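/- Let $N\ge 1$, $m>0$, $\varepsilon>0$. Let $W:[0,\infty)\to\mathbb R$ be $C^2$ with $W(0)=W'(0)=W''(0)=0$, $|W''(s)|\le c_1 s^{q-2}+c_2 s^{p-2}$ for some $2<q\le p<2^*$ (where $2^*=\frac{2N}{N-2}$ if $N\ge3$ and $2^*=\infty$ otherwise), $W(s)\ge -c\,s^{\nu}$ for $s$ large, for some $c\ge 0$ and $2<\nu<2+\frac4N$, and $W(s_0)<0$ for some $s_0>0$. Let $V:\mathbb R^N\to\mathbb R$ be $C^2$ with bounded derivatives and $0\le V\le V_0<\infty$. Put $W_\varepsilon(z)=\varepsilon^{-(N+2)}W(\varepsilon^{N/2}|z|)$ and $W_\varepsilon'(z)=\varepsilon^{-(N/2+2)}W'(\varepsilon^{N/2}|z|)\frac{z}{|z|}$ for $z\in\mathbb C$. Let $\psi_\varepsilon\in C^0(\mathbb R,H^2(\mathbb R^N))\cap C^1(\mathbb R,L^2(\mathbb R^N))$ be a solution of $$i\,\partial_t\psi_\varepsilon=-\tfrac1{2m}\Delta\psi_\varepsilon+\tfrac12W_\varepsilon'(\psi_\varepsilon)+V\psi_\varepsilon .$$ Write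 $\psi_\varepsilon=u_\varepsilon e^{iS_\varepsilon}$ with $u_\varepsilon=|\psi_\varepsilon|$, so that $u_\varepsilon^2\nabla S_\varepsilon=\operatorname{Im}(\overline{\psi_\varepsilon}\nabla\psi_\varepsilon)$, and let $T$ be the stress tensor $$T_{jk}=-\tfrac1m\operatorname{Re}\big(\partial_{x_j}\psi_\varepsilon\,\overline{\partial_{x_k}\psi_\varepsilon}\big)+\delta_{jk}\Big[\tfrac1{4m}\Delta|\psi_\varepsilon|^2-\tfrac12W_\varepsilon'(\psi_\varepsilon)\overline{\psi_\varepsilon}+W_\varepsilon(\psi_\varepsilon)\Big],$$ which is normalized so that $\partial_t(u_\varepsilon^2\nabla S_\varepsilon)=-u_\varepsilon^2\nabla V+\nabla\cdot T$. Let $\rho_\varepsilon\in C^1(\mathbb R\times\mathbb R^N)$ be real-valued with $\rho_\varepsilon(t,x)\to0$ as $|x|\to\infty$, uniformly for $t$ in bounded intervals, and suppose that $\partial_t\rho_\varepsilon+\nabla\cdot J_{\rho_\varepsilon}=0$ for some $J_{\rho_\varepsilon}\in C^1(\mathbb R\times\mathbb R^N;\mathbb R^N)$. Let $\varphi(s)=0$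 for $s\le1$, $\varphi(s)=s-1$ for $1\le s\le2$, $\varphi(s)=1$ for $s\ge2$, and put $$\Psi_\varepsilon=\psi_\varepsilon\sqrt{\varphi(\rho_\varepsilon)},\qquad \Sigma_{\varepsilon,t}=\{x: 1<\rho_\varepsilon(t,x)<2\},$$ $$m_\varepsilon=m\int|\Psi_\varepsilon|^2dx,\qquad q_\varepsilon=\frac{\int x|\Psi_\varepsilon|^2dx}{\int|\Psi_\varepsilon|^2dx},\qquad p_\varepsilon=\int\nabla S_\varepsilon|\Psi_\varepsilon|^2dx .$$ Then all the integrals that occur here and below converge absolutely for every $t$. The function $p_\varepsilon$ is locally Lipschitz on $\mathbb R$, $q_\varepsilon$ is locally Lipschitz where $m_\varepsilon>0$, and the equations $$\dot q_\varepsilon=\frac{p_\varepsilon}{m_\varepsilon}+\frac1{m_\varepsilon}\int_{\Sigma_{\varepsilon,t}}(x-q_\varepsilon)\big[u_\varepsilon^2\nabla S_\varepsilon\cdot\nabla\rho_\varepsilon-m\,u_\varepsilon^2\,\nabla\cdot J_{\rho_\varepsilon}\big]dx\qquad(\text{when } m_\varepsilon(t)>0),$$ $$\dot p_\varepsilon=-\int\nabla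 V|\Psi_\varepsilon|^2dx-\int_{\Sigma_{\varepsilon,t}}\big[T\cdot\nabla\rho_\varepsilon+u_\varepsilon^2\nabla S_\varepsilon(\nabla\cdot J_{\rho_\varepsilon})\big]dx$$ hold at every time $t$ at which $\nabla\cdot J_{\rho_\varepsilon}(t,x)=0$ for almost every $x$ with $\rho_\varepsilon(t,x)\in\{1,2\}$ (for instance, if the level sets $\{\rho_\varepsilon(t,\cdot)=1\}$ and $\{\rho_\varepsilon(t,\cdot)=2\}$ are null sets). Almost every $t$ has this property. -/

import Mathlib

open MeasureTheory Filter Topology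

noncomputable section

namespace NLSSoliton

/-- Physical space `ℝ^N` with its Euclidean structure. -/
abbrev E (N : ℕ) := EuclideanSpace ℝ (Fin N)

/-- The complex Hilbert space `L²(ℝ^N)`. -/
abbrev L2 (N : ℕ) := Lp ℂ 2 (volume : Measure (E N))

variable {N : ℕ}

/-- The `j`-th vector of the canonical basis. -/
def basisVec (j : Fin N) : E N := EuclideanSpace.single j 1

/-- `g` is the weak partial derivative `∂f/∂x_j`, for `f, g ∈ L²`. -/
def HasWeakPartial (j : Fin N) (f g : L2 N) : Prop :=
  ∀ η : E N → ℝ, ContDiff ℝ (⊤ : ℕ∞) η → HasCompactSupport η →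
    ∫ x, fderiv ℝ η x (basisVec j) • f x = - ∫ x, η x • g x

open Classical in
/-- The weak partial derivative in `L²` (zero if there is none). -/
def weakPartial (j : Fin N) (f : L2 N) : L2 N :=
  if h : ∃ g, HasWeakPartial j f g then h.choose else 0

/-- `f ∈ H²(ℝ^N)`: all weak derivatives of order one and two exist in `L²`. -/
def MemH2 (f : L2 N) : Prop :=
  (∀ j, ∃ g, HasWeakPartial j f g) ∧
    ∀ j k, ∃ g, HasWeakPartial k (weakPartial j f) g

/-- The Laplacian of `f ∈ H²`. -/
def laplace (f : L2 N) : L2 N := ∑ j, weakPartial j (weakPartial j f)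

/-- `g = Δf` in the sense of distributions, for locally integrable `f, g`. -/
def HasWeakLaplacian (f g : E N → ℝ) : Prop :=
  LocallyIntegrable f ∧ LocallyIntegrable g ∧
    ∀ η : E N → ℝ, ContDiff ℝ (⊤ : ℕ∞) η → HasCompactSupport η →
      ∫ x, f x * Laplacian.laplacian η x = ∫ x, g x * η x

open Classical in
/-- The distributional Laplacian of `f` as a locally integrable function (zero if it is none);
determined up to a null set. -/
def weakLaplacian (f : E N → ℝ) : E N → ℝ :=
  if h : ∃ g, HasWeakLaplacian f g then h.choose else 0

/-- The derivative of a function on the half-line `[0, ∞)` (one-sided at `0`). -/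
def halfLineDeriv (W : ℝ → ℝ) : ℝ → ℝ := derivWithin W (Set.Ici 0)

/-- The assumptions on the nonlinearity `W : [0, ∞) → ℝ` in dimension `N`. Only the values of `W`
on `[0, ∞)` matter. -/
structure NonlinearityAssumption (N : ℕ) (W : ℝ → ℝ) : Prop where
  contDiffOn : ContDiffOn ℝ 2 W (Set.Ici 0)
  zero : W 0 = 0
  deriv_zero : halfLineDeriv W 0 = 0
  deriv2_zero : halfLineDeriv (halfLineDeriv W) 0 = 0
  /-- Subcritical growth, `2 < q ≤ p < 2^*`, where `2^* = 2N/(N-2)` for `N ≥ 3` and `2^* = ∞`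
  for `N ≤ 2`. -/
  growth : ∃ c₁ c₂ p q : ℝ, 2 < q ∧ q ≤ p ∧ (3 ≤ N → p < 2 * N / ((N : ℝ) - 2)) ∧
    ∀ s : ℝ, 0 ≤ s → |halfLineDeriv (halfLineDeriv W) s| ≤ c₁ * s ^ (q - 2) + c₂ * s ^ (p - 2)
  lower : ∃ c ν s₁ : ℝ, 0 ≤ c ∧ 2 < ν ∧ ν < 2 + 4 / (N : ℝ) ∧
    ∀ s : ℝ, 0 ≤ s → s₁ ≤ s → - c * s ^ ν ≤ W s
  negative : ∃ s₀ : ℝ, 0 < s₀ ∧ W s₀ < 0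

/-- The assumptions on the potential: `C²`, bounded derivatives, `0 ≤ V ≤ V₀`. -/
structure PotentialAssumption (V : E N → ℝ) : Prop where
  contDiff : ContDiff ℝ 2 V
  bounded_deriv : ∃ C : ℝ, ∀ x, ‖iteratedFDeriv ℝ 1 V x‖ ≤ C ∧ ‖iteratedFDeriv ℝ 2 V x‖ ≤ C
  bounded : ∃ V₀ : ℝ, ∀ x, 0 ≤ V x ∧ V x ≤ V₀

/-- `W_ε(z) = ε^{-(N+2)} W(ε^{N/2} |z|)`. -/
def Weps (N : ℕ) (ε : ℝ) (W : ℝ → ℝ) (z : ℂ) : ℝ :=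
  1 / ε ^ (N + 2) * W (ε ^ ((N : ℝ) / 2) * ‖z‖)

/-- `W_ε'(z) = ε^{-(N/2+2)} W'(ε^{N/2} |z|) z / |z|` (zero for `z = 0`). -/
def WepsPrime (N : ℕ) (ε : ℝ) (W : ℝ → ℝ) (z : ℂ) : ℂ :=
  ((1 / ε ^ ((N : ℝ) / 2 + 2) * halfLineDeriv W (ε ^ ((N : ℝ) / 2) * ‖z‖) : ℝ) : ℂ) * (z / ‖z‖)

/-- `ψ ∈ C⁰(ℝ, H²) ∩ C¹(ℝ, L²)` solves
`i ∂_t ψ = -(1/2m) Δψ + (1/2) W_ε'(ψ) + V ψ`. -/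
structure IsSolution (m ε : ℝ) (W : ℝ → ℝ) (V : E N → ℝ) (ψ : ℝ → L2 N) : Prop where
  contDiff : ContDiff ℝ 1 ψ
  memH2 : ∀ t, MemH2 (ψ t)
  continuous_one : ∀ j, Continuous fun t => weakPartial j (ψ t)
  continuous_two : ∀ j k, Continuous fun t => weakPartial k (weakPartial j (ψ t))
  equation : ∀ t, ∀ᵐ x : E N,
    Complex.I * deriv ψ t x
      = -(1 / (2 * (m : ℂ))) * laplace (ψ t) x + 1 / 2 * WepsPrime N ε W (ψ t x)
        + (V x : ℂ) * ψ t x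

/-- The divergence of a vector field. -/
def divergence (F : E N → E N) (x : E N) : ℝ := ∑ j, fderiv ℝ F x (basisVec j) j

/-- The assumptions on the density `ρ` and its flow `J`. -/
structure IsDensity (ρ : ℝ → E N → ℝ) (J : ℝ → E N → E N) : Prop where
  contDiff : ContDiff ℝ 1 fun z : ℝ × E N => ρ z.1 z.2
  /-- `ρ(t,x) → 0` as `|x| → ∞`, uniformly for `t` in bounded intervals. -/
  decay : ∀ τ : ℝ, ∀ δ > 0, ∃ R : ℝ, ∀ t x, |t| ≤ τ → R ≤ ‖x‖ → |ρ t x| < δ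
  contDiff_flow : ContDiff ℝ 1 fun z : ℝ × E N => J z.1 z.2
  continuity : ∀ t x, deriv (fun s => ρ s x) t + divergence (J t) x = 0

/-- The cutoff `φ`. -/
def cutoff (s : ℝ) : ℝ := if s ≤ 1 then 0 else if s ≤ 2 then s - 1 else 1

/-- The soliton `Ψ = ψ χ` with `χ = √(φ(ρ))`. -/
def soliton (ψ : ℝ → L2 N) (ρ : ℝ → E N → ℝ) (t : ℝ) (x : E N) : ℂ :=
  ψ t x * (√(cutoff (ρ t x)) : ℝ)

/-- The gradient of the phase of `f = u e^{iS} ∈ H¹`, that is `∇S = Im (f̄ ∇f) / |f|²`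
(set to zero where `f = 0`). -/
def gradPhase (f : L2 N) (x : E N) : E N :=
  WithLp.toLp 2 fun j => (starRingEnd ℂ (f x) * weakPartial j f x).im / ‖f x‖ ^ 2

/-- The stress tensor, normalized so that the local momentum balance is
`∂_t (u² ∇S) = -u² ∇V + ∇ · T`. -/
def stress (m ε : ℝ) (W : ℝ → ℝ) (f : L2 N) (x : E N) : Matrix (Fin N) (Fin N) ℝ :=
  fun j k =>
    -(1 / m) * (weakPartial j f x * starRingEnd ℂ (weakPartial k f x)).re
      + (if j = k then
          1 / (4 * m) * weakLaplacian (fun y => ‖f y‖ ^ 2) x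
            - 1 / 2 * (WepsPrime N ε W (f x) * starRingEnd ℂ (f x)).re + Weps N ε W (f x)
        else 0)

/-- `∫ |Ψ|² dx`. -/
def charge (ψ : ℝ → L2 N) (ρ : ℝ → E N → ℝ) (t : ℝ) : ℝ :=
  ∫ x, ‖soliton ψ ρ t x‖ ^ 2

/-- The mass `m_ε = m ∫ |Ψ|² dx` of the soliton. -/
def mass (m : ℝ) (ψ : ℝ → L2 N) (ρ : ℝ → E N → ℝ) (t : ℝ) : ℝ := m * charge ψ ρ t

/-- The barycenter `q = ∫ x |Ψ|² dx / ∫ |Ψ|² dx` of the soliton. -/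
def barycenter (ψ : ℝ → L2 N) (ρ : ℝ → E N → ℝ) (t : ℝ) : E N :=
  (charge ψ ρ t)⁻¹ • ∫ x, ‖soliton ψ ρ t x‖ ^ 2 • x

/-- The momentum `p = ∫ ∇S |Ψ|² dx` of the soliton. -/
def momentum (ψ : ℝ → L2 N) (ρ : ℝ → E N → ℝ) (t : ℝ) : E N :=
  ∫ x, ‖soliton ψ ρ t x‖ ^ 2 • gradPhase (ψ t) x

/-- The halo `Σ_t = {x | 1 < ρ(t,x) < 2}`. -/
def halo (ρ : ℝ → E N → ℝ) (t : ℝ) : Set (E N) := {x | 1 < ρ t x ∧ ρ t x < 2}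

/-- The integrand `(x - q) [u² ∇S · ∇ρ - m u² ∇ · J]` over the halo in the equation for `q`. -/
def haloVelocity (m : ℝ) (ψ : ℝ → L2 N) (ρ : ℝ → E N → ℝ) (J : ℝ → E N → E N) (t : ℝ)
    (x : E N) : E N :=
  (‖ψ t x‖ ^ 2 * inner ℝ (gradPhase (ψ t) x) (gradient (ρ t) x)
      - m * ‖ψ t x‖ ^ 2 * divergence (J t) x) • (x - barycenter ψ ρ t)

/-- The integrand `T · ∇ρ + u² ∇S (∇ · J)` over the halo in the equation for `p`. -/
def haloForce (m ε : ℝ) (W : ℝ → ℝ) (ψ : ℝ → L2 N) (ρ : ℝ → E N → ℝ) (J : ℝ → E N → E N)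
    (t : ℝ) (x : E N) : E N :=
  WithLp.toLp 2 ((stress m ε W (ψ t) x).mulVec (gradient (ρ t) x).ofLp)
    + (‖ψ t x‖ ^ 2 * divergence (J t) x) • gradPhase (ψ t) x

/-- The equation of motion of the barycenter at time `t`:
`q' = p / m_ε + (1 / m_ε) ∫_Σ (x - q) [u² ∇S · ∇ρ - m u² ∇ · J] dx`. -/
def BarycenterEquation (m : ℝ) (ψ : ℝ → L2 N) (ρ : ℝ → E N → ℝ) (J : ℝ → E N → E N)
    (t : ℝ) : Prop :=
  HasDerivAt (barycenter ψ ρ)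
    ((1 / mass m ψ ρ t) • momentum ψ ρ t
      + (1 / mass m ψ ρ t) • ∫ x in halo ρ t, haloVelocity m ψ ρ J t x) t

/-- The equation of motion of the momentum at time `t`:
`p' = -∫ ∇V |Ψ|² dx - ∫_Σ [T · ∇ρ + u² ∇S (∇ · J)] dx`. -/
def MomentumEquation (m ε : ℝ) (W : ℝ → ℝ) (V : E N → ℝ) (ψ : ℝ → L2 N) (ρ : ℝ → E N → ℝ)
    (J : ℝ → E N → E N) (t : ℝ) : Prop :=
  HasDerivAt (momentum ψ ρ)
    (- (∫ x, ‖soliton ψ ρ t x‖ ^ 2 • gradient V x)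
      - ∫ x in halo ρ t, haloForce m ε W ψ ρ J t x) t

/-- The time `t` is regular: at almost every point `x` of the levels `ρ = 1` and `ρ = 2`, where
the cutoff `φ` has its kinks, `∂_t ρ(t,x) = -∇ · J(t,x)` vanishes. In particular `t` is regular
if both levels are null sets. -/
def IsRegularTime (ρ : ℝ → E N → ℝ) (J : ℝ → E N → E N) (t : ℝ) : Prop :=
  ∀ᵐ x : E N, (ρ t x = 1 ∨ ρ t x = 2) → divergence (J t) x = 0

end NLSSoliton

end

open NLSSoliton

/-!
The charge, its first moments and the momentum are real or imaginary parts of pairings `∫ β f̄ h`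
with `f, h ∈ L²` and a bounded weight `β = ω φ(ρ)`, where `φ` is the cutoff and `ω` is `1` or a
coordinate. The equations of motion follow by differentiating such pairings in time, once with
the solution moving and the weight frozen, once with the weight moving.

*The weight.* By the equation of continuity `∂_t φ(ρ) = -1_{1 < ρ < 2} ∇ · J` wherever `ρ ∉ {1, 2}`
or `∂_t ρ = 0`, so at a regular time almost everywhere. Since `φ` is Lipschitz and `ρ > 1` only on a
bounded set, dominated convergence applies (`IsDensity.hasDerivAt_pairing`). Along a line `{x} × ℝ`
the times with `ρ = 1` or `ρ = 2` and `∂_t ρ ≠ 0` are isolated, hence countable, and Fubini's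
theorem shows that almost every time is regular (`IsDensity.ae_isRegularTime`).

*The solution.* For the charge and its first moments the derivative is `2 Re ∫ β ψ̄ ∂_t ψ`. For the
momentum `Im ∫ β ψ̄ ∂_j ψ` the factor `∂_j ψ` is only continuous in time; integration by parts moves
`∂_j` from its increment to the other factors, which shows that the pairing is Lipschitz and
differentiable for a frozen weight (`IsDensity.exists_lipschitz_pairing_partial`,
`IsDensity.hasDerivAt_pairing_partial`). Inserting the equation and integrating by parts again gives
the balance laws of charge and momentum (`IsSolution.two_mul_re_pairing`,
`IsSolution.im_pairing_force`), where the derivative of the weight produces the integrals over the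
halo. These integrations by parts are legitimate although `φ` has kinks, because `φ` is the limit of
`C¹` functions whose derivatives converge everywhere to the indicator of `(1, 2)`
(`HasLocalPartial.integral_cutWeight`).

*Calculus in `L²`.* The weak derivative `∂_j f` is the derivative at `0` of the translates
`s ↦ f(· + s e_j)` in `L²` (`HasWeakPartial.hasDerivAt_translate`). Hence the product rule for
`f̄ h` comes from differentiating a pairing of translates, and the chain rule for `A(|f|)` from the
differentiability of `f ↦ ∫ β A(|f|)` on `L²`, at first for Lipschitz `A'`.

*The nonlinearity.* The equation itself shows that `W_ε'(ψ)` belongs to `L²`, since all other terms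
do. The chain rule for `W_ε(ψ)` then follows by truncation, as soon as `W_ε(ψ)` is known to be
locally integrable. Testing the chain rule for the primitive of `|W_ε'|` with `arctan x_j` bounds
its integral against `1 / (1 + x_j²)` by the norms of `W_ε'(ψ)` and `∂_j ψ`
(`HasWeakPartial.locallyIntegrable_integral_abs`).
-/

namespace NLSSoliton

variable {N : ℕ}

open scoped ComplexConjugate

/-! ### Weak partial derivatives in `L²` -/

theorem norm_basisVec (j : Fin N) : ‖(basisVec j : E N)‖ = 1 := by
  simp [basisVec]

theorem locallyIntegrable_coeFn (f : L2 N) : LocallyIntegrable (fun x => f x) :=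
  (Lp.memLp f).locallyIntegrable (by norm_num)

theorem contDiff_fderiv_apply {η : E N → ℝ} (hη : ContDiff ℝ (⊤ : ℕ∞) η) (v : E N) :
    ContDiff ℝ (⊤ : ℕ∞) (fun x => fderiv ℝ η x v) :=
  (hη.fderiv_right (m := (⊤ : ℕ∞)) (by simp)).clm_apply contDiff_const

theorem hasWeakPartial_weakPartial {j : Fin N} {f : L2 N} (h : ∃ g, HasWeakPartial j f g) :
    HasWeakPartial j f (weakPartial j f) := by
  rw [weakPartial, dif_pos h]
  exact h.choose_spec

theorem integral_smul_sub {η : E N → ℝ} (hη : Continuous η) (hc : HasCompactSupport η)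
    (f g : L2 N) : ∫ x, η x • (f - g) x = (∫ x, η x • f x) - ∫ x, η x • g x := by
  rw [← integral_sub ((locallyIntegrable_coeFn f).integrable_smul_left_of_hasCompactSupport hη hc)
    ((locallyIntegrable_coeFn g).integrable_smul_left_of_hasCompactSupport hη hc)]
  refine integral_congr_ae ?_
  filter_upwards [Lp.coeFn_sub f g] with x hx
  rw [hx, Pi.sub_apply, smul_sub]

theorem HasWeakPartial.sub {j : Fin N} {f g f' g' : L2 N} (hf : HasWeakPartial j f f')
    (hg : HasWeakPartial j g g') : HasWeakPartial j (f - g) (f' - g') := by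
  intro η hη hc
  rw [integral_smul_sub hη.continuous hc,
    integral_smul_sub (contDiff_fderiv_apply hη _).continuous (hc.fderiv_apply ℝ _),
    hf η hη hc, hg η hη hc]
  ring

theorem fderiv_fderiv_apply_comm {η : E N → ℝ} (hη : ContDiff ℝ (⊤ : ℕ∞) η) (v w x : E N) :
    fderiv ℝ (fun y => fderiv ℝ η y v) x w = fderiv ℝ (fun y => fderiv ℝ η y w) x v := by
  have hd : DifferentiableAt ℝ (fderiv ℝ η) x :=
    ((hη.fderiv_right (m := (⊤ : ℕ∞)) (by simp)).differentiable (by simp)) x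
  rw [fderiv_clm_apply hd (differentiableAt_const _),
    fderiv_clm_apply hd (differentiableAt_const _)]
  have := (hη.contDiffAt (x := x)).isSymmSndFDerivAt
    (by simpa using (WithTop.coe_le_coe.2 le_top :
      ((2 : ℕ∞) : WithTop ℕ∞) ≤ ((⊤ : ℕ∞) : WithTop ℕ∞)))
  simpa using this.eq w v

/-- Weak partial derivatives commute. -/
theorem HasWeakPartial.comm {j k : Fin N} {f fj fk fjk : L2 N} (hj : HasWeakPartial j f fj)
    (hk : HasWeakPartial k f fk) (hjk : HasWeakPartial k fj fjk) : HasWeakPartial j fk fjk := by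
  intro η hη hc
  have h1 := hk _ (contDiff_fderiv_apply hη (basisVec j)) (hc.fderiv_apply ℝ _)
  have h2 := hj _ (contDiff_fderiv_apply hη (basisVec k)) (hc.fderiv_apply ℝ _)
  have h3 := hjk η hη hc
  simp_rw [fderiv_fderiv_apply_comm hη (basisVec j) (basisVec k)] at h1
  rw [h2, h3] at h1
  rw [← neg_eq_iff_eq_neg.2 h1]
  simp

/-! ### Translations -/

/-- Translation `f ↦ f(· + s e_j)` on `L²`. -/
noncomputable def translate (j : Fin N) (s : ℝ) : L2 N →ₗᵢ[ℂ] L2 N :=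
  Lp.compMeasurePreservingₗᵢ ℂ (fun x : E N => x + s • basisVec j)
    (measurePreserving_add_right volume _)

theorem coeFn_translate (j : Fin N) (s : ℝ) (f : L2 N) :
    ∀ᵐ x, translate j s f x = f (x + s • basisVec j) :=
  Lp.coeFn_compMeasurePreserving f (measurePreserving_add_right volume (s • basisVec j))

theorem translate_zero (j : Fin N) (f : L2 N) : translate j 0 f = f := by
  apply Lp.ext
  filter_upwards [coeFn_translate j 0 f] with x hx
  simpa using hx

theorem continuous_translate (j : Fin N) (f : L2 N) : Continuous fun s => translate j s f := by
  let G : C(ℝ × E N, E N) := ⟨fun z => z.2 + z.1 • basisVec j, by fun_prop⟩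
  exact (continuous_const (y := f)).compMeasurePreservingLp G.curry.continuous
    (fun s => measurePreserving_add_right volume (s • basisVec j)) (by simp)

theorem hasDerivAt_line {β : E N → ℝ} (hβ : ContDiff ℝ 1 β) (e x : E N) (s : ℝ) :
    HasDerivAt (fun s : ℝ => β (x - s • e)) (-fderiv ℝ β (x - s • e) e) s := by
  have h1 : HasDerivAt (fun s : ℝ => x - s • e) (-e) s := by
    simpa using ((hasDerivAt_id s).smul_const e).const_sub x
  have h2 := (hβ.differentiable (by simp) (x - s • e)).hasFDerivAt.comp_hasDerivAt s h1
  rw [map_neg] at h2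
  exact h2

section
variable {F : Type*} [NormedAddCommGroup F] [NormedSpace ℝ F]

/-- Differentiation of `∫ β(x - s e_j) U(x) dx` at `s = 0` under the integral sign. -/
theorem hasDerivAt_integral_translate {j : Fin N} {U : E N → F} {β Φ : E N → ℝ}
    (hβ : ContDiff ℝ 1 β) (hU : AEStronglyMeasurable U) (hint : Integrable fun x => β x • U x)
    (hΦ : Integrable Φ)
    (hb : ∀ s ∈ Metric.ball (0 : ℝ) 1, ∀ x,
      |fderiv ℝ β (x - s • basisVec j) (basisVec j)| * ‖U x‖ ≤ Φ x) :
    HasDerivAt (fun s : ℝ => ∫ x, β (x - s • basisVec j) • U x)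
      (-∫ x, fderiv ℝ β x (basisVec j) • U x) 0 := by
  have hc : Continuous fun x => fderiv ℝ β x (basisVec j) :=
    (hβ.continuous_fderiv (by simp)).clm_apply continuous_const
  have key := (hasDerivAt_integral_of_dominated_loc_of_deriv_le (μ := (volume : Measure (E N)))
    (F := fun (s : ℝ) x => β (x - s • basisVec j) • U x)
    (F' := fun (s : ℝ) x => (-fderiv ℝ β (x - s • basisVec j) (basisVec j)) • U x)
    (x₀ := (0 : ℝ)) (bound := Φ) (Metric.ball_mem_nhds 0 one_pos)
    (.of_forall fun s => (hβ.continuous.comp (by fun_prop)).aestronglyMeasurable.smul hU)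
    (by simpa using hint)
    ((hc.comp (by fun_prop : Continuous fun x : E N =>
      x - (0 : ℝ) • basisVec j)).neg.aestronglyMeasurable.smul hU)
    (.of_forall fun x s hs => by
      rw [norm_smul, norm_neg, Real.norm_eq_abs]; exact hb s hs x) hΦ
    (.of_forall fun x s _ => (hasDerivAt_line hβ _ x s).smul_const (U x))).2
  simpa [integral_neg] using key

theorem hasDerivAt_integral_translate_of_compact {j : Fin N} {U : E N → F} {β : E N → ℝ}
    (hβ : ContDiff ℝ 1 β) (hc : HasCompactSupport β) (hU : LocallyIntegrable U) :
    HasDerivAt (fun s : ℝ => ∫ x, β (x - s • basisVec j) • U x)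
      (-∫ x, fderiv ℝ β x (basisVec j) • U x) 0 := by
  have hc' : Continuous fun x => fderiv ℝ β x (basisVec j) :=
    (hβ.continuous_fderiv (by simp)).clm_apply continuous_const
  obtain ⟨C, hC⟩ := hc'.bounded_above_of_compact_support (hc.fderiv_apply ℝ _)
  obtain ⟨R, hR⟩ := (Metric.isBounded_iff_subset_closedBall 0).1
    (hc.fderiv_apply ℝ (basisVec j)).isBounded
  have hC0 : 0 ≤ C := (norm_nonneg _).trans (hC 0)
  have hK : IntegrableOn U (Metric.closedBall 0 (R + 1)) :=
    hU.integrableOn_isCompact (isCompact_closedBall _ _)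
  refine hasDerivAt_integral_translate hβ hU.aestronglyMeasurable
    (hU.integrable_smul_left_of_hasCompactSupport hβ.continuous hc)
    (Φ := (Metric.closedBall 0 (R + 1)).indicator fun x => C * ‖U x‖)
    ((integrable_indicator_iff measurableSet_closedBall).2 (hK.norm.const_mul C)) ?_
  intro s hs x
  by_cases hx : x ∈ Metric.closedBall 0 (R + 1)
  · rw [Set.indicator_of_mem hx]
    exact mul_le_mul_of_nonneg_right (hC _) (norm_nonneg _)
  · rw [Set.indicator_of_notMem hx]
    have : x - s • basisVec j ∉ tsupport fun x => fderiv ℝ β x (basisVec j) := by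
      intro hmem
      have h1 := hR hmem
      rw [mem_closedBall_zero_iff] at h1 hx
      apply hx
      have h2 : ‖s • (basisVec j : E N)‖ ≤ 1 := by
        rw [norm_smul, norm_basisVec, mul_one]
        exact (mem_ball_zero_iff.1 hs).le
      calc ‖x‖ = ‖(x - s • basisVec j) + s • basisVec j‖ := by simp
        _ ≤ _ := (norm_add_le _ _).trans (add_le_add h1 h2)
    have h0 := image_eq_zero_of_notMem_tsupport this
    rw [h0]; simp

theorem hasDerivAt_integral_translate_of_bounded {j : Fin N} {U : E N → F} {β : E N → ℝ}
    {B C : ℝ} (hβ : ContDiff ℝ 1 β) (hB : ∀ x, |β x| ≤ B)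
    (hC : ∀ x, |fderiv ℝ β x (basisVec j)| ≤ C) (hU : Integrable U) :
    HasDerivAt (fun s : ℝ => ∫ x, β (x - s • basisVec j) • U x)
      (-∫ x, fderiv ℝ β x (basisVec j) • U x) 0 :=
  hasDerivAt_integral_translate hβ hU.aestronglyMeasurable
    (hU.bdd_smul B hβ.continuous.aestronglyMeasurable (.of_forall hB))
    (hU.norm.const_mul C) fun _ _ _ => mul_le_mul_of_nonneg_right (hC _) (norm_nonneg _)

end

/-- Moving a translation from one factor to the other. -/
theorem integral_smul_add_right {F : Type*} [NormedAddCommGroup F] [NormedSpace ℝ F]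
    (β : E N → ℝ) (U : E N → F) (v : E N) :
    ∫ x, β x • U (x + v) = ∫ x, β (x - v) • U x := by
  have := integral_sub_right_eq_self (μ := (volume : Measure (E N)))
    (fun x => β x • U (x + v)) v
  simpa using this.symm

/-- The fundamental theorem of calculus along a coordinate direction, in `L²`. -/
theorem HasWeakPartial.translate_sub {j : Fin N} {f g : L2 N} (h : HasWeakPartial j f g) (s : ℝ) :
    translate j s f - f = ∫ σ in (0 : ℝ)..s, translate j σ g := by
  apply Lp.ext
  refine ae_eq_of_integral_contDiff_smul_eq (locallyIntegrable_coeFn _)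
    (locallyIntegrable_coeFn _) fun η hη hc => ?_
  have hmem : MemLp (fun x => (η x : ℂ)) 2 (volume : Measure (E N)) :=
    (Complex.continuous_ofReal.comp hη.continuous).memLp_of_hasCompactSupport
      (hc.comp_left Complex.ofReal_zero)
  have hℓ : ∀ u : L2 N, innerSL ℂ (hmem.toLp _) u = ∫ x, η x • u x := by
    intro u
    rw [innerSL_apply_apply, L2.inner_def]
    refine integral_congr_ae ?_
    filter_upwards [hmem.coeFn_toLp] with x hx
    rw [hx]
    simp [mul_comm]
  have hF : ∀ (u : L2 N) (σ : ℝ),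
      ∫ x, η x • translate j σ u x = ∫ x, η (x - σ • basisVec j) • u x := by
    intro u σ
    rw [← integral_smul_add_right]
    refine integral_congr_ae ?_
    filter_upwards [coeFn_translate j σ u] with x hx
    rw [hx]
  have hder : ∀ σ : ℝ, HasDerivAt (fun σ => ∫ x, η (x - σ • basisVec j) • f x)
      (∫ x, η (x - σ • basisVec j) • g x) σ := by
    intro σ
    have hη' : ContDiff ℝ (⊤ : ℕ∞) fun x => η (x - σ • basisVec j) :=
      hη.comp (contDiff_id.sub contDiff_const)
    have hc' : HasCompactSupport fun x => η (x - σ • basisVec j) :=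
      hc.comp_homeomorph (Homeomorph.subRight (σ • basisVec j))
    have h1 := hasDerivAt_integral_translate_of_compact (j := j) (hη'.of_le (by simp)) hc'
      (locallyIntegrable_coeFn f)
    rw [h _ hη' hc', neg_neg] at h1
    have h2 := HasDerivAt.comp_sub_const σ σ (by rwa [sub_self])
    refine h2.congr_of_eventuallyEq (.of_forall fun u => ?_)
    simp only
    congr 1 with x
    rw [sub_smul, sub_sub, sub_add_cancel]
  have hcont : Continuous fun σ : ℝ => ∫ x, η (x - σ • basisVec j) • g x := by
    simp_rw [← hF, ← hℓ]
    exact (innerSL ℂ (hmem.toLp _)).continuous.comp (continuous_translate j g)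
  have hftc := intervalIntegral.integral_eq_sub_of_hasDerivAt (a := 0) (b := s)
    (fun σ _ => hder σ) (hcont.intervalIntegrable _ _)
  rw [integral_smul_sub hη.continuous hc, hF f s]
  simp only [zero_smul, sub_zero] at hftc
  rw [← hftc, ← hℓ, ← ContinuousLinearMap.intervalIntegral_comp_comm _
    ((continuous_translate j g).intervalIntegrable _ _)]
  simp_rw [hℓ, hF]

/-- The weak derivative is the derivative of the translation group. -/
theorem HasWeakPartial.hasDerivAt_translate {j : Fin N} {f g : L2 N} (h : HasWeakPartial j f g) :
    HasDerivAt (fun s => translate j s f) g 0 := by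
  have hc := continuous_translate j g
  have h1 : HasDerivAt (fun s => ∫ σ in (0 : ℝ)..s, translate j σ g) (translate j 0 g) 0 :=
    intervalIntegral.integral_hasDerivAt_right (hc.intervalIntegrable _ _)
      hc.stronglyMeasurable.stronglyMeasurableAtFilter hc.continuousAt
  rw [translate_zero] at h1
  refine (h1.add_const f).congr_of_eventuallyEq (.of_forall fun s => ?_)
  simp only [← h.translate_sub s, sub_add_cancel]

/-! ### Weighted pairings in `L²` -/

/-- `β` is a measurable function with `|β| ≤ B`. -/
structure IsBoundedWeight (β : E N → ℝ) (B : ℝ) : Prop where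
  aestronglyMeasurable : AEStronglyMeasurable β
  bound : ∀ x, |β x| ≤ B

/-- The sesquilinear pairing `∫ β f̄ h` with a real weight `β`. -/
noncomputable def pairing (β : E N → ℝ) (f h : L2 N) : ℂ := ∫ x, (β x : ℂ) * (conj (f x) * h x)

theorem conj_pairing (β : E N → ℝ) (f h : L2 N) : conj (pairing β f h) = pairing β h f := by
  rw [pairing, pairing, ← integral_conj]
  congr 1 with x
  simp only [map_mul, Complex.conj_conj, Complex.conj_ofReal]
  ring

theorem ofReal_smul_eq (c : ℝ) (f : L2 N) : (c : ℂ) • f = c • f := by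
  apply Lp.ext
  filter_upwards [Lp.coeFn_smul (c : ℂ) f, Lp.coeFn_smul c f] with x h1 h2
  rw [h1, h2, Pi.smul_apply, Pi.smul_apply, Complex.coe_smul]

theorem norm_sq_eq_integral (f : L2 N) : ‖f‖ ^ 2 = ∫ x, ‖f x‖ ^ 2 := by
  rw [← real_inner_self_eq_norm_sq, L2.inner_def]
  simp only [real_inner_self_eq_norm_sq]

namespace IsBoundedWeight

variable {β : E N → ℝ} {B : ℝ} (hβ : IsBoundedWeight β B)
include hβ

theorem nonneg : 0 ≤ B := (abs_nonneg _).trans (hβ.bound 0)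

theorem memLp_mul (h : L2 N) : MemLp (fun x => (β x : ℂ) * h x) 2 :=
  (Lp.memLp h).of_le_mul (c := B)
    ((Complex.continuous_ofReal.comp_aestronglyMeasurable hβ.aestronglyMeasurable).mul
      (Lp.aestronglyMeasurable h))
    (.of_forall fun x => by
      rw [norm_mul, Complex.norm_real]
      exact mul_le_mul_of_nonneg_right (hβ.bound x) (norm_nonneg _))

/-- Multiplication by a bounded weight, as an operator on `L²`. -/
noncomputable def mulL : L2 N →L[ℂ] L2 N :=
  LinearMap.mkContinuous
    { toFun := fun h => (hβ.memLp_mul h).toLp _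
      map_add' := fun f h => by
        apply Lp.ext
        filter_upwards [(hβ.memLp_mul (f + h)).coeFn_toLp, (hβ.memLp_mul f).coeFn_toLp,
          (hβ.memLp_mul h).coeFn_toLp, Lp.coeFn_add f h,
          Lp.coeFn_add ((hβ.memLp_mul f).toLp _) ((hβ.memLp_mul h).toLp _)] with x h1 h2 h3 h4 h5
        rw [h1, h5, Pi.add_apply, h2, h3, h4, Pi.add_apply, mul_add]
      map_smul' := fun c h => by
        apply Lp.ext
        filter_upwards [(hβ.memLp_mul (c • h)).coeFn_toLp, (hβ.memLp_mul h).coeFn_toLp,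
          Lp.coeFn_smul c h, Lp.coeFn_smul c ((hβ.memLp_mul h).toLp _)] with x h1 h2 h3 h4
        simp only [RingHom.id_apply]
        rw [h1, h4, Pi.smul_apply, h2, h3, Pi.smul_apply, smul_eq_mul, smul_eq_mul]
        ring }
    B fun h => by
      refine Lp.norm_le_mul_norm_of_ae_le_mul ?_
      filter_upwards [(hβ.memLp_mul h).coeFn_toLp] with x hx
      simp only [LinearMap.coe_mk, AddHom.coe_mk]
      rw [hx, norm_mul, Complex.norm_real]
      exact mul_le_mul_of_nonneg_right (hβ.bound x) (norm_nonneg _)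

theorem coeFn_mulL (h : L2 N) : ∀ᵐ x, hβ.mulL h x = (β x : ℂ) * h x :=
  (hβ.memLp_mul h).coeFn_toLp

theorem norm_mulL_le (h : L2 N) : ‖hβ.mulL h‖ ≤ B * ‖h‖ :=
  (hβ.mulL.le_opNorm h).trans <| mul_le_mul_of_nonneg_right
    (LinearMap.mkContinuous_norm_le _ hβ.nonneg _) (norm_nonneg _)

theorem pairing_eq_inner (f h : L2 N) : pairing β f h = inner ℂ f (hβ.mulL h) := by
  rw [pairing, L2.inner_def]
  refine integral_congr_ae ?_
  filter_upwards [hβ.coeFn_mulL h] with x hx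
  rw [hx, RCLike.inner_apply]
  ring

theorem integrable_pairing (f h : L2 N) :
    Integrable fun x => (β x : ℂ) * (conj (f x) * h x) := by
  refine (L2.integrable_inner (𝕜 := ℂ) f (hβ.mulL h)).congr ?_
  filter_upwards [hβ.coeFn_mulL h] with x hx
  rw [hx, RCLike.inner_apply]
  ring

theorem norm_pairing_le (f h : L2 N) : ‖pairing β f h‖ ≤ B * (‖f‖ * ‖h‖) := by
  rw [hβ.pairing_eq_inner]
  calc _ ≤ ‖f‖ * ‖hβ.mulL h‖ := norm_inner_le_norm _ _
    _ ≤ ‖f‖ * (B * ‖h‖) := by gcongr; exact hβ.norm_mulL_le h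
    _ = _ := by ring

theorem pairing_sub_left (f f' h : L2 N) :
    pairing β (f - f') h = pairing β f h - pairing β f' h := by
  simp only [hβ.pairing_eq_inner, inner_sub_left]

theorem pairing_sub_right (f h h' : L2 N) :
    pairing β f (h - h') = pairing β f h - pairing β f h' := by
  simp only [hβ.pairing_eq_inner, map_sub, inner_sub_right]

theorem pairing_smul_left (c : ℝ) (f h : L2 N) :
    pairing β (c • f) h = c * pairing β f h := by
  rw [hβ.pairing_eq_inner, hβ.pairing_eq_inner, ← ofReal_smul_eq c f, inner_smul_left]
  simp

theorem pairing_smul_right (c : ℝ) (f h : L2 N) :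
    pairing β f (c • h) = c * pairing β f h := by
  rw [hβ.pairing_eq_inner, hβ.pairing_eq_inner, ← ofReal_smul_eq c h, map_smul, inner_smul_right]

theorem tendsto_pairing {ι : Type*} {l : Filter ι} {f h : ι → L2 N} {f₀ h₀ : L2 N}
    (hf : Tendsto f l (𝓝 f₀)) (hh : Tendsto h l (𝓝 h₀)) :
    Tendsto (fun i => pairing β (f i) (h i)) l (𝓝 (pairing β f₀ h₀)) := by
  simp only [hβ.pairing_eq_inner]
  exact hf.inner ((hβ.mulL.continuous.tendsto _).comp hh)

theorem hasDerivAt_pairing {f h : ℝ → L2 N} {f' h' : L2 N} {t : ℝ} (hf : HasDerivAt f f' t)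
    (hh : HasDerivAt h h' t) :
    HasDerivAt (fun s => pairing β (f s) (h s)) (pairing β f' (h t) + pairing β (f t) h') t := by
  simp only [hβ.pairing_eq_inner]
  rw [add_comm]
  have h1 : HasDerivAt (fun s => hβ.mulL (h s)) (hβ.mulL h') t :=
    ((hβ.mulL.restrictScalars ℝ).hasFDerivAt).comp_hasDerivAt t hh
  exact hf.inner ℂ h1

end IsBoundedWeight

theorem isBoundedWeight_one : IsBoundedWeight (fun _ : E N => 1) 1 :=
  ⟨aestronglyMeasurable_const, by simp⟩

theorem integrable_conj_mul (f h : L2 N) : Integrable fun x => conj (f x) * h x := by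
  simpa using isBoundedWeight_one.integrable_pairing f h

theorem integrable_re_conj_mul (f h : L2 N) : Integrable fun x => (conj (f x) * h x).re :=
  (integrable_conj_mul f h).re

theorem integrable_im_conj_mul (f h : L2 N) : Integrable fun x => (conj (f x) * h x).im :=
  (integrable_conj_mul f h).im

theorem integrable_sq (f : L2 N) : Integrable fun x => ‖f x‖ ^ 2 :=
  (memLp_two_iff_integrable_sq_norm (Lp.aestronglyMeasurable f)).1 (Lp.memLp f)

/-! ### Weak derivatives of locally integrable functions -/

/-- `D` is the weak partial derivative `∂U/∂x_j`, for locally integrable `U` and `D`, with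
compactly supported test functions of class `C¹`. -/
structure HasLocalPartial {F : Type*} [NormedAddCommGroup F] [NormedSpace ℝ F] (j : Fin N)
    (U D : E N → F) : Prop where
  locallyIntegrable : LocallyIntegrable U
  locallyIntegrable_deriv : LocallyIntegrable D
  integral_eq : ∀ β : E N → ℝ, ContDiff ℝ 1 β → HasCompactSupport β →
    ∫ x, fderiv ℝ β x (basisVec j) • U x = -∫ x, β x • D x

theorem HasLocalPartial.clm_comp {F G : Type*} [NormedAddCommGroup F] [NormedSpace ℝ F]
    [CompleteSpace F] [NormedAddCommGroup G] [NormedSpace ℝ G] [CompleteSpace G] {j : Fin N}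
    {U D : E N → F} (h : HasLocalPartial j U D) (L : F →L[ℝ] G) :
    HasLocalPartial j (fun x => L (U x)) (fun x => L (D x)) where
  locallyIntegrable x := by
    obtain ⟨s, hs, hi⟩ := h.locallyIntegrable x
    exact ⟨s, hs, L.integrable_comp hi⟩
  locallyIntegrable_deriv x := by
    obtain ⟨s, hs, hi⟩ := h.locallyIntegrable_deriv x
    exact ⟨s, hs, L.integrable_comp hi⟩
  integral_eq β hβ hc := by
    have hc' : Continuous fun x => fderiv ℝ β x (basisVec j) :=
      (hβ.continuous_fderiv (by simp)).clm_apply continuous_const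
    have h1 := L.integral_comp_comm (h.locallyIntegrable.integrable_smul_left_of_hasCompactSupport
      hc' (hc.fderiv_apply ℝ _))
    have h2 := L.integral_comp_comm
      (h.locallyIntegrable_deriv.integrable_smul_left_of_hasCompactSupport hβ.continuous hc)
    simp only [map_smul] at h1 h2
    rw [h1, h2, h.integral_eq β hβ hc, map_neg]

/-- The product rule for `f̄ h` with `f, h ∈ H¹`: differentiate the pairing of the translates. -/
theorem HasWeakPartial.conj_mul {j : Fin N} {f f' h h' : L2 N} (hf : HasWeakPartial j f f')
    (hh : HasWeakPartial j h h') :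
    HasLocalPartial j (fun x => conj (f x) * h x)
      (fun x => conj (f' x) * h x + conj (f x) * h' x) where
  locallyIntegrable := (integrable_conj_mul f h).locallyIntegrable
  locallyIntegrable_deriv :=
    ((integrable_conj_mul f' h).add (integrable_conj_mul f h')).locallyIntegrable
  integral_eq β hβ hc := by
    obtain ⟨B, hB⟩ := hβ.continuous.bounded_above_of_compact_support hc
    have hw : IsBoundedWeight β B := ⟨hβ.continuous.aestronglyMeasurable, hB⟩
    have h1 := hasDerivAt_integral_translate_of_compact (j := j) hβ hc
      (integrable_conj_mul f h).locallyIntegrable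
    have h2 := hw.hasDerivAt_pairing hf.hasDerivAt_translate hh.hasDerivAt_translate
    have h3 : (fun s : ℝ => ∫ x, β (x - s • basisVec j) • (conj (f x) * h x)) =
        fun s => pairing β (translate j s f) (translate j s h) := by
      ext s
      rw [← integral_smul_add_right β (fun x => conj (f x) * h x), pairing]
      refine integral_congr_ae ?_
      filter_upwards [coeFn_translate j s f, coeFn_translate j s h] with x hx hx'
      rw [hx, hx', Complex.real_smul]
    rw [h3] at h1
    rw [neg_eq_iff_eq_neg.1 (h1.unique h2), translate_zero, translate_zero, pairing, pairing,
      ← integral_add (hw.integrable_pairing f' h) (hw.integrable_pairing f h')]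
    simp_rw [Complex.real_smul, mul_add]

theorem HasWeakPartial.re_conj_mul {j : Fin N} {f f' h h' : L2 N} (hf : HasWeakPartial j f f')
    (hh : HasWeakPartial j h h') :
    HasLocalPartial j (fun x => (conj (f x) * h x).re)
      (fun x => (conj (f' x) * h x).re + (conj (f x) * h' x).re) :=
  (hf.conj_mul hh).clm_comp Complex.reCLM

theorem HasWeakPartial.im_conj_mul {j : Fin N} {f f' h h' : L2 N} (hf : HasWeakPartial j f f')
    (hh : HasWeakPartial j h h') :
    HasLocalPartial j (fun x => (conj (f x) * h x).im)
      (fun x => (conj (f' x) * h x).im + (conj (f x) * h' x).im) :=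
  (hf.conj_mul hh).clm_comp Complex.imCLM

theorem re_conj_mul_self (z : ℂ) : (conj z * z).re = ‖z‖ ^ 2 := by
  rw [← Complex.normSq_eq_conj_mul_self, Complex.ofReal_re, Complex.normSq_eq_norm_sq]

theorem re_conj_mul_comm (z w : ℂ) : (conj z * w).re = (conj w * z).re := by
  simp [Complex.mul_re]; ring

theorem HasWeakPartial.norm_sq {j : Fin N} {f f' : L2 N} (hf : HasWeakPartial j f f') :
    HasLocalPartial j (fun x => ‖f x‖ ^ 2) (fun x => 2 * (conj (f x) * f' x).re) := by
  have h := hf.re_conj_mul hf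
  simp_rw [re_conj_mul_self, fun x => re_conj_mul_comm (f' x) (f x), ← two_mul] at h
  exact h

/-! ### The weak Laplacian of `|f|²` -/

theorem laplacian_eq_sum {η : E N → ℝ} (hη : ContDiff ℝ (⊤ : ℕ∞) η) (x : E N) :
    Laplacian.laplacian η x =
      ∑ j, fderiv ℝ (fun y => fderiv ℝ η y (basisVec j)) x (basisVec j) := by
  rw [InnerProductSpace.laplacian_eq_iteratedFDeriv_orthonormalBasis η
    (EuclideanSpace.basisFun (Fin N) ℝ)]
  refine Finset.sum_congr rfl fun j _ => ?_
  have hd : DifferentiableAt ℝ (fderiv ℝ η) x :=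
    ((hη.fderiv_right (m := (⊤ : ℕ∞)) (by simp)).differentiable (by simp)) x
  rw [iteratedFDeriv_two_apply, fderiv_clm_apply hd (differentiableAt_const _)]
  simp [basisVec]

theorem HasWeakLaplacian.ae_eq {f g g' : E N → ℝ} (h : HasWeakLaplacian f g)
    (h' : HasWeakLaplacian f g') : ∀ᵐ x, g x = g' x := by
  refine ae_eq_of_integral_contDiff_smul_eq h.2.1 h'.2.1 fun η hη hc => ?_
  simp_rw [smul_eq_mul, mul_comm (η _)]
  rw [← h.2.2 η hη hc, ← h'.2.2 η hη hc]

theorem HasWeakLaplacian.weakLaplacian_ae_eq {f g : E N → ℝ} (h : HasWeakLaplacian f g) :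
    ∀ᵐ x, weakLaplacian f x = g x := by
  have h0 : ∃ g, HasWeakLaplacian f g := ⟨g, h⟩
  have : HasWeakLaplacian f (weakLaplacian f) := by
    rw [weakLaplacian, dif_pos h0]
    exact h0.choose_spec
  exact this.ae_eq h

/-- `Δ|f|² = 2 ∑_j (|∂_j f|² + Re (f̄ ∂_j² f))` for `f ∈ H²`. -/
theorem hasWeakLaplacian_norm_sq {f : L2 N} {g h : Fin N → L2 N}
    (hg : ∀ j, HasWeakPartial j f (g j)) (hh : ∀ j, HasWeakPartial j (g j) (h j)) :
    HasWeakLaplacian (fun x => ‖f x‖ ^ 2)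
      (fun x => ∑ j, 2 * (‖g j x‖ ^ 2 + (conj (f x) * h j x).re)) := by
  have hloc : ∀ j, Integrable fun x => 2 * (‖g j x‖ ^ 2 + (conj (f x) * h j x).re) := fun j =>
    ((integrable_sq (g j)).add (integrable_re_conj_mul f (h j))).const_mul 2
  refine ⟨(integrable_sq f).locallyIntegrable,
    (integrable_finsetSum _ fun j _ => hloc j).locallyIntegrable, fun η hη hc => ?_⟩
  have h1 : ∀ j, ContDiff ℝ (⊤ : ℕ∞) (fun x => fderiv ℝ η x (basisVec j)) := fun j =>
    contDiff_fderiv_apply hη _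
  have hc1 : ∀ j, HasCompactSupport (fun x => fderiv ℝ η x (basisVec j)) := fun j =>
    hc.fderiv_apply ℝ _
  have h2 : ∀ j, ∫ x, ‖f x‖ ^ 2 * fderiv ℝ (fun y => fderiv ℝ η y (basisVec j)) x (basisVec j) =
      ∫ x, 2 * (‖g j x‖ ^ 2 + (conj (f x) * h j x).re) * η x := by
    intro j
    have e1 := (hg j).norm_sq.integral_eq _ ((h1 j).of_le (by simp)) (hc1 j)
    have e2 := ((hg j).re_conj_mul (hh j)).integral_eq η (hη.of_le (by simp)) hc
    simp only [smul_eq_mul, re_conj_mul_self] at e1 e2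
    calc _ = ∫ x, fderiv ℝ (fun y => fderiv ℝ η y (basisVec j)) x (basisVec j) * ‖f x‖ ^ 2 := by
          simp_rw [mul_comm]
      _ = -(2 * ∫ x, fderiv ℝ η x (basisVec j) * (conj (f x) * g j x).re) := by
          rw [e1, ← integral_const_mul]
          congr 2 with x
          ring
      _ = _ := by
          rw [e2, mul_neg, neg_neg, ← integral_const_mul]
          congr 1 with x
          ring
  have h3 : ∀ j, Integrable fun x =>
      ‖f x‖ ^ 2 * fderiv ℝ (fun y => fderiv ℝ η y (basisVec j)) x (basisVec j) := by
    intro j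
    have := (integrable_sq f).locallyIntegrable.integrable_smul_left_of_hasCompactSupport
      (contDiff_fderiv_apply (h1 j) (basisVec j)).continuous ((hc1 j).fderiv_apply ℝ _)
    simpa only [smul_eq_mul, mul_comm] using this
  have h4 : ∀ j, Integrable fun x => 2 * (‖g j x‖ ^ 2 + (conj (f x) * h j x).re) * η x := by
    intro j
    have := (hloc j).locallyIntegrable.integrable_smul_left_of_hasCompactSupport
      hη.continuous hc
    simpa only [smul_eq_mul, mul_comm] using this
  simp_rw [laplacian_eq_sum hη, Finset.mul_sum, Finset.sum_mul]
  rw [integral_finsetSum _ fun j _ => h3 j, integral_finsetSum _ fun j _ => h4 j]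
  exact Finset.sum_congr rfl fun j _ => h2 j

/-! ### The chain rule -/

theorem abs_primitive_sub_le {a : ℝ → ℝ} {L : NNReal} (ha : LipschitzWith L a) (r r' : ℝ) :
    |(∫ τ in (0 : ℝ)..r', a τ) - (∫ τ in (0 : ℝ)..r, a τ) - a r * (r' - r)| ≤
      L * (r' - r) ^ 2 := by
  have hi : ∀ u v, IntervalIntegrable a volume u v := fun u v =>
    ha.continuous.intervalIntegrable u v
  have h1 : (∫ τ in (0 : ℝ)..r', a τ) - (∫ τ in (0 : ℝ)..r, a τ) - a r * (r' - r) =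
      ∫ τ in r..r', (a τ - a r) := by
    rw [intervalIntegral.integral_interval_sub_left (hi _ _) (hi _ _),
      intervalIntegral.integral_sub (hi _ _) (by simp), intervalIntegral.integral_const,
      smul_eq_mul, mul_comm]
  rw [h1, ← Real.norm_eq_abs]
  refine (intervalIntegral.norm_integral_le_of_norm_le_const (C := L * |r' - r|) ?_).trans
    (le_of_eq ?_)
  · intro τ hτ
    have h2 := ha.dist_le_mul τ r
    rw [Real.dist_eq, Real.dist_eq] at h2
    refine h2.trans (mul_le_mul_of_nonneg_left ?_ L.2)
    exact Set.abs_sub_left_of_mem_uIcc (Set.uIoc_subset_uIcc hτ)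
  · rw [mul_assoc, ← abs_mul, ← sq, abs_of_nonneg (sq_nonneg _)]

theorem norm_sub_sq_complex (z w : ℂ) :
    ‖w - z‖ ^ 2 = ‖w‖ ^ 2 + ‖z‖ ^ 2 - 2 * (conj z * w).re := by
  rw [← Complex.normSq_eq_norm_sq, ← Complex.normSq_eq_norm_sq, ← Complex.normSq_eq_norm_sq,
    Complex.normSq_sub]
  simp [Complex.mul_re]
  ring

/-- The second order Taylor estimate for the radial function `z ↦ A(|z|)`, where `A' = a`. -/
theorem abs_radial_sub_le {a : ℝ → ℝ} {L : NNReal} (ha : LipschitzWith L a) (ha0 : a 0 = 0)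
    (z w : ℂ) :
    |(∫ τ in (0 : ℝ)..‖w‖, a τ) - (∫ τ in (0 : ℝ)..‖z‖, a τ)
      - a ‖z‖ * (conj z * (w - z)).re / ‖z‖| ≤ 2 * L * ‖w - z‖ ^ 2 := by
  have h1 := abs_primitive_sub_le ha ‖z‖ ‖w‖
  have h2 : (‖w‖ - ‖z‖) ^ 2 ≤ ‖w - z‖ ^ 2 := by
    rw [← sq_abs (‖w‖ - ‖z‖)]
    exact pow_le_pow_left₀ (abs_nonneg _) (abs_norm_sub_norm_le w z) 2
  have h3 : |a ‖z‖ * (‖w‖ - ‖z‖) - a ‖z‖ * (conj z * (w - z)).re / ‖z‖| ≤ L * ‖w - z‖ ^ 2 := by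
    rcases eq_or_ne z 0 with rfl | hz
    · simp [ha0]; positivity
    have hz' : 0 < ‖z‖ := norm_pos_iff.2 hz
    have h4 : a ‖z‖ * (‖w‖ - ‖z‖) - a ‖z‖ * (conj z * (w - z)).re / ‖z‖ =
        a ‖z‖ / ‖z‖ * (‖z‖ * ‖w‖ - (conj z * w).re) := by
      have : (conj z * (w - z)).re = (conj z * w).re - ‖z‖ ^ 2 := by
        rw [mul_sub, Complex.sub_re, re_conj_mul_self]
      rw [this]
      field_simp
      ring
    have h5 : |a ‖z‖ / ‖z‖| ≤ L := by
      rw [abs_div, abs_of_pos hz', div_le_iff₀ hz']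
      have := ha.dist_le_mul ‖z‖ 0
      simpa [ha0, Real.dist_eq] using this
    have h6 : |‖z‖ * ‖w‖ - (conj z * w).re| ≤ ‖w - z‖ ^ 2 := by
      have h7 : (conj z * w).re ≤ ‖z‖ * ‖w‖ := by
        refine (Complex.re_le_norm _).trans (le_of_eq ?_)
        simp
      rw [abs_of_nonneg (by linarith)]
      have := norm_sub_sq_complex z w
      nlinarith [sq_nonneg (‖w‖ - ‖z‖)]
    rw [h4, abs_mul]
    exact mul_le_mul h5 h6 (abs_nonneg _) L.2
  have hL : (0 : ℝ) ≤ L := L.2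
  have h8 := abs_add_le ((∫ τ in (0 : ℝ)..‖w‖, a τ) - (∫ τ in (0 : ℝ)..‖z‖, a τ)
    - a ‖z‖ * (‖w‖ - ‖z‖)) (a ‖z‖ * (‖w‖ - ‖z‖) - a ‖z‖ * (conj z * (w - z)).re / ‖z‖)
  rw [sub_add_sub_cancel] at h8
  nlinarith

theorem integrable_radial {a : ℝ → ℝ} {L : NNReal} (ha : LipschitzWith L a) (ha0 : a 0 = 0)
    (f : L2 N) : Integrable fun x => ∫ τ in (0 : ℝ)..‖f x‖, a τ := by
  refine ((integrable_sq f).const_mul (2 * L)).mono' ?_ (.of_forall fun x => ?_)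
  · exact (intervalIntegral.continuous_primitive
      (fun u v => ha.continuous.intervalIntegrable u v) 0).comp_aestronglyMeasurable
      (Lp.aestronglyMeasurable f).norm
  · simpa [ha0] using abs_radial_sub_le ha ha0 0 (f x)

/-- The chain rule for a radial function with Lipschitz derivative: the functional
`f ↦ ∫ β A(|f|)` is differentiable on `L²`, and it is composed with the translations. -/
theorem HasWeakPartial.integral_radial {j : Fin N} {f g : L2 N} (h : HasWeakPartial j f g)
    {a : ℝ → ℝ} {L : NNReal} (ha : LipschitzWith L a) (ha0 : a 0 = 0) {β : E N → ℝ} {B C : ℝ}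
    (hβ : ContDiff ℝ 1 β) (hB : ∀ x, |β x| ≤ B)
    (hC : ∀ x, |fderiv ℝ β x (basisVec j)| ≤ C) :
    ∫ x, fderiv ℝ β x (basisVec j) * (∫ τ in (0 : ℝ)..‖f x‖, a τ) =
      -∫ x, β x * (a ‖f x‖ * (conj (f x) * g x).re / ‖f x‖) := by
  have hw : IsBoundedWeight β B := ⟨hβ.continuous.aestronglyMeasurable, hB⟩
  have hB0 := hw.nonneg
  have h1 := hasDerivAt_integral_translate_of_bounded (j := j) hβ hB hC
    (integrable_radial ha ha0 f)
  set A : ℂ → ℝ := fun z => ∫ τ in (0 : ℝ)..‖z‖, a τ with hA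
  have hint : ∀ u : L2 N, Integrable fun x => β x * A (u x) := fun u => by
    exact (integrable_radial ha ha0 u).bdd_smul B hβ.continuous.aestronglyMeasurable
      (.of_forall hB)
  have hqm : MemLp (fun x => ((β x * (a ‖f x‖ / ‖f x‖) : ℝ) : ℂ) * f x) 2 := by
    refine (Lp.memLp f).of_le_mul (c := B * L) ?_ (.of_forall fun x => ?_)
    · have hf := (Lp.aestronglyMeasurable f).norm
      exact (Complex.continuous_ofReal.comp_aestronglyMeasurable
        (hβ.continuous.aestronglyMeasurable.mul
          ((ha.continuous.comp_aestronglyMeasurable hf).div₀ hf))).mul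
          (Lp.aestronglyMeasurable f)
    · rw [norm_mul, Complex.norm_real, norm_mul]
      have h5 : ‖a ‖f x‖ / ‖f x‖‖ ≤ L := by
        rw [norm_div, norm_norm]
        refine div_le_of_le_mul₀ (norm_nonneg _) L.2 ?_
        have := ha.dist_le_mul ‖f x‖ 0
        simpa [ha0, Real.dist_eq] using this
      exact mul_le_mul_of_nonneg_right (mul_le_mul (hB x) h5 (norm_nonneg _) hB0) (norm_nonneg _)
  set ℓ : L2 N →L[ℝ] ℝ :=
    Complex.reCLM.comp ((innerSL ℂ (hqm.toLp _)).restrictScalars ℝ) with hℓ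
  have hre : ∀ u : L2 N,
      (Integrable fun x => β x * (a ‖f x‖ * (conj (f x) * u x).re / ‖f x‖)) ∧
      ℓ u = ∫ x, β x * (a ‖f x‖ * (conj (f x) * u x).re / ‖f x‖) := by
    intro u
    have e1 : (fun x => (inner ℂ (hqm.toLp _ x) (u x)).re) =ᵐ[volume]
        fun x => β x * (a ‖f x‖ * (conj (f x) * u x).re / ‖f x‖) := by
      filter_upwards [hqm.coeFn_toLp] with x hx
      rw [hx, RCLike.inner_apply, map_mul, Complex.conj_ofReal, mul_left_comm,
        Complex.re_ofReal_mul, mul_comm (u x)]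
      ring
    refine ⟨(L2.integrable_inner (𝕜 := ℂ) (hqm.toLp _) u).re.congr e1, ?_⟩
    rw [← integral_congr_ae e1]
    simp only [hℓ, ContinuousLinearMap.comp_apply, ContinuousLinearMap.coe_restrictScalars',
      innerSL_apply_apply, L2.inner_def]
    exact (Complex.reCLM.integral_comp_comm
      (L2.integrable_inner (𝕜 := ℂ) (hqm.toLp _) u)).symm
  -- `ℓ` is the derivative of the functional: the second order remainder is `O(‖u - f‖²)`
  have hfd : HasFDerivAt (fun u : L2 N => ∫ x, β x * A (u x)) ℓ f := by
    refine .of_isLittleO ?_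
    have hO : (fun u : L2 N => (∫ x, β x * A (u x)) - (∫ x, β x * A (f x)) - ℓ (u - f))
        =O[𝓝 f] fun u => ‖u - f‖ ^ 2 := by
      refine Asymptotics.IsBigO.of_bound (B * (2 * L)) (.of_forall fun u => ?_)
      have hsub : Integrable fun x => β x * A (u x) - β x * A (f x) := (hint u).sub (hint f)
      have e2 : (∫ x, β x * A (u x)) - (∫ x, β x * A (f x)) - ℓ (u - f) =
          ∫ x, β x * (A (u x) - A (f x)
            - a ‖f x‖ * (conj (f x) * (u - f) x).re / ‖f x‖) := by
        rw [(hre (u - f)).2, ← integral_sub (hint u) (hint f),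
          ← integral_sub hsub (hre (u - f)).1]
        congr 1 with x
        ring
      rw [e2, Real.norm_of_nonneg (sq_nonneg _), norm_sq_eq_integral, ← integral_const_mul]
      refine norm_integral_le_of_norm_le ((integrable_sq (u - f)).const_mul _) ?_
      filter_upwards [Lp.coeFn_sub u f] with x hx
      rw [norm_mul, mul_assoc]
      refine mul_le_mul (hB x) ?_ (norm_nonneg _) hB0
      rw [hx, Pi.sub_apply]
      exact abs_radial_sub_le ha ha0 (f x) (u x)
    refine hO.trans_isLittleO ?_
    have := (Asymptotics.isLittleO_norm_pow_id (E' := L2 N) one_lt_two).comp_tendsto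
      (show Tendsto (fun u : L2 N => u - f) (𝓝 f) (𝓝 0) by
        exact tendsto_sub_nhds_zero_iff.2 tendsto_id)
    exact this
  have h2 := HasFDerivAt.comp_hasDerivAt_of_eq (0 : ℝ) hfd h.hasDerivAt_translate
    (translate_zero j f).symm
  have h3 : (fun s : ℝ => ∫ x, β (x - s • basisVec j) • A (f x)) =
      (fun u : L2 N => ∫ x, β x * A (u x)) ∘ fun s => translate j s f := by
    ext s
    rw [← integral_smul_add_right β (fun x => A (f x)), Function.comp_apply]
    refine integral_congr_ae ?_
    filter_upwards [coeFn_translate j s f] with x hx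
    rw [hx, smul_eq_mul]
  rw [← h3] at h2
  have h4 := h1.unique h2
  rw [(hre g).2] at h4
  rw [← h4, neg_neg]
  simp only [smul_eq_mul]

/-! ### The chain rule for the nonlinearity -/

/-- A Lipschitz truncation of `w` on `[0, ∞)`: it agrees with `w` on `[0, n]`, vanishes beyond
`n + 1`, and is dominated by `w`. -/
noncomputable def truncation (w : ℝ → ℝ) (n : ℕ) (s : ℝ) : ℝ :=
  w (max 0 (min s (n + 1))) * max 0 (min 1 (n + 1 - s))

section Truncation

variable {w : ℝ → ℝ}

theorem truncation_zero (hw0 : w 0 = 0) (n : ℕ) : truncation w n 0 = 0 := by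
  have : min (0 : ℝ) (n + 1) = 0 := min_eq_left (by positivity)
  simp [truncation, this, hw0]

theorem truncation_eq {n : ℕ} {s : ℝ} (h0 : 0 ≤ s) (hs : s ≤ n) : truncation w n s = w s := by
  rw [truncation, min_eq_left (by linarith), max_eq_right h0, min_eq_left (by linarith),
    max_eq_right zero_le_one, mul_one]

theorem abs_truncation_le {n : ℕ} {s : ℝ} (h0 : 0 ≤ s) : |truncation w n s| ≤ |w s| := by
  rw [truncation, abs_mul]
  have h1 : |max 0 (min 1 ((n : ℝ) + 1 - s))| ≤ 1 := by
    rw [abs_of_nonneg (le_max_left _ _)]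
    exact max_le zero_le_one (min_le_left _ _)
  rcases le_total s (n + 1) with h | h
  · rw [min_eq_left h, max_eq_right h0]
    exact mul_le_of_le_one_right (abs_nonneg _) h1
  · rw [max_eq_left ((min_le_right _ _).trans (by linarith : (n : ℝ) + 1 - s ≤ 0)), abs_zero,
      mul_zero]
    exact abs_nonneg _

theorem exists_lipschitzWith_truncation
    (hlip : ∀ R : ℝ, ∃ L : NNReal, LipschitzOnWith L w (Set.Icc 0 R)) (n : ℕ) :
    ∃ L : NNReal, LipschitzWith L (truncation w n) := by
  obtain ⟨L, hL⟩ := hlip (n + 1)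
  obtain ⟨M, hM⟩ := isCompact_Icc.exists_bound_of_continuousOn hL.continuousOn
  have hM0 : 0 ≤ M := (norm_nonneg _).trans (hM 0 ⟨le_rfl, by positivity⟩)
  have hn : (0 : ℝ) ≤ n + 1 := by positivity
  have hmem : ∀ s : ℝ, max 0 (min s (n + 1)) ∈ Set.Icc (0 : ℝ) (n + 1) := fun s =>
    ⟨le_max_left _ _, max_le hn (min_le_right _ _)⟩
  have hc : LipschitzWith 1 fun s : ℝ => max 0 (min s (n + 1)) :=
    (LipschitzWith.id.min_const _).const_max _
  have hk : LipschitzWith 1 fun s : ℝ => max 0 (min 1 (n + 1 - s)) := by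
    have : LipschitzWith 1 fun s : ℝ => (n : ℝ) + 1 - s :=
      LipschitzWith.of_dist_le_mul fun x y => by rw [dist_sub_left]; simp
    exact (this.const_min _).const_max _
  refine ⟨L + ⟨M, hM0⟩, LipschitzWith.of_dist_le_mul fun s s' => ?_⟩
  have h1 := hc.dist_le_mul s s'
  have h2 := hk.dist_le_mul s s'
  have h3 := hL.dist_le_mul _ (hmem s) _ (hmem s')
  have h4 := hM _ (hmem s')
  simp only [truncation, Real.dist_eq, NNReal.coe_one, one_mul, Real.norm_eq_abs] at *
  set u := max 0 (min s ((n : ℝ) + 1))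
  set u' := max 0 (min s' ((n : ℝ) + 1))
  set k := max 0 (min 1 ((n : ℝ) + 1 - s))
  set k' := max 0 (min 1 ((n : ℝ) + 1 - s'))
  have h5 : |k| ≤ 1 := by
    rw [abs_of_nonneg (le_max_left _ _)]
    exact max_le zero_le_one (min_le_left _ _)
  have h6 : w u * k - w u' * k' = (w u - w u') * k + w u' * (k - k') := by ring
  calc |w u * k - w u' * k'| ≤ |w u - w u'| * |k| + |w u'| * |k - k'| := by
        rw [h6, ← abs_mul, ← abs_mul]; exact abs_add_le _ _
    _ ≤ (L * |s - s'|) * 1 + M * |s - s'| := by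
        refine add_le_add (mul_le_mul (h3.trans ?_) h5 (abs_nonneg _) (by positivity))
          (mul_le_mul h4 h2 (abs_nonneg _) hM0)
        exact mul_le_mul_of_nonneg_left h1 L.2
    _ = ((L : ℝ) + M) * |s - s'| := by ring

theorem integral_truncation_eq {n : ℕ} {r : ℝ} (h0 : 0 ≤ r) (hr : r ≤ n) :
    ∫ τ in (0 : ℝ)..r, truncation w n τ = ∫ τ in (0 : ℝ)..r, w τ := by
  refine intervalIntegral.integral_congr fun τ hτ => ?_
  rw [Set.uIcc_of_le h0] at hτ
  exact truncation_eq hτ.1 (hτ.2.trans hr)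

theorem tendsto_integral_truncation (w : ℝ → ℝ) {r : ℝ} (h0 : 0 ≤ r) :
    Tendsto (fun n : ℕ => ∫ τ in (0 : ℝ)..r, truncation w n τ) atTop
      (𝓝 (∫ τ in (0 : ℝ)..r, w τ)) := by
  obtain ⟨n₀, hn₀⟩ := exists_nat_ge r
  refine tendsto_const_nhds.congr' ?_
  filter_upwards [eventually_ge_atTop n₀] with n hn
  exact (integral_truncation_eq h0 (hn₀.trans (by exact_mod_cast hn))).symm

theorem tendsto_truncation (w : ℝ → ℝ) {r : ℝ} (h0 : 0 ≤ r) :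
    Tendsto (fun n : ℕ => truncation w n r) atTop (𝓝 (w r)) := by
  obtain ⟨n₀, hn₀⟩ := exists_nat_ge r
  refine tendsto_const_nhds.congr' ?_
  filter_upwards [eventually_ge_atTop n₀] with n hn
  exact (truncation_eq h0 (hn₀.trans (by exact_mod_cast hn))).symm

end Truncation

theorem abs_re_conj_mul_div_le (z v : ℂ) : |(conj z * v).re / ‖z‖| ≤ ‖v‖ := by
  rw [abs_div, abs_norm]
  refine div_le_of_le_mul₀ (norm_nonneg _) (norm_nonneg _) ((Complex.abs_re_le_norm _).trans ?_)
  rw [norm_mul, RCLike.norm_conj, mul_comm]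

section Radial

variable {j : Fin N} {f g : L2 N} {w : ℝ → ℝ}

theorem integrable_norm_mul_norm (hmem : MemLp (fun x => w ‖f x‖) 2) (g : L2 N) :
    Integrable fun x => |w ‖f x‖| * ‖g x‖ := by
  exact hmem.norm.integrable_mul (Lp.memLp g).norm

theorem fderiv_arctan_coord (j : Fin N) (x : E N) :
    fderiv ℝ (fun y : E N => Real.arctan (y j)) x (basisVec j) = 1 / (1 + x j ^ 2) := by
  have h1 : HasFDerivAt (fun y : E N => y j) (EuclideanSpace.proj j : E N →L[ℝ] ℝ) x :=
    (EuclideanSpace.proj j : E N →L[ℝ] ℝ).hasFDerivAt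
  rw [h1.arctan.fderiv]
  simp [basisVec]

/-- The primitive of `|w|` along `|f|` is locally integrable. A bounded increasing test function
in one variable, here `arctan x_j`, bounds its integral against `1 / (1 + x_j²)` by the `L¹` norm
of the derivative alone, so that no Sobolev embedding is needed. -/
theorem HasWeakPartial.locallyIntegrable_integral_abs (h : HasWeakPartial j f g) (hw0 : w 0 = 0)
    (hlip : ∀ R : ℝ, ∃ L : NNReal, LipschitzOnWith L w (Set.Icc 0 R))
    (hmem : MemLp (fun x => w ‖f x‖) 2) :
    LocallyIntegrable fun x => ∫ τ in (0 : ℝ)..‖f x‖, |w τ| := by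
  set v : ℝ → ℝ := fun τ => |w τ| with hv
  have hv0 : v 0 = 0 := by simp [hv, hw0]
  have hvlip : ∀ R : ℝ, ∃ L : NNReal, LipschitzOnWith L v (Set.Icc 0 R) := fun R => by
    obtain ⟨L, hL⟩ := hlip R
    refine ⟨L, LipschitzOnWith.of_dist_le_mul fun x hx y hy => ?_⟩
    refine le_trans ?_ (hL.dist_le_mul x hx y hy)
    rw [Real.dist_eq, Real.dist_eq]
    exact abs_abs_sub_abs_le _ _
  set κ : E N → ℝ := fun x => 1 / (1 + x j ^ 2) with hκ
  have hκc : Continuous κ := by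
    refine continuous_const.div (by fun_prop) fun x => by positivity
  have hκ1 : ∀ x, |κ x| ≤ 1 := fun x => by
    rw [abs_of_nonneg (by positivity), hκ]
    exact (div_le_one (by positivity)).2 (by nlinarith [sq_nonneg (x j)])
  set C := Real.pi / 2 * ∫ x, |w ‖f x‖| * ‖g x‖ with hC
  have hwint := integrable_norm_mul_norm hmem g
  -- the truncations are bounded in `L¹` uniformly in `n`, so that Fatou's lemma applies
  have hbound : ∀ n : ℕ, (Integrable fun x => κ x * ∫ τ in (0 : ℝ)..‖f x‖, truncation v n τ) ∧
      eLpNorm (fun x => κ x * ∫ τ in (0 : ℝ)..‖f x‖, truncation v n τ) 1 ≤ ENNReal.ofReal C := by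
    intro n
    obtain ⟨L, hL⟩ := exists_lipschitzWith_truncation hvlip n
    have hint : Integrable fun x => κ x * ∫ τ in (0 : ℝ)..‖f x‖, truncation v n τ :=
      (integrable_radial hL (truncation_zero hv0 n) f).bdd_smul 1 hκc.aestronglyMeasurable
        (.of_forall hκ1)
    refine ⟨hint, ?_⟩
    have hatan : ContDiff ℝ 1 fun y : E N => Real.arctan (y j) :=
      Real.contDiff_arctan.comp (EuclideanSpace.proj j : E N →L[ℝ] ℝ).contDiff
    have harc : ∀ x : E N, |Real.arctan (x j)| ≤ Real.pi / 2 := fun x =>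
      abs_le.2 ⟨(Real.neg_pi_div_two_lt_arctan _).le, (Real.arctan_lt_pi_div_two _).le⟩
    have hid := h.integral_radial hL (truncation_zero hv0 n) hatan harc
      (fun x => by rw [fderiv_arctan_coord]; exact hκ1 x)
    simp_rw [fderiv_arctan_coord] at hid
    have hnn : ∀ x, 0 ≤ κ x * ∫ τ in (0 : ℝ)..‖f x‖, truncation v n τ := fun x =>
      mul_nonneg (by positivity) (intervalIntegral.integral_nonneg (norm_nonneg _)
        fun τ _ => mul_nonneg (abs_nonneg _) (le_max_left _ _))
    rw [eLpNorm_one_eq_lintegral_enorm, ← ofReal_integral_norm_eq_lintegral_enorm hint]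
    refine ENNReal.ofReal_le_ofReal ?_
    simp_rw [Real.norm_of_nonneg (hnn _)]
    rw [hid, hC, ← integral_const_mul]
    refine (neg_le_abs _).trans ?_
    rw [← Real.norm_eq_abs]
    refine norm_integral_le_of_norm_le (hwint.const_mul _) (.of_forall fun x => ?_)
    rw [norm_mul, mul_div_assoc]
    refine mul_le_mul (harc x) ?_ (norm_nonneg _) (by positivity)
    rw [Real.norm_eq_abs, abs_mul]
    refine mul_le_mul ?_ (abs_re_conj_mul_div_le _ _) (abs_nonneg _) (abs_nonneg _)
    simpa [hv] using abs_truncation_le (w := v) (n := n) (norm_nonneg (f x))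
  have hlim : ∀ᵐ x : E N, Tendsto
      (fun n : ℕ => κ x * ∫ τ in (0 : ℝ)..‖f x‖, truncation v n τ) atTop
      (𝓝 (κ x * ∫ τ in (0 : ℝ)..‖f x‖, v τ)) :=
    .of_forall fun x => (tendsto_integral_truncation v (norm_nonneg _)).const_mul _
  have hfin : Integrable fun x => κ x * ∫ τ in (0 : ℝ)..‖f x‖, v τ := by
    refine memLp_one_iff_integrable.1
      ⟨aestronglyMeasurable_of_tendsto_ae atTop (fun n => (hbound n).1.1) hlim, ?_⟩
    refine (Lp.eLpNorm_lim_le_liminf_eLpNorm (fun n => (hbound n).1.1) _ hlim).trans_lt ?_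
    refine lt_of_le_of_lt ?_ (ENNReal.ofReal_lt_top (r := C))
    exact liminf_le_of_frequently_le' (.of_forall fun n => (hbound n).2)
  have := hfin.locallyIntegrable.continuous_smul
    (g := fun x : E N => 1 + x j ^ 2) (by fun_prop)
  refine this.congr (.of_forall fun x => ?_)
  have hx : (1 + x j ^ 2) ≠ 0 := by positivity
  simp only [hκ, smul_eq_mul]
  field_simp

/-- The chain rule for `A(|f|)`, `A' = w`, assuming only that `w` is locally Lipschitz and that
`w(|f|)` belongs to `L²`. -/
theorem HasWeakPartial.hasLocalPartial_radial (h : HasWeakPartial j f g) (hw0 : w 0 = 0)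
    (hlip : ∀ R : ℝ, ∃ L : NNReal, LipschitzOnWith L w (Set.Icc 0 R))
    (hmem : MemLp (fun x => w ‖f x‖) 2) :
    HasLocalPartial j (fun x => ∫ τ in (0 : ℝ)..‖f x‖, w τ)
      (fun x => w ‖f x‖ * (conj (f x) * g x).re / ‖f x‖) := by
  have hK := h.locallyIntegrable_integral_abs hw0 hlip hmem
  have hwint := integrable_norm_mul_norm hmem g
  choose L hL using exists_lipschitzWith_truncation hlip
  have hAm : ∀ n : ℕ, AEStronglyMeasurable
      (fun x => ∫ τ in (0 : ℝ)..‖f x‖, truncation w n τ) volume := fun n =>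
    (integrable_radial (hL n) (truncation_zero hw0 n) f).1
  have hDm : ∀ n : ℕ, AEStronglyMeasurable
      (fun x => truncation w n ‖f x‖ * (conj (f x) * g x).re / ‖f x‖) volume := fun n =>
    (((hL n).continuous.comp_aestronglyMeasurable (Lp.aestronglyMeasurable f).norm).mul
      (integrable_re_conj_mul f g).1).div₀ (Lp.aestronglyMeasurable f).norm
  have hAle : ∀ (n : ℕ) (x : E N), |∫ τ in (0 : ℝ)..‖f x‖, truncation w n τ| ≤
      ∫ τ in (0 : ℝ)..‖f x‖, |w τ| := by
    intro n x
    obtain ⟨L', hL'⟩ := hlip ‖f x‖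
    rw [← Real.norm_eq_abs]
    refine intervalIntegral.norm_integral_le_of_norm_le (norm_nonneg (f x))
      (.of_forall fun τ hτ => ?_) (ContinuousOn.intervalIntegrable ?_)
    · exact abs_truncation_le hτ.1.le
    · rw [Set.uIcc_of_le (norm_nonneg _)]
      exact hL'.continuousOn.abs
  have hDle : ∀ (n : ℕ) (x : E N),
      |truncation w n ‖f x‖ * (conj (f x) * g x).re / ‖f x‖| ≤ |w ‖f x‖| * ‖g x‖ := by
    intro n x
    rw [mul_div_assoc, abs_mul]
    exact mul_le_mul (abs_truncation_le (norm_nonneg _)) (abs_re_conj_mul_div_le _ _)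
      (abs_nonneg _) (abs_nonneg _)
  have hAlim : ∀ x : E N, Tendsto (fun n : ℕ => ∫ τ in (0 : ℝ)..‖f x‖, truncation w n τ) atTop
      (𝓝 (∫ τ in (0 : ℝ)..‖f x‖, w τ)) := fun x =>
    tendsto_integral_truncation w (norm_nonneg _)
  have hDlim : ∀ x : E N, Tendsto
      (fun n : ℕ => truncation w n ‖f x‖ * (conj (f x) * g x).re / ‖f x‖) atTop
      (𝓝 (w ‖f x‖ * (conj (f x) * g x).re / ‖f x‖)) := fun x =>
    ((tendsto_truncation w (norm_nonneg _)).mul_const _).div_const _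
  refine ⟨?_, ?_, fun β hβ hc => ?_⟩
  · refine hK.mono (aestronglyMeasurable_of_tendsto_ae atTop hAm (.of_forall hAlim))
      (.of_forall fun x => ?_)
    have h1 : ‖∫ τ in (0 : ℝ)..‖f x‖, w τ‖ ≤ ∫ τ in (0 : ℝ)..‖f x‖, |w τ| :=
      le_of_tendsto (hAlim x).norm (.of_forall fun n => hAle n x)
    exact h1.trans (le_abs_self _)
  · refine Integrable.locallyIntegrable ?_
    refine hwint.mono' (aestronglyMeasurable_of_tendsto_ae atTop hDm (.of_forall hDlim))
      (.of_forall fun x => ?_)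
    exact le_of_tendsto (hDlim x).norm (.of_forall fun n => hDle n x)
  · have hc' : Continuous fun x => fderiv ℝ β x (basisVec j) :=
      (hβ.continuous_fderiv (by simp)).clm_apply continuous_const
    obtain ⟨B, hB⟩ := hβ.continuous.bounded_above_of_compact_support hc
    obtain ⟨C, hC⟩ := hc'.bounded_above_of_compact_support (hc.fderiv_apply ℝ _)
    have hid : ∀ n : ℕ, ∫ x, fderiv ℝ β x (basisVec j) *
        (∫ τ in (0 : ℝ)..‖f x‖, truncation w n τ) =
        -∫ x, β x * (truncation w n ‖f x‖ * (conj (f x) * g x).re / ‖f x‖) := fun n =>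
      h.integral_radial (hL n) (truncation_zero hw0 n) hβ hB hC
    have t1 : Tendsto (fun n : ℕ => ∫ x, fderiv ℝ β x (basisVec j) *
        (∫ τ in (0 : ℝ)..‖f x‖, truncation w n τ)) atTop
        (𝓝 (∫ x, fderiv ℝ β x (basisVec j) * ∫ τ in (0 : ℝ)..‖f x‖, w τ)) := by
      refine tendsto_integral_of_dominated_convergence
        (fun x => |fderiv ℝ β x (basisVec j)| * ∫ τ in (0 : ℝ)..‖f x‖, |w τ|)
        (fun n => hc'.aestronglyMeasurable.mul (hAm n)) ?_
        (fun n => .of_forall fun x => ?_) (.of_forall fun x => (hAlim x).const_mul _)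
      · exact hK.integrable_smul_left_of_hasCompactSupport hc'.abs
          ((hc.fderiv_apply ℝ (basisVec j)).comp_left abs_zero)
      · rw [norm_mul]
        exact mul_le_mul_of_nonneg_left (hAle n x) (abs_nonneg _)
    have t2 : Tendsto (fun n : ℕ =>
        ∫ x, β x * (truncation w n ‖f x‖ * (conj (f x) * g x).re / ‖f x‖)) atTop
        (𝓝 (∫ x, β x * (w ‖f x‖ * (conj (f x) * g x).re / ‖f x‖))) := by
      refine tendsto_integral_of_dominated_convergence
        (fun x => B * (|w ‖f x‖| * ‖g x‖))
        (fun n => hβ.continuous.aestronglyMeasurable.mul (hDm n)) (hwint.const_mul B)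
        (fun n => .of_forall fun x => ?_) (.of_forall fun x => (hDlim x).const_mul _)
      rw [norm_mul]
      exact mul_le_mul (hB x) (hDle n x) (norm_nonneg _) ((norm_nonneg _).trans (hB 0))
    simp_rw [hid] at t1
    exact tendsto_nhds_unique t1 t2.neg

end Radial

/-! ### The rescaled nonlinearity -/

/-- The radial profile `r ↦ ε^{-(N/2+2)} W'(ε^{N/2} r)` of `W_ε'`. -/
noncomputable def radialForce (N : ℕ) (ε : ℝ) (W : ℝ → ℝ) (r : ℝ) : ℝ :=
  1 / ε ^ ((N : ℝ) / 2 + 2) * halfLineDeriv W (ε ^ ((N : ℝ) / 2) * r)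

theorem wepsPrime_eq (ε : ℝ) (W : ℝ → ℝ) (z : ℂ) :
    WepsPrime N ε W z = (radialForce N ε W ‖z‖ : ℂ) * (z / ‖z‖) := rfl

namespace NonlinearityAssumption

variable {W : ℝ → ℝ} {ε : ℝ} (hW : NonlinearityAssumption N W)
include hW

theorem radialForce_zero : radialForce N ε W 0 = 0 := by
  simp [radialForce, hW.deriv_zero]

theorem contDiffOn_halfLineDeriv : ContDiffOn ℝ 1 (halfLineDeriv W) (Set.Ici 0) :=
  hW.contDiffOn.derivWithin (uniqueDiffOn_Ici 0) (by norm_num)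

theorem contDiffOn_radialForce (hε : 0 < ε) : ContDiffOn ℝ 1 (radialForce N ε W) (Set.Ici 0) :=
  contDiffOn_const.mul <| hW.contDiffOn_halfLineDeriv.comp (by fun_prop) fun r hr =>
    mul_nonneg (Real.rpow_nonneg hε.le _) hr

theorem exists_lipschitzOnWith_radialForce (hε : 0 < ε) (R : ℝ) :
    ∃ L : NNReal, LipschitzOnWith L (radialForce N ε W) (Set.Icc 0 R) :=
  ((hW.contDiffOn_radialForce hε).mono Set.Icc_subset_Ici_self).exists_lipschitzOnWith
    one_ne_zero (convex_Icc 0 R) isCompact_Icc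

theorem hasDerivAt_radial (hε : 0 < ε) {r : ℝ} (hr : 0 < r) :
    HasDerivAt (fun r => 1 / ε ^ (N + 2) * W (ε ^ ((N : ℝ) / 2) * r)) (radialForce N ε W r) r := by
  have hpos : 0 < ε ^ ((N : ℝ) / 2) := Real.rpow_pos_of_pos hε _
  have h1 : HasDerivAt W (halfLineDeriv W (ε ^ ((N : ℝ) / 2) * r)) (ε ^ ((N : ℝ) / 2) * r) :=
    ((hW.contDiffOn.differentiableOn (by norm_num)) _
      (mul_pos hpos hr).le).hasDerivWithinAt.hasDerivAt (Ici_mem_nhds (mul_pos hpos hr))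
  have h2 : HasDerivAt (fun r => ε ^ ((N : ℝ) / 2) * r) (ε ^ ((N : ℝ) / 2)) r := by
    simpa using (hasDerivAt_id r).const_mul (ε ^ ((N : ℝ) / 2))
  have h3 := (h1.comp r h2).const_mul (1 / ε ^ (N + 2))
  refine h3.congr_deriv ?_
  unfold radialForce
  rw [mul_comm (halfLineDeriv W _), ← mul_assoc]
  congr 1
  rw [← Real.rpow_natCast ε (N + 2), one_div, one_div, ← Real.rpow_neg hε.le,
    ← Real.rpow_neg hε.le, ← Real.rpow_add hε]
  congr 1
  push_cast
  ring

theorem weps_eq_integral (hε : 0 < ε) (z : ℂ) :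
    Weps N ε W z = ∫ τ in (0 : ℝ)..‖z‖, radialForce N ε W τ := by
  have hpos : 0 < ε ^ ((N : ℝ) / 2) := Real.rpow_pos_of_pos hε _
  have hsub : Set.Icc 0 ‖z‖ ⊆ Set.Ici (0 : ℝ) := Set.Icc_subset_Ici_self
  rw [intervalIntegral.integral_eq_sub_of_hasDerivAt_of_le (norm_nonneg z)
    (f := fun r => 1 / ε ^ (N + 2) * W (ε ^ ((N : ℝ) / 2) * r)) ?_
    (fun r hr => hW.hasDerivAt_radial hε hr.1) ?_]
  · simp [Weps, hW.zero]
  · refine continuousOn_const.mul (hW.contDiffOn.continuousOn.comp (by fun_prop) fun r hr => ?_)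
    exact mul_nonneg hpos.le hr.1
  · refine ContinuousOn.intervalIntegrable ?_
    rw [Set.uIcc_of_le (norm_nonneg z)]
    exact (hW.contDiffOn_radialForce hε).continuousOn.mono hsub

theorem norm_wepsPrime (z : ℂ) : ‖WepsPrime N ε W z‖ = |radialForce N ε W ‖z‖| := by
  rw [wepsPrime_eq, norm_mul, Complex.norm_real, Real.norm_eq_abs, norm_div, Complex.norm_real,
    norm_norm]
  rcases eq_or_ne z 0 with rfl | hz
  · simp [hW.radialForce_zero]
  · rw [div_self (norm_ne_zero_iff.2 hz), mul_one]

end NonlinearityAssumption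

/-! ### The cutoff and its smooth approximations -/

theorem cutoff_eq_max (s : ℝ) : cutoff s = max 0 (min 1 (s - 1)) := by
  unfold cutoff
  split_ifs with h1 h2
  · rw [max_eq_left ((min_le_right _ _).trans (by linarith))]
  · rw [min_eq_right (by linarith), max_eq_right (by linarith)]
  · rw [min_eq_left (by linarith), max_eq_right zero_le_one]

theorem continuous_cutoff : Continuous cutoff := by
  rw [funext cutoff_eq_max]
  fun_prop

theorem cutoff_nonneg (s : ℝ) : 0 ≤ cutoff s := by
  rw [cutoff_eq_max]; exact le_max_left _ _

theorem cutoff_le_one (s : ℝ) : cutoff s ≤ 1 := by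
  rw [cutoff_eq_max]; exact max_le zero_le_one (min_le_left _ _)

theorem cutoff_of_le_one {s : ℝ} (h : s ≤ 1) : cutoff s = 0 := if_pos h

theorem abs_cutoff_sub_le (s s' : ℝ) : |cutoff s - cutoff s'| ≤ |s - s'| := by
  have h : LipschitzWith 1 fun s : ℝ => max 0 (min 1 (s - 1)) :=
    ((LipschitzWith.of_dist_le_mul fun x y => by simp).const_min 1).const_max 0
  simpa [cutoff_eq_max, Real.dist_eq] using h.dist_le_mul s s'

/-- Continuous functions supported in `[1, 2]` which increase to the indicator of `(1, 2)`. -/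
noncomputable def tent (n : ℕ) (s : ℝ) : ℝ := max 0 (min 1 (n * min (s - 1) (2 - s)))

theorem continuous_tent (n : ℕ) : Continuous (tent n) := by
  unfold tent
  fun_prop

theorem abs_tent_le_one (n : ℕ) (s : ℝ) : |tent n s| ≤ 1 := by
  unfold tent
  rw [abs_of_nonneg (le_max_left _ _)]
  exact max_le zero_le_one (min_le_left _ _)

theorem tent_eq_zero (n : ℕ) {s : ℝ} (h : ¬(1 < s ∧ s < 2)) : tent n s = 0 := by
  refine max_eq_left ((min_le_right _ _).trans (mul_nonpos_of_nonneg_of_nonpos (by positivity) ?_))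
  by_contra! h'
  obtain ⟨h1, h2⟩ := lt_min_iff.1 h'
  exact h ⟨by linarith, by linarith⟩

theorem tendsto_tent (s : ℝ) :
    Tendsto (fun n => tent n s) atTop (𝓝 ((Set.Ioo 1 2).indicator 1 s)) := by
  by_cases h : s ∈ Set.Ioo (1 : ℝ) 2
  · rw [Set.indicator_of_mem h, Pi.one_apply]
    have hpos : 0 < min (s - 1) (2 - s) := lt_min (by linarith [h.1]) (by linarith [h.2])
    refine tendsto_const_nhds.congr' ?_
    filter_upwards [(tendsto_natCast_atTop_atTop.atTop_mul_const hpos).eventually_ge_atTop 1]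
      with n hn
    rw [tent, min_eq_left hn, max_eq_right zero_le_one]
  · rw [Set.indicator_of_notMem h]
    simp_rw [tent_eq_zero _ h]
    exact tendsto_const_nhds

/-- Approximations of `cutoff` of class `C¹`. -/
noncomputable def ramp (n : ℕ) (s : ℝ) : ℝ := ∫ τ in (1 : ℝ)..s, tent n τ

theorem hasDerivAt_ramp (n : ℕ) (s : ℝ) : HasDerivAt (ramp n) (tent n s) s :=
  intervalIntegral.integral_hasDerivAt_right ((continuous_tent n).intervalIntegrable _ _)
    (continuous_tent n).stronglyMeasurable.stronglyMeasurableAtFilter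
    (continuous_tent n).continuousAt

theorem contDiff_ramp (n : ℕ) : ContDiff ℝ 1 (ramp n) := by
  rw [contDiff_one_iff_deriv]
  refine ⟨fun s => (hasDerivAt_ramp n s).differentiableAt, ?_⟩
  rw [funext fun s => (hasDerivAt_ramp n s).deriv]
  exact continuous_tent n

theorem ramp_of_le_one (n : ℕ) {s : ℝ} (h : s ≤ 1) : ramp n s = 0 := by
  rw [ramp, intervalIntegral.integral_congr (g := fun _ => (0 : ℝ)), intervalIntegral.integral_zero]
  intro τ hτ
  rw [Set.uIcc_of_ge h] at hτ
  exact tent_eq_zero n fun h' => absurd h'.1 (not_lt.2 hτ.2)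

theorem abs_ramp_le (n : ℕ) (s : ℝ) : |ramp n s| ≤ |s - 1| := by
  have := intervalIntegral.norm_integral_le_of_norm_le_const (a := 1) (b := s) (f := tent n)
    (C := 1) (fun τ _ => abs_tent_le_one n τ)
  rwa [one_mul] at this

theorem integral_indicator_Ioo (s : ℝ) :
    ∫ τ in (1 : ℝ)..s, (Set.Ioo (1 : ℝ) 2).indicator (1 : ℝ → ℝ) τ = cutoff s := by
  rcases le_or_gt s 1 with h | h
  · rw [cutoff_of_le_one h, intervalIntegral.integral_congr (g := fun _ => (0 : ℝ)),
      intervalIntegral.integral_zero]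
    intro τ hτ
    rw [Set.uIcc_of_ge h] at hτ
    exact Set.indicator_of_notMem (fun h' => absurd h'.1 (not_lt.2 hτ.2)) _
  · rw [intervalIntegral.integral_of_le h.le, setIntegral_indicator measurableSet_Ioo]
    simp only [Pi.one_apply, integral_const, smul_eq_mul, mul_one, measureReal_restrict_apply_univ]
    unfold cutoff
    rw [if_neg (not_le.2 h)]
    split_ifs with h2
    · rcases h2.lt_or_eq with h3 | rfl
      · rw [Set.inter_eq_left.2
          (show Set.Ioc 1 s ⊆ Set.Ioo 1 2 from fun τ hτ => ⟨hτ.1, hτ.2.trans_lt h3⟩),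
          Real.volume_real_Ioc_of_le h.le]
      · rw [Set.inter_eq_right.2 Set.Ioo_subset_Ioc_self,
          Real.volume_real_Ioo_of_le (by norm_num)]
    · rw [Set.inter_eq_right.2
          (show Set.Ioo 1 2 ⊆ Set.Ioc 1 s from fun τ hτ => ⟨hτ.1, by linarith [hτ.2]⟩),
        Real.volume_real_Ioo_of_le (by norm_num)]
      norm_num

theorem tendsto_ramp (s : ℝ) : Tendsto (fun n => ramp n s) atTop (𝓝 (cutoff s)) := by
  rw [← integral_indicator_Ioo]
  exact intervalIntegral.tendsto_integral_filter_of_dominated_convergence (fun _ => 1)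
    (.of_forall fun n => (continuous_tent n).aestronglyMeasurable)
    (.of_forall fun n => .of_forall fun τ _ => abs_tent_le_one n τ)
    intervalIntegrable_const (.of_forall fun τ _ => tendsto_tent τ)

/-! ### Weights built from the cutoff -/

/-- The weight `ω φ(ρ)`. -/
noncomputable def cutWeight (ω r : E N → ℝ) (x : E N) : ℝ := ω x * cutoff (r x)

/-- The weak partial derivative `∂_k (ω φ(ρ)) = ∂_k ω φ(ρ) + ω 1_{1 < ρ < 2} ∂_k ρ`. -/
noncomputable def cutWeightDeriv (k : Fin N) (ω r : E N → ℝ) (x : E N) : ℝ :=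
  fderiv ℝ ω x (basisVec k) * cutoff (r x) +
    {x | 1 < r x ∧ r x < 2}.indicator (fun x => ω x * fderiv ℝ r x (basisVec k)) x

theorem measurableSet_haloSet {r : E N → ℝ} (hr : Continuous r) :
    MeasurableSet {x | 1 < r x ∧ r x < 2} :=
  ((isOpen_lt continuous_const hr).inter (isOpen_lt hr continuous_const)).measurableSet

section Weights

variable {ω r : E N → ℝ}

theorem continuous_fderiv_basisVec (hω : ContDiff ℝ 1 ω) (k : Fin N) :
    Continuous fun x => fderiv ℝ ω x (basisVec k) :=
  (hω.continuous_fderiv (by simp)).clm_apply continuous_const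

theorem continuous_cutWeight (hω : Continuous ω) (hr : Continuous r) :
    Continuous (cutWeight ω r) :=
  hω.mul (continuous_cutoff.comp hr)

theorem measurable_cutWeightDeriv (hω : ContDiff ℝ 1 ω) (hr : ContDiff ℝ 1 r) (k : Fin N) :
    Measurable (cutWeightDeriv k ω r) :=
  ((continuous_fderiv_basisVec hω k).mul (continuous_cutoff.comp hr.continuous)).measurable.add
    ((hω.continuous.mul (continuous_fderiv_basisVec hr k)).measurable.indicator
      (measurableSet_haloSet hr.continuous))

theorem cutWeight_eq_zero {x : E N} (h : r x ≤ 1) : cutWeight ω r x = 0 := by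
  rw [cutWeight, cutoff_of_le_one h, mul_zero]

theorem cutWeightDeriv_eq_zero {x : E N} (h : r x ≤ 1) (k : Fin N) :
    cutWeightDeriv k ω r x = 0 := by
  rw [cutWeightDeriv, cutoff_of_le_one h, mul_zero, zero_add]
  exact Set.indicator_of_notMem (fun h' => absurd h'.1 (not_lt.2 h)) _

theorem abs_cutWeight_le {M : ℝ} {x : E N} (hM : |ω x| ≤ M) : |cutWeight ω r x| ≤ M := by
  rw [cutWeight, abs_mul, abs_of_nonneg (cutoff_nonneg _)]
  exact (mul_le_of_le_one_right (abs_nonneg _) (cutoff_le_one _)).trans hM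

theorem abs_cutWeightDeriv_le {M M' L : ℝ} {x : E N} {k : Fin N} (hM : |ω x| ≤ M)
    (hM' : |fderiv ℝ ω x (basisVec k)| ≤ M') (hL : |fderiv ℝ r x (basisVec k)| ≤ L) :
    |cutWeightDeriv k ω r x| ≤ M' + M * L := by
  have hM0 := (abs_nonneg _).trans hM
  have hL0 := (abs_nonneg _).trans hL
  refine (abs_add_le _ _).trans (add_le_add ?_ ?_)
  · rw [abs_mul, abs_of_nonneg (cutoff_nonneg _)]
    exact (mul_le_of_le_one_right (abs_nonneg _) (cutoff_le_one _)).trans hM'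
  · by_cases hx : x ∈ {x | 1 < r x ∧ r x < 2}
    · rw [Set.indicator_of_mem hx, abs_mul]
      exact mul_le_mul hM hL (abs_nonneg _) hM0
    · rw [Set.indicator_of_notMem hx, abs_zero]
      positivity

/-- Integration by parts against `ω φ(ρ)`. Since `φ` has kinks, `φ(ρ)` is approximated by `φ_n(ρ)`
with `φ_n` of class `C¹` and `φ_n' → 1_{(1,2)}` everywhere. -/
theorem HasLocalPartial.integral_cutWeight {F : Type*} [NormedAddCommGroup F] [NormedSpace ℝ F]
    {k : Fin N} {U D : E N → F} (h : HasLocalPartial k U D) (hω : ContDiff ℝ 1 ω)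
    (hr : ContDiff ℝ 1 r) {R : ℝ} (hR : ∀ x, R ≤ ‖x‖ → r x ≤ 1) :
    ∫ x, cutWeightDeriv k ω r x • U x = -∫ x, cutWeight ω r x • D x := by
  have hK : IsCompact (Metric.closedBall (0 : E N) R) := isCompact_closedBall _ _
  have hout : ∀ x ∉ Metric.closedBall (0 : E N) R, r x ≤ 1 := fun x hx =>
    hR x (not_le.1 (fun h' => hx (mem_closedBall_zero_iff.2 h'))).le
  have hωk := continuous_fderiv_basisVec hω k
  have hrk := continuous_fderiv_basisVec hr k
  obtain ⟨M, hM⟩ := hK.exists_bound_of_continuousOn hω.continuous.continuousOn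
  obtain ⟨M', hM'⟩ := hK.exists_bound_of_continuousOn hωk.continuousOn
  obtain ⟨L, hL⟩ := hK.exists_bound_of_continuousOn hrk.continuousOn
  obtain ⟨P, hP⟩ := hK.exists_bound_of_continuousOn
    (hr.continuous.sub continuous_const (g := fun _ => (1 : ℝ))).continuousOn
  have hβ : ∀ n, ContDiff ℝ 1 fun x => ω x * ramp n (r x) := fun n =>
    hω.mul ((contDiff_ramp n).comp hr)
  have hc : ∀ n, HasCompactSupport fun x => ω x * ramp n (r x) := fun n =>
    HasCompactSupport.intro hK fun x hx => by rw [ramp_of_le_one n (hout x hx), mul_zero]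
  have hder : ∀ n x, fderiv ℝ (fun x => ω x * ramp n (r x)) x (basisVec k) =
      fderiv ℝ ω x (basisVec k) * ramp n (r x) +
        ω x * (tent n (r x) * fderiv ℝ r x (basisVec k)) := by
    intro n x
    have h1 := (hasDerivAt_ramp n (r x)).comp_hasFDerivAt x
      (hr.differentiable (by simp) x).hasFDerivAt
    have h2 := ((hω.differentiable (by simp) x).hasFDerivAt.mul h1).fderiv
    have h3 : fderiv ℝ (fun x => ω x * ramp n (r x)) x = _ := h2
    rw [h3]
    simp
    ring
  have hid := fun n => h.integral_eq _ (hβ n) (hc n)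
  simp_rw [hder] at hid
  have hUK : IntegrableOn U (Metric.closedBall 0 R) := h.locallyIntegrable.integrableOn_isCompact hK
  have hDK : IntegrableOn D (Metric.closedBall 0 R) :=
    h.locallyIntegrable_deriv.integrableOn_isCompact hK
  have t1 : Tendsto (fun n => ∫ x, (fderiv ℝ ω x (basisVec k) * ramp n (r x) +
        ω x * (tent n (r x) * fderiv ℝ r x (basisVec k))) • U x) atTop
      (𝓝 (∫ x, cutWeightDeriv k ω r x • U x)) := by
    refine tendsto_integral_of_dominated_convergence
      ((Metric.closedBall 0 R).indicator fun x => (M' * P + M * L) * ‖U x‖)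
      (fun n => ?_) ((integrable_indicator_iff measurableSet_closedBall).2 (hUK.norm.const_mul _))
      (fun n => .of_forall fun x => ?_) (.of_forall fun x => Tendsto.smul_const ?_ _)
    · exact ((hωk.mul ((contDiff_ramp n).continuous.comp hr.continuous)).add
        (hω.continuous.mul (((continuous_tent n).comp hr.continuous).mul
          hrk))).aestronglyMeasurable.smul h.locallyIntegrable.aestronglyMeasurable
    · by_cases hx : x ∈ Metric.closedBall (0 : E N) R
      · rw [Set.indicator_of_mem hx, norm_smul]
        refine mul_le_mul_of_nonneg_right ?_ (norm_nonneg _)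
        refine (norm_add_le _ _).trans (add_le_add ?_ ?_)
        · rw [norm_mul]
          exact mul_le_mul (hM' x hx) ((abs_ramp_le n _).trans (hP x hx)) (norm_nonneg _)
            ((norm_nonneg _).trans (hM' x hx))
        · rw [norm_mul, norm_mul]
          exact mul_le_mul (hM x hx) ((mul_le_of_le_one_left (norm_nonneg _)
            (abs_tent_le_one n _)).trans (hL x hx)) (by positivity)
            ((norm_nonneg _).trans (hM x hx))
      · rw [Set.indicator_of_notMem hx, ramp_of_le_one n (hout x hx),
          tent_eq_zero n fun h' => absurd h'.1 (not_lt.2 (hout x hx))]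
        simp
    · refine ((tendsto_ramp (r x)).const_mul _).add ?_
      have h1 := (((tendsto_tent (r x)).mul_const (fderiv ℝ r x (basisVec k))).const_mul (ω x))
      convert h1 using 2
      by_cases hx : 1 < r x ∧ r x < 2
      · rw [Set.indicator_of_mem (show x ∈ {x | 1 < r x ∧ r x < 2} from hx),
          Set.indicator_of_mem (show r x ∈ Set.Ioo (1 : ℝ) 2 from hx)]
        simp
      · rw [Set.indicator_of_notMem (show x ∉ {x | 1 < r x ∧ r x < 2} from hx),
          Set.indicator_of_notMem (show r x ∉ Set.Ioo (1 : ℝ) 2 from hx)]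
        simp
  have t2 : Tendsto (fun n => ∫ x, (ω x * ramp n (r x)) • D x) atTop
      (𝓝 (∫ x, cutWeight ω r x • D x)) := by
    refine tendsto_integral_of_dominated_convergence
      ((Metric.closedBall 0 R).indicator fun x => (M * P) * ‖D x‖)
      (fun n => ?_) ((integrable_indicator_iff measurableSet_closedBall).2 (hDK.norm.const_mul _))
      (fun n => .of_forall fun x => ?_)
      (.of_forall fun x => ((tendsto_ramp (r x)).const_mul _).smul_const _)
    · exact (hβ n).continuous.aestronglyMeasurable.smul
        h.locallyIntegrable_deriv.aestronglyMeasurable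
    · by_cases hx : x ∈ Metric.closedBall (0 : E N) R
      · rw [Set.indicator_of_mem hx, norm_smul, norm_mul]
        refine mul_le_mul_of_nonneg_right ?_ (norm_nonneg _)
        exact mul_le_mul (hM x hx) ((abs_ramp_le n _).trans (hP x hx)) (norm_nonneg _)
            ((norm_nonneg _).trans (hM x hx))
      · rw [Set.indicator_of_notMem hx, ramp_of_le_one n (hout x hx)]
        simp
  simp_rw [hid] at t1
  exact tendsto_nhds_unique t1 t2.neg

end Weights

/-! ### The density -/

namespace IsDensity

variable {ρ : ℝ → E N → ℝ} {J : ℝ → E N → E N} (hρ : IsDensity ρ J)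
include hρ

theorem hasFDerivAt (z : ℝ × E N) :
    HasFDerivAt (fun z : ℝ × E N => ρ z.1 z.2) (fderiv ℝ (fun z : ℝ × E N => ρ z.1 z.2) z) z :=
  (hρ.contDiff.differentiable (by simp) z).hasFDerivAt

theorem contDiff_space (t : ℝ) : ContDiff ℝ 1 (ρ t) :=
  hρ.contDiff.comp (contDiff_const.prodMk contDiff_id)

theorem hasDerivAt_time (t : ℝ) (x : E N) :
    HasDerivAt (fun s => ρ s x) (-divergence (J t) x) t := by
  have h : ContDiff ℝ 1 fun s => ρ s x :=
    hρ.contDiff.comp (contDiff_id.prodMk contDiff_const)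
  rw [← eq_neg_of_add_eq_zero_left (hρ.continuity t x)]
  exact (h.differentiable (by simp) t).hasDerivAt

theorem fderiv_space (t : ℝ) (x v : E N) :
    fderiv ℝ (ρ t) x v = fderiv ℝ (fun z : ℝ × E N => ρ z.1 z.2) (t, x) (0, v) := by
  have h1 : HasFDerivAt (fun x : E N => ((t, x) : ℝ × E N)) (ContinuousLinearMap.inr ℝ ℝ (E N)) x :=
    (hasFDerivAt_const t x).prodMk (hasFDerivAt_id x)
  have h2 := ((hρ.hasFDerivAt (t, x)).comp x h1).fderiv
  have h3 : fderiv ℝ (ρ t) x = _ := h2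
  rw [h3]
  simp

theorem divergence_eq (t : ℝ) (x : E N) :
    -divergence (J t) x = fderiv ℝ (fun z : ℝ × E N => ρ z.1 z.2) (t, x) (1, 0) := by
  have h1 : HasDerivAt (fun s : ℝ => ((s, x) : ℝ × E N)) (1, 0) t :=
    (hasDerivAt_id t).prodMk (hasDerivAt_const t x)
  have h2 : HasDerivAt (fun s => ρ s x)
      (fderiv ℝ (fun z : ℝ × E N => ρ z.1 z.2) (t, x) (1, 0)) t :=
    HasFDerivAt.comp_hasDerivAt (l := fun z : ℝ × E N => ρ z.1 z.2) t (hρ.hasFDerivAt (t, x)) h1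
  exact (hρ.hasDerivAt_time t x).unique h2

theorem continuous_divergence : Continuous fun z : ℝ × E N => divergence (J z.1) z.2 := by
  have : (fun z : ℝ × E N => divergence (J z.1) z.2) =
      fun z => -fderiv ℝ (fun z : ℝ × E N => ρ z.1 z.2) z (1, 0) := by
    ext z
    rw [← hρ.divergence_eq, neg_neg]
  rw [this]
  exact ((hρ.contDiff.continuous_fderiv (by simp)).clm_apply continuous_const).neg

/-- Almost every time is regular: along each line `{x} × ℝ`, the times at which `ρ` attains a
given level with `∂_t ρ ≠ 0` are isolated. -/
theorem ae_isRegularTime : ∀ᵐ t : ℝ, IsRegularTime ρ J t := by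
  have hm : ∀ c : ℝ, MeasurableSet {z : ℝ × E N | ρ z.1 z.2 = c} := fun c =>
    (isClosed_eq hρ.contDiff.continuous continuous_const).measurableSet
  have hm0 : MeasurableSet {z : ℝ × E N | divergence (J z.1) z.2 = 0} :=
    (isClosed_eq hρ.continuous_divergence continuous_const).measurableSet
  have hmeas : MeasurableSet {z : ℝ × E N |
      (ρ z.1 z.2 = 1 ∨ ρ z.1 z.2 = 2) → divergence (J z.1) z.2 = 0} := by
    convert ((hm 1).union (hm 2)).compl.union hm0 using 1
    ext z
    simp only [Set.mem_ofPred_eq, Set.mem_union, Set.mem_compl_iff, imp_iff_not_or]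
  have key : ∀ (x : E N) (c : ℝ), {t | ρ t x = c ∧ divergence (J t) x ≠ 0}.Countable := by
    intro x c
    have hsub : {t | ρ t x = c ∧ divergence (J t) x ≠ 0} ⊆
        {t ∈ {t | ρ t x = c ∧ divergence (J t) x ≠ 0} |
          𝓝[{t | ρ t x = c ∧ divergence (J t) x ≠ 0} ∩ Set.Ioi t] t = ⊥} := by
      intro t ht
      refine ⟨ht, ?_⟩
      have h1 := (hρ.hasDerivAt_time t x).eventually_ne (c := c) (neg_ne_zero.2 ht.2)
      rw [← Filter.eventually_false_iff_eq_bot]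
      filter_upwards [h1.filter_mono (nhdsWithin_mono _ fun s hs => (Set.mem_Ioi.1 hs.2).ne'),
        self_mem_nhdsWithin] with s hs hs'
      exact hs hs'.1.1
    exact countable_setOfPred_isolated_right_within.mono hsub
  refine (Measure.ae_ae_comm (μ := (volume : Measure ℝ)) (ν := (volume : Measure (E N)))
    (p := fun t x => (ρ t x = 1 ∨ ρ t x = 2) → divergence (J t) x = 0) hmeas).2
    (.of_forall fun x => ?_)
  filter_upwards [(key x 1).ae_notMem volume, (key x 2).ae_notMem volume] with t h1 h2 h
  by_contra h0
  exact h.elim (fun h => h1 ⟨h, h0⟩) fun h => h2 ⟨h, h0⟩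

theorem exists_radius (τ : ℝ) : ∃ R : ℝ, ∀ t x, |t| ≤ τ → R ≤ ‖x‖ → ρ t x ≤ 1 := by
  obtain ⟨R, hR⟩ := hρ.decay τ 1 one_pos
  exact ⟨R, fun t x ht hx => (le_abs_self _).trans (hR t x ht hx).le⟩

/-- Bounds for the weights, uniform in time on bounded intervals. -/
theorem exists_bound {ω : E N → ℝ} (hω : ContDiff ℝ 1 ω) (τ : ℝ) :
    ∃ B : ℝ, ∀ t, |t| ≤ τ → IsBoundedWeight (cutWeight ω (ρ t)) B ∧
      (∀ k, IsBoundedWeight (cutWeightDeriv k ω (ρ t)) B) ∧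
      ∀ s, |s| ≤ τ → ∀ x, |cutWeight ω (ρ s) x - cutWeight ω (ρ t) x| ≤ B * |s - t| := by
  obtain ⟨R, hR⟩ := hρ.exists_radius τ
  have hK : IsCompact (Metric.closedBall (0 : E N) R) := isCompact_closedBall _ _
  have hK' : IsCompact (Set.Icc (-τ) τ ×ˢ Metric.closedBall (0 : E N) R) := isCompact_Icc.prod hK
  have hout : ∀ t x, |t| ≤ τ → x ∉ Metric.closedBall (0 : E N) R → ρ t x ≤ 1 := fun t x ht hx =>
    hR t x ht (not_le.1 (fun h' => hx (mem_closedBall_zero_iff.2 h'))).le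
  obtain ⟨M, hM⟩ := hK.exists_bound_of_continuousOn hω.continuous.continuousOn
  obtain ⟨M', hM'⟩ := hK.exists_bound_of_continuousOn
    (hω.continuous_fderiv (by simp)).continuousOn
  obtain ⟨L, hL⟩ := hK'.exists_bound_of_continuousOn
    (hρ.contDiff.continuous_fderiv (by simp)).continuousOn
  have hk : ∀ (A : E N →L[ℝ] ℝ) (k : Fin N), |A (basisVec k)| ≤ ‖A‖ := fun A k => by
    have := A.le_opNorm (basisVec k)
    rwa [norm_basisVec, mul_one] at this
  have hLk : ∀ t x, |t| ≤ τ → x ∈ Metric.closedBall (0 : E N) R → ∀ k,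
      |fderiv ℝ (ρ t) x (basisVec k)| ≤ L := by
    intro t x ht hx k
    rw [hρ.fderiv_space, ← Real.norm_eq_abs]
    refine (ContinuousLinearMap.le_opNorm _ _).trans ?_
    have : ‖((0 : ℝ), (basisVec k : E N))‖ = 1 := by simp [Prod.norm_def, norm_basisVec]
    rw [this, mul_one]
    exact hL (t, x) ⟨abs_le.1 ht, hx⟩
  have hLt : ∀ t x, |t| ≤ τ → x ∈ Metric.closedBall (0 : E N) R →
      |divergence (J t) x| ≤ L := by
    intro t x ht hx
    rw [← abs_neg, hρ.divergence_eq, ← Real.norm_eq_abs]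
    refine (ContinuousLinearMap.le_opNorm _ _).trans ?_
    have : ‖((1 : ℝ), (0 : E N))‖ = 1 := by simp [Prod.norm_def]
    rw [this, mul_one]
    exact hL (t, x) ⟨abs_le.1 ht, hx⟩
  refine ⟨|M| + |M'| + |M| * |L|, fun t ht => ⟨⟨?_, fun x => ?_⟩, fun k => ⟨?_, fun x => ?_⟩,
    fun s hs x => ?_⟩⟩
  · exact (continuous_cutWeight hω.continuous (hρ.contDiff_space t).continuous).aestronglyMeasurable
  · by_cases hx : x ∈ Metric.closedBall (0 : E N) R
    · refine (abs_cutWeight_le (hM x hx)).trans ?_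
      have : 0 ≤ |M'| + |M| * |L| := by positivity
      linarith [le_abs_self M]
    · rw [cutWeight_eq_zero (hout t x ht hx), abs_zero]
      positivity
  · exact (measurable_cutWeightDeriv hω (hρ.contDiff_space t) k).aestronglyMeasurable
  · by_cases hx : x ∈ Metric.closedBall (0 : E N) R
    · refine (abs_cutWeightDeriv_le ((hM x hx).trans (le_abs_self M))
        (((hk _ k).trans (hM' x hx)).trans (le_abs_self M'))
        ((hLk t x ht hx k).trans (le_abs_self L))).trans ?_
      linarith [abs_nonneg M]
    · rw [cutWeightDeriv_eq_zero (hout t x ht hx), abs_zero]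
      positivity
  · by_cases hx : x ∈ Metric.closedBall (0 : E N) R
    · have h1 : |ρ s x - ρ t x| ≤ |L| * |s - t| := by
        refine (convex_Icc (-τ) τ).norm_image_sub_le_of_norm_hasDerivWithin_le
          (fun u _ => (hρ.hasDerivAt_time u x).hasDerivWithinAt) (fun u hu => ?_)
          (abs_le.1 ht) (abs_le.1 hs)
        rw [norm_neg]
        exact (hLt u x (abs_le.2 hu) hx).trans (le_abs_self L)
      rw [cutWeight, cutWeight, ← mul_sub, abs_mul]
      calc |ω x| * |cutoff (ρ s x) - cutoff (ρ t x)| ≤ |M| * (|L| * |s - t|) :=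
            mul_le_mul ((hM x hx).trans (le_abs_self M)) ((abs_cutoff_sub_le _ _).trans h1)
              (abs_nonneg _) (abs_nonneg _)
        _ = (|M| * |L|) * |s - t| := by ring
        _ ≤ _ := by
          refine mul_le_mul_of_nonneg_right ?_ (abs_nonneg _)
          linarith [abs_nonneg M, abs_nonneg M']
    · rw [cutWeight_eq_zero (hout t x ht hx), cutWeight_eq_zero (hout s x hs hx), sub_zero,
        abs_zero]
      positivity

/-- The time derivative of `φ(ρ)` at a point where `ρ ∉ {1, 2}` or `∂_t ρ = 0`. -/
theorem hasDerivAt_cutoff {t : ℝ} {x : E N}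
    (hx : (ρ t x = 1 ∨ ρ t x = 2) → divergence (J t) x = 0) :
    HasDerivAt (fun s => cutoff (ρ s x))
      ((halo ρ t).indicator (fun x => -divergence (J t) x) x) t := by
  have hd := hρ.hasDerivAt_time t x
  have hcont := hd.continuousAt
  by_cases h12 : ρ t x = 1 ∨ ρ t x = 2
  · have h0 : x ∉ halo ρ t := fun h => h12.elim (fun h' => h.1.ne' h') fun h' => h.2.ne h'
    rw [Set.indicator_of_notMem h0]
    rw [hx h12, neg_zero] at hd
    rw [hasDerivAt_iff_isLittleO] at hd ⊢
    simp only [smul_zero, sub_zero] at hd ⊢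
    exact (Asymptotics.IsBigO.of_bound 1 (.of_forall fun s => by
      rw [one_mul]; exact abs_cutoff_sub_le _ _)).trans_isLittleO hd
  · push Not at h12
    rcases lt_or_gt_of_ne h12.1 with h1 | h1
    · rw [Set.indicator_of_notMem (fun h => absurd h.1 (not_lt.2 h1.le))]
      refine (hasDerivAt_const t (0 : ℝ)).congr_of_eventuallyEq ?_
      filter_upwards [hcont.eventually_lt_const h1] with s hs
      exact cutoff_of_le_one hs.le
    · rcases lt_or_gt_of_ne h12.2 with h2 | h2
      · rw [Set.indicator_of_mem (show x ∈ halo ρ t from ⟨h1, h2⟩)]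
        refine (hd.sub_const 1).congr_of_eventuallyEq ?_
        filter_upwards [hcont.eventually_const_lt h1, hcont.eventually_lt_const h2] with s hs hs'
        rw [cutoff, if_neg (not_le.2 hs), if_pos hs'.le]
      · rw [Set.indicator_of_notMem (fun h => absurd h.2 (not_lt.2 h2.le))]
        refine (hasDerivAt_const t (1 : ℝ)).congr_of_eventuallyEq ?_
        filter_upwards [hcont.eventually_const_lt h2] with s hs
        rw [cutoff, if_neg (not_le.2 (by linarith)), if_neg (not_le.2 hs)]

end IsDensity

/-! ### Integration by parts and integrability with the cutoff -/

section CutWeight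

variable {ω r : E N → ℝ} {R : ℝ}

theorem hasCompactSupport_cutWeight (hR : ∀ x, R ≤ ‖x‖ → r x ≤ 1) :
    HasCompactSupport (cutWeight ω r) :=
  HasCompactSupport.intro (isCompact_closedBall (0 : E N) R) fun x hx =>
    cutWeight_eq_zero (hR x (not_le.1 (fun h' => hx (mem_closedBall_zero_iff.2 h'))).le)

theorem integrable_cutWeight_mul (hω : Continuous ω) (hr : Continuous r)
    (hR : ∀ x, R ≤ ‖x‖ → r x ≤ 1) {U : E N → ℝ} (hU : LocallyIntegrable U) :
    Integrable fun x => cutWeight ω r x * U x :=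
  hU.integrable_smul_left_of_hasCompactSupport (continuous_cutWeight hω hr)
    (hasCompactSupport_cutWeight hR)

theorem integrableOn_haloSet (hR : ∀ x, R ≤ ‖x‖ → r x ≤ 1) {a U : E N → ℝ} (ha : Continuous a)
    (hU : LocallyIntegrable U) :
    IntegrableOn (fun x => a x * U x) {x | 1 < r x ∧ r x < 2} := by
  refine ((hU.continuous_mul ha).integrableOn_isCompact
    (isCompact_closedBall (0 : E N) R)).mono_set fun x hx => ?_
  rw [mem_closedBall_zero_iff]
  by_contra! h
  exact absurd hx.1 (not_lt.2 (hR x h.le))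

theorem integrable_cutWeightDeriv_mul (hω : ContDiff ℝ 1 ω) (hr : ContDiff ℝ 1 r)
    (hR : ∀ x, R ≤ ‖x‖ → r x ≤ 1) (k : Fin N) {U : E N → ℝ} (hU : LocallyIntegrable U) :
    Integrable fun x => cutWeightDeriv k ω r x * U x := by
  have h1 := integrable_cutWeight_mul (continuous_fderiv_basisVec hω k) hr.continuous hR hU
  have h2 := (integrable_indicator_iff (measurableSet_haloSet hr.continuous)).2
    (integrableOn_haloSet hR (hω.continuous.mul (continuous_fderiv_basisVec hr k)) hU)
  refine (h1.add h2).congr (.of_forall fun x => ?_)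
  simp only [Pi.add_apply, cutWeightDeriv, cutWeight, add_mul]
  by_cases hx : x ∈ {x | 1 < r x ∧ r x < 2}
  · simp only [Set.indicator_of_mem hx, Pi.mul_apply]
  · simp only [Set.indicator_of_notMem hx, zero_mul]

theorem HasLocalPartial.integrable_cutWeight {k : Fin N} {U D : E N → ℝ}
    (h : HasLocalPartial k U D) (hω : ContDiff ℝ 1 ω) (hr : ContDiff ℝ 1 r)
    (hR : ∀ x, R ≤ ‖x‖ → r x ≤ 1) :
    Integrable fun x => cutWeight ω r x * D x + cutWeightDeriv k ω r x * U x :=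
  (integrable_cutWeight_mul hω.continuous hr.continuous hR h.locallyIntegrable_deriv).add
    (integrable_cutWeightDeriv_mul hω hr hR k h.locallyIntegrable)

theorem HasLocalPartial.integral_cutWeight_eq_zero {k : Fin N} {U D : E N → ℝ}
    (h : HasLocalPartial k U D) (hω : ContDiff ℝ 1 ω) (hr : ContDiff ℝ 1 r)
    (hR : ∀ x, R ≤ ‖x‖ → r x ≤ 1) :
    ∫ x, (cutWeight ω r x * D x + cutWeightDeriv k ω r x * U x) = 0 := by
  have h1 := h.integral_cutWeight hω hr hR
  simp only [smul_eq_mul] at h1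
  rw [integral_add
    (integrable_cutWeight_mul hω.continuous hr.continuous hR h.locallyIntegrable_deriv)
    (integrable_cutWeightDeriv_mul hω hr hR k h.locallyIntegrable), h1]
  ring

/-- Integration by parts in the pairing of two functions of class `H¹`. -/
theorem pairing_cutWeight_partial {k : Fin N} {f f' h h' : L2 N} (hf : HasWeakPartial k f f')
    (hh : HasWeakPartial k h h') (hω : ContDiff ℝ 1 ω) (hr : ContDiff ℝ 1 r)
    (hR : ∀ x, R ≤ ‖x‖ → r x ≤ 1) {B : ℝ} (hB : IsBoundedWeight (cutWeight ω r) B) :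
    pairing (cutWeight ω r) f h' =
      -pairing (cutWeight ω r) f' h - pairing (cutWeightDeriv k ω r) f h := by
  have h1 := (hf.conj_mul hh).integral_cutWeight hω hr hR
  simp only [Complex.real_smul, mul_add] at h1
  rw [integral_add (hB.integrable_pairing f' h) (hB.integrable_pairing f h')] at h1
  simp only [pairing]
  rw [h1]
  ring

end CutWeight

theorem IsBoundedWeight.re_pairing {β : E N → ℝ} {B : ℝ} (hβ : IsBoundedWeight β B) (f h : L2 N) :
    (pairing β f h).re = ∫ x, β x * (conj (f x) * h x).re := by
  have := Complex.reCLM.integral_comp_comm (hβ.integrable_pairing f h)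
  rw [pairing, ← Complex.reCLM_apply, ← this]
  simp only [Complex.reCLM_apply, Complex.re_ofReal_mul]

theorem IsBoundedWeight.im_pairing {β : E N → ℝ} {B : ℝ} (hβ : IsBoundedWeight β B) (f h : L2 N) :
    (pairing β f h).im = ∫ x, β x * (conj (f x) * h x).im := by
  have := Complex.imCLM.integral_comp_comm (hβ.integrable_pairing f h)
  rw [pairing, ← Complex.imCLM_apply, ← this]
  simp only [Complex.imCLM_apply, Complex.im_ofReal_mul]

/-! ### Time-dependent weights -/

theorem pairing_sub_weight {β γ : E N → ℝ} {B B' : ℝ} (hβ : IsBoundedWeight β B)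
    (hγ : IsBoundedWeight γ B') (f h : L2 N) :
    pairing β f h - pairing γ f h = pairing (fun x => β x - γ x) f h := by
  rw [pairing, pairing, ← integral_sub (hβ.integrable_pairing f h) (hγ.integrable_pairing f h)]
  simp only [pairing, Complex.ofReal_sub, sub_mul]

theorem pairing_smul_weight (c : ℝ) (β : E N → ℝ) (f h : L2 N) :
    pairing (fun x => c * β x) f h = c * pairing β f h := by
  rw [pairing, pairing, ← integral_const_mul]
  simp only [Complex.ofReal_mul, mul_assoc]

namespace IsDensity

variable {ρ : ℝ → E N → ℝ} {J : ℝ → E N → E N} (hρ : IsDensity ρ J)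
include hρ

/-- Differentiating `∫ ω φ(ρ) f̄ h` at a regular time, given the derivative `D` for a weight frozen
at that time. The difference quotients of the weight are bounded, because `φ` is Lipschitz, and
converge almost everywhere, because the time is regular. -/
theorem hasDerivAt_pairing {ω : E N → ℝ} (hω : ContDiff ℝ 1 ω) {t : ℝ}
    (ht : IsRegularTime ρ J t) {f h : ℝ → L2 N} (hf : ContinuousAt f t) (hh : ContinuousAt h t)
    {D : ℂ} (hD : HasDerivAt (fun s => pairing (cutWeight ω (ρ t)) (f s) (h s)) D t) :
    HasDerivAt (fun s => pairing (cutWeight ω (ρ s)) (f s) (h s))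
      (D + pairing (fun x => ω x * (halo ρ t).indicator (fun x => -divergence (J t) x) x)
        (f t) (h t)) t := by
  set b : E N → ℝ := fun x => ω x * (halo ρ t).indicator (fun x => -divergence (J t) x) x with hb
  obtain ⟨B, hB⟩ := hρ.exists_bound hω (|t| + 1)
  have ht1 : |t| ≤ |t| + 1 := by linarith
  have hBt := (hB t ht1).1
  have hnear : ∀ᶠ s in 𝓝[≠] t, |s| ≤ |t| + 1 := by
    refine nhdsWithin_le_nhds ?_
    exact (continuous_abs.continuousAt.eventually_lt_const (by linarith : |t| < |t| + 1)).mono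
      fun s hs => hs.le
  -- the difference quotients of the weight
  set γ : ℝ → E N → ℝ := fun s x =>
    (s - t)⁻¹ * (cutWeight ω (ρ s) x - cutWeight ω (ρ t) x) with hγ
  have hγB : ∀ s, |s| ≤ |t| + 1 → IsBoundedWeight (γ s) B := by
    intro s hs
    refine ⟨(((hB s hs).1.aestronglyMeasurable).sub hBt.aestronglyMeasurable).const_mul _,
      fun x => ?_⟩
    rw [hγ]
    simp only [abs_mul, abs_inv]
    rcases eq_or_ne s t with rfl | hst
    · simp only [sub_self, abs_zero, inv_zero, zero_mul]
      exact hBt.nonneg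
    · rw [inv_mul_le_iff₀ (abs_pos.2 (sub_ne_zero.2 hst)), mul_comm]
      exact (hB t ht1).2.2 s hs x
  have h2 : HasDerivAt (fun s => pairing (cutWeight ω (ρ s)) (f s) (h s)
      - pairing (cutWeight ω (ρ t)) (f s) (h s)) (pairing b (f t) (h t)) t := by
    rw [hasDerivAt_iff_tendsto_slope]
    have hslope : ∀ᶠ s in 𝓝[≠] t, pairing (γ s) (f s) (h s) =
        slope (fun s => pairing (cutWeight ω (ρ s)) (f s) (h s)
          - pairing (cutWeight ω (ρ t)) (f s) (h s)) t s := by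
      filter_upwards [hnear] with s hs
      rw [slope_def_module, sub_self, sub_zero, pairing_sub_weight (hB s hs).1 hBt, hγ,
        pairing_smul_weight, Complex.real_smul]
    refine Tendsto.congr' hslope ?_
    have hlim : Tendsto (fun s => pairing (γ s) (f t) (h t)) (𝓝[≠] t)
        (𝓝 (pairing b (f t) (h t))) := by
      refine tendsto_integral_filter_of_dominated_convergence
        (fun x => B * ‖conj (f t x) * h t x‖) ?_ ?_
        ((integrable_conj_mul (f t) (h t)).norm.const_mul B) ?_
      · filter_upwards [hnear] with s hs
        exact ((hγB s hs).integrable_pairing (f t) (h t)).1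
      · filter_upwards [hnear] with s hs
        refine .of_forall fun x => ?_
        rw [norm_mul, Complex.norm_real]
        exact mul_le_mul_of_nonneg_right ((hγB s hs).bound x) (norm_nonneg _)
      · filter_upwards [ht] with x hx
        have h3 := ((hρ.hasDerivAt_cutoff hx).const_mul (ω x)).tendsto_slope
        refine Tendsto.mul_const _ ((Complex.continuous_ofReal.tendsto _).comp ?_)
        refine h3.congr fun s => ?_
        rw [slope_def_module, smul_eq_mul]
        rfl
    have hzero : Tendsto (fun s => pairing (γ s) (f s) (h s) - pairing (γ s) (f t) (h t))
        (𝓝[≠] t) (𝓝 0) := by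
      have hft : Tendsto f (𝓝[≠] t) (𝓝 (f t)) := hf.tendsto.mono_left nhdsWithin_le_nhds
      have hht : Tendsto h (𝓝[≠] t) (𝓝 (h t)) := hh.tendsto.mono_left nhdsWithin_le_nhds
      have hbd : Tendsto (fun s => B * (‖f s - f t‖ * ‖h s‖) + B * (‖f t‖ * ‖h s - h t‖))
          (𝓝[≠] t) (𝓝 0) := by
        have e1 := (((hft.sub_const (f t)).norm.mul hht.norm).const_mul B).add
          (((hht.sub_const (h t)).norm.const_mul ‖f t‖).const_mul B)
        simpa using e1
      refine squeeze_zero_norm' ?_ hbd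
      filter_upwards [hnear] with s hs
      have e2 : pairing (γ s) (f s) (h s) - pairing (γ s) (f t) (h t) =
          pairing (γ s) (f s - f t) (h s) + pairing (γ s) (f t) (h s - h t) := by
        rw [(hγB s hs).pairing_sub_left, (hγB s hs).pairing_sub_right]
        ring
      rw [e2]
      exact (norm_add_le _ _).trans (add_le_add ((hγB s hs).norm_pairing_le _ _)
        ((hγB s hs).norm_pairing_le _ _))
    simpa using hzero.add hlim
  refine (hD.add h2).congr_of_eventuallyEq (.of_forall fun s => ?_)
  simp

/-- Lipschitz dependence on time of `∫ ω φ(ρ) |f|²`. -/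
theorem exists_lipschitz_pairing_self {ω : E N → ℝ} (hω : ContDiff ℝ 1 ω) {f : ℝ → L2 N}
    (hf : ContDiff ℝ 1 f) (τ : ℝ) :
    ∃ K : ℝ, ∀ s s', |s| ≤ τ → |s'| ≤ τ →
      ‖pairing (cutWeight ω (ρ s)) (f s) (f s) - pairing (cutWeight ω (ρ s')) (f s') (f s')‖ ≤
        K * |s - s'| := by
  obtain ⟨B, hB⟩ := hρ.exists_bound hω τ
  obtain ⟨Λ, hΛ⟩ := (hf.contDiffOn (s := Set.Icc (-τ) τ)).exists_lipschitzOnWith one_ne_zero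
    (convex_Icc _ _) isCompact_Icc
  obtain ⟨A, hA⟩ := isCompact_Icc.exists_bound_of_continuousOn
    (hf.continuous.continuousOn (s := Set.Icc (-τ) τ))
  refine ⟨B * (A * A) + B * (Λ * A) + B * (A * Λ), fun s s' hs hs' => ?_⟩
  have hBs := (hB s hs).1
  have hBs' := (hB s' hs').1
  have hB0 := hBs.nonneg
  have hfs := hA s (abs_le.1 hs)
  have hfs' := hA s' (abs_le.1 hs')
  have hA0 := (norm_nonneg _).trans hfs
  have hδ : ‖f s - f s'‖ ≤ Λ * |s - s'| := by
    have := hΛ.dist_le_mul s (abs_le.1 hs) s' (abs_le.1 hs')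
    rwa [dist_eq_norm, Real.dist_eq] at this
  have hw : IsBoundedWeight (fun x => cutWeight ω (ρ s) x - cutWeight ω (ρ s') x)
      (B * |s - s'|) :=
    ⟨hBs.aestronglyMeasurable.sub hBs'.aestronglyMeasurable, (hB s' hs').2.2 s hs⟩
  have e : pairing (cutWeight ω (ρ s)) (f s) (f s) - pairing (cutWeight ω (ρ s')) (f s') (f s') =
      pairing (fun x => cutWeight ω (ρ s) x - cutWeight ω (ρ s') x) (f s) (f s)
      + pairing (cutWeight ω (ρ s')) (f s - f s') (f s)
      + pairing (cutWeight ω (ρ s')) (f s') (f s - f s') := by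
    rw [← pairing_sub_weight hBs hBs', hBs'.pairing_sub_left, hBs'.pairing_sub_right]
    ring
  rw [e]
  calc _ ≤ B * |s - s'| * (‖f s‖ * ‖f s‖) + B * (‖f s - f s'‖ * ‖f s‖)
        + B * (‖f s'‖ * ‖f s - f s'‖) :=
        (norm_add_le _ _).trans (add_le_add ((norm_add_le _ _).trans (add_le_add
          (hw.norm_pairing_le _ _) (hBs'.norm_pairing_le _ _))) (hBs'.norm_pairing_le _ _))
    _ ≤ B * |s - s'| * (A * A) + B * ((Λ * |s - s'|) * A) + B * (A * (Λ * |s - s'|)) := by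
        gcongr
    _ = _ := by ring

/-- Lipschitz dependence on time of `∫ ω φ(ρ) f̄ ∂_j f`. Since `∂_j f` is only continuous in time,
the derivative is moved to the other factors by integration by parts. -/
theorem exists_lipschitz_pairing_partial {ω : E N → ℝ} (hω : ContDiff ℝ 1 ω) {j : Fin N}
    {f h : ℝ → L2 N} (hf : ContDiff ℝ 1 f) (hh : Continuous h)
    (hfh : ∀ t, HasWeakPartial j (f t) (h t)) (τ : ℝ) :
    ∃ K : ℝ, ∀ s s', |s| ≤ τ → |s'| ≤ τ →
      ‖pairing (cutWeight ω (ρ s)) (f s) (h s) - pairing (cutWeight ω (ρ s')) (f s') (h s')‖ ≤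
        K * |s - s'| := by
  obtain ⟨B, hB⟩ := hρ.exists_bound hω τ
  obtain ⟨R, hR⟩ := hρ.exists_radius τ
  obtain ⟨Λ, hΛ⟩ := (hf.contDiffOn (s := Set.Icc (-τ) τ)).exists_lipschitzOnWith one_ne_zero
    (convex_Icc _ _) isCompact_Icc
  obtain ⟨A, hA⟩ := isCompact_Icc.exists_bound_of_continuousOn
    (hf.continuous.continuousOn (s := Set.Icc (-τ) τ))
  obtain ⟨A', hA'⟩ := isCompact_Icc.exists_bound_of_continuousOn
    (hh.continuousOn (s := Set.Icc (-τ) τ))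
  refine ⟨B * (A * A') + B * (Λ * A') + (B * (A' * Λ) + B * (A * Λ)), fun s s' hs hs' => ?_⟩
  have hBs := (hB s hs).1
  have hBs' := (hB s' hs').1
  have hBd := (hB s' hs').2.1 j
  have hB0 := hBs.nonneg
  have hfs := hA s (abs_le.1 hs)
  have hfs' := hA s' (abs_le.1 hs')
  have hhs := hA' s (abs_le.1 hs)
  have hhs' := hA' s' (abs_le.1 hs')
  have hA0 := (norm_nonneg _).trans hfs
  have hA0' := (norm_nonneg _).trans hhs
  have hδ : ‖f s - f s'‖ ≤ Λ * |s - s'| := by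
    have := hΛ.dist_le_mul s (abs_le.1 hs) s' (abs_le.1 hs')
    rwa [dist_eq_norm, Real.dist_eq] at this
  have hw : IsBoundedWeight (fun x => cutWeight ω (ρ s) x - cutWeight ω (ρ s') x)
      (B * |s - s'|) :=
    ⟨hBs.aestronglyMeasurable.sub hBs'.aestronglyMeasurable, (hB s' hs').2.2 s hs⟩
  have hibp := pairing_cutWeight_partial (hfh s') ((hfh s).sub (hfh s')) hω
    (hρ.contDiff_space s') (fun x => hR s' x hs') hBs'
  have e : pairing (cutWeight ω (ρ s)) (f s) (h s) - pairing (cutWeight ω (ρ s')) (f s') (h s') =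
      pairing (fun x => cutWeight ω (ρ s) x - cutWeight ω (ρ s') x) (f s) (h s)
      + pairing (cutWeight ω (ρ s')) (f s - f s') (h s)
      + (-pairing (cutWeight ω (ρ s')) (h s') (f s - f s')
        - pairing (cutWeightDeriv j ω (ρ s')) (f s') (f s - f s')) := by
    rw [← hibp, ← pairing_sub_weight hBs hBs', hBs'.pairing_sub_left, hBs'.pairing_sub_right]
    ring
  rw [e]
  calc _ ≤ B * |s - s'| * (‖f s‖ * ‖h s‖) + B * (‖f s - f s'‖ * ‖h s‖)
        + (B * (‖h s'‖ * ‖f s - f s'‖) + B * (‖f s'‖ * ‖f s - f s'‖)) := by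
        refine (norm_add_le _ _).trans (add_le_add ((norm_add_le _ _).trans (add_le_add
          (hw.norm_pairing_le _ _) (hBs'.norm_pairing_le _ _))) ?_)
        refine (norm_sub_le _ _).trans (add_le_add ?_ (hBd.norm_pairing_le _ _))
        rw [norm_neg]
        exact hBs'.norm_pairing_le _ _
    _ ≤ B * |s - s'| * (A * A') + B * ((Λ * |s - s'|) * A')
        + (B * (A' * (Λ * |s - s'|)) + B * (A * (Λ * |s - s'|))) := by
        gcongr
    _ = _ := by ring

/-- The derivative of `∫ ω φ(ρ) f̄ ∂_j f` for a frozen weight. As `∂_j f` is only continuous in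
time, integration by parts turns its difference quotient into that of `f`. -/
theorem hasDerivAt_pairing_partial {ω : E N → ℝ} (hω : ContDiff ℝ 1 ω) {j : Fin N}
    {f h : ℝ → L2 N} (hh : Continuous h) (hfh : ∀ t, HasWeakPartial j (f t) (h t)) {t : ℝ}
    {f' : L2 N} (hf : HasDerivAt f f' t) :
    HasDerivAt (fun s => pairing (cutWeight ω (ρ t)) (f s) (h s))
      (pairing (cutWeight ω (ρ t)) f' (h t) +
        (-pairing (cutWeight ω (ρ t)) (h t) f' -
          pairing (cutWeightDeriv j ω (ρ t)) (f t) f')) t := by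
  obtain ⟨B, hB⟩ := hρ.exists_bound hω |t|
  obtain ⟨R, hR⟩ := hρ.exists_radius |t|
  have hBt := (hB t le_rfl).1
  have hBd := (hB t le_rfl).2.1 j
  rw [hasDerivAt_iff_tendsto_slope] at hf ⊢
  have hht : Tendsto h (𝓝[≠] t) (𝓝 (h t)) := (hh.tendsto t).mono_left nhdsWithin_le_nhds
  refine Tendsto.congr (fun s => ?_) ((hBt.tendsto_pairing hf hht).add
    ((hBt.tendsto_pairing tendsto_const_nhds hf).neg.sub
      (hBd.tendsto_pairing tendsto_const_nhds hf)))
  have hibp := pairing_cutWeight_partial (hfh t) ((hfh s).sub (hfh t)) hω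
    (hρ.contDiff_space t) (fun x => hR t x le_rfl) hBt
  rw [slope_def_module, slope_def_module, hBt.pairing_smul_left, hBt.pairing_smul_right,
    hBd.pairing_smul_right, Complex.real_smul]
  rw [hBt.pairing_sub_right] at hibp
  rw [hBt.pairing_sub_left]
  linear_combination -((s - t)⁻¹ : ℝ) * hibp

end IsDensity

/-! ### The local balance laws of a solution -/

theorem aestronglyMeasurable_comp_norm {w : ℝ → ℝ} (hw : ContinuousOn w (Set.Ici 0)) (f : L2 N) :
    AEStronglyMeasurable (fun x => w ‖f x‖) := by
  have h1 : Continuous fun s : ℝ => w (max 0 s) :=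
    hw.comp_continuous (by fun_prop) fun s => Set.mem_Ici.2 (le_max_left _ _)
  have h2 := h1.comp_aestronglyMeasurable (Lp.aestronglyMeasurable f).norm
  simpa [max_eq_right] using h2

theorem coeFn_sum_ae_eq {ι : Type*} (s : Finset ι) (f : ι → L2 N) :
    ∀ᵐ x, (∑ i ∈ s, f i) x = ∑ i ∈ s, f i x := by
  classical
  induction s using Finset.induction_on with
  | empty => simp
  | insert a s ha ih =>
    rw [Finset.sum_insert ha]
    filter_upwards [ih, Lp.coeFn_add (f a) (∑ i ∈ s, f i)] with x h1 h2
    rw [h2, Pi.add_apply, h1, Finset.sum_insert ha]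

theorem integral_add₃ {A B C : E N → ℝ} (hA : Integrable A) (hB : Integrable B)
    (hC : Integrable C) : ∫ x, (A x + B x + C x) = (∫ x, A x) + (∫ x, B x) + ∫ x, C x := by
  rw [← integral_add hA hB]
  exact integral_add (hA.add hB) hC

theorem laplace_ae_eq (f : L2 N) :
    ∀ᵐ x, laplace f x = ∑ j, weakPartial j (weakPartial j f) x :=
  coeFn_sum_ae_eq Finset.univ fun j => weakPartial j (weakPartial j f)

theorem im_conj_mul_self (z : ℂ) : (conj z * z).im = 0 := by
  simp [Complex.mul_im]; ring

namespace PotentialAssumption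

variable {V : E N → ℝ} (hV : PotentialAssumption V)
include hV

theorem contDiff_one : ContDiff ℝ 1 V := hV.contDiff.of_le (by norm_num)

theorem exists_abs_le : ∃ V₀ : ℝ, ∀ x, |V x| ≤ V₀ := by
  obtain ⟨V₀, h⟩ := hV.bounded
  exact ⟨V₀, fun x => by rw [abs_of_nonneg (h x).1]; exact (h x).2⟩

end PotentialAssumption

theorem gradient_apply (r : E N → ℝ) (x : E N) (k : Fin N) :
    gradient r x k = fderiv ℝ r x (basisVec k) := by
  have h1 : inner ℝ (gradient r x) (basisVec k) = fderiv ℝ r x (basisVec k) := by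
    rw [gradient, InnerProductSpace.toDual_symm_apply]
  rw [← h1, basisVec, EuclideanSpace.inner_single_right]
  simp

theorem norm_sq_mul_gradPhase (f : L2 N) (x : E N) (j : Fin N) :
    ‖f x‖ ^ 2 * gradPhase f x j = (conj (f x) * weakPartial j f x).im := by
  simp only [gradPhase]
  rcases eq_or_ne (f x) 0 with h | h
  · simp [h]
  · have : ‖f x‖ ^ 2 ≠ 0 := by positivity
    field_simp

theorem norm_soliton_sq (ψ : ℝ → L2 N) (ρ : ℝ → E N → ℝ) (t : ℝ) (x : E N) :
    ‖soliton ψ ρ t x‖ ^ 2 = cutoff (ρ t x) * ‖ψ t x‖ ^ 2 := by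
  rw [soliton, norm_mul, mul_pow, Complex.norm_real, Real.norm_eq_abs, sq_abs,
    Real.sq_sqrt (cutoff_nonneg _), mul_comm]

namespace IsSolution

variable {m ε : ℝ} {W : ℝ → ℝ} {V : E N → ℝ} {ψ : ℝ → L2 N}

section
variable (hψ : IsSolution m ε W V ψ)
include hψ

theorem hasWeakPartial (t : ℝ) (j : Fin N) : HasWeakPartial j (ψ t) (weakPartial j (ψ t)) :=
  hasWeakPartial_weakPartial ((hψ.memH2 t).1 j)

theorem hasWeakPartial_two (t : ℝ) (j k : Fin N) :
    HasWeakPartial k (weakPartial j (ψ t)) (weakPartial k (weakPartial j (ψ t))) :=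
  hasWeakPartial_weakPartial ((hψ.memH2 t).2 j k)

theorem hasWeakPartial_comm (t : ℝ) (j k : Fin N) :
    HasWeakPartial j (weakPartial k (ψ t)) (weakPartial k (weakPartial j (ψ t))) :=
  (hψ.hasWeakPartial t j).comm (hψ.hasWeakPartial t k) (hψ.hasWeakPartial_two t j k)

theorem hasDerivAt (t : ℝ) : HasDerivAt ψ (deriv ψ t) t :=
  (hψ.contDiff.differentiable (by simp) t).hasDerivAt

/-- The nonlinear force belongs to `L²`, because all other terms of the equation do. -/
theorem memLp_radialForce (hε : 0 < ε) (hW : NonlinearityAssumption N W)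
    (hV : PotentialAssumption V) (t : ℝ) :
    MemLp (fun x => radialForce N ε W ‖ψ t x‖) 2 := by
  obtain ⟨V₀, hV₀⟩ := hV.exists_abs_le
  have hVψ : MemLp (fun x => (V x : ℂ) * ψ t x) 2 :=
    IsBoundedWeight.memLp_mul ⟨hV.contDiff.continuous.aestronglyMeasurable, hV₀⟩ (ψ t)
  have h1 : MemLp (fun x => 2 * (Complex.I * deriv ψ t x + 1 / (2 * (m : ℂ)) * laplace (ψ t) x
      - (V x : ℂ) * ψ t x)) 2 :=
    ((((Lp.memLp (deriv ψ t)).const_mul _).add ((Lp.memLp (laplace (ψ t))).const_mul _)).sub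
      hVψ).const_mul _
  refine h1.congr_norm
    (aestronglyMeasurable_comp_norm (hW.contDiffOn_radialForce hε).continuousOn _) ?_
  filter_upwards [hψ.equation t] with x hx
  rw [hx, Real.norm_eq_abs, ← hW.norm_wepsPrime]
  congr 1
  ring

/-- The nonlinear energy density is weakly differentiable, with gradient `Re (∇ψ̄ W_ε'(ψ))`. -/
theorem hasLocalPartial_weps (hε : 0 < ε) (hW : NonlinearityAssumption N W)
    (hV : PotentialAssumption V) (t : ℝ) (j : Fin N) :
    HasLocalPartial j (fun x => Weps N ε W (ψ t x))
      (fun x => (conj (weakPartial j (ψ t) x) * WepsPrime N ε W (ψ t x)).re) := by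
  have h := (hψ.hasWeakPartial t j).hasLocalPartial_radial hW.radialForce_zero
    (hW.exists_lipschitzOnWith_radialForce hε) (hψ.memLp_radialForce hε hW hV t)
  simp_rw [← hW.weps_eq_integral hε] at h
  convert h using 2 with x
  rw [wepsPrime_eq, mul_left_comm, Complex.re_ofReal_mul, mul_div_assoc, re_conj_mul_comm (ψ t x),
    ← mul_div_assoc, Complex.div_ofReal_re]

theorem integrable_wepsPrime_mul (hε : 0 < ε) (hW : NonlinearityAssumption N W)
    (hV : PotentialAssumption V) (t : ℝ) (f : L2 N) :
    Integrable fun x => (conj (f x) * WepsPrime N ε W (ψ t x)).re := by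
  have h1 := hψ.memLp_radialForce hε hW hV t
  have h2 : AEStronglyMeasurable (fun x => WepsPrime N ε W (ψ t x)) volume := by
    have hm := Lp.aestronglyMeasurable (ψ t)
    exact (Complex.continuous_ofReal.comp_aestronglyMeasurable h1.1).mul
      (hm.div₀ (Complex.continuous_ofReal.comp_aestronglyMeasurable hm.norm))
  have h3 : MemLp (fun x => WepsPrime N ε W (ψ t x)) 2 :=
    h1.congr_norm h2 (.of_forall fun x => by rw [hW.norm_wepsPrime, Real.norm_eq_abs])
  have h4 : MemLp (fun x => conj (f x)) 2 := (Lp.memLp f).star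
  exact (h4.integrable_mul h3).re

theorem weakLaplacian_ae_eq (t : ℝ) :
    ∀ᵐ x, weakLaplacian (fun y => ‖ψ t y‖ ^ 2) x =
      ∑ k, 2 * (‖weakPartial k (ψ t) x‖ ^ 2
        + (conj (ψ t x) * weakPartial k (weakPartial k (ψ t)) x).re) :=
  (hasWeakLaplacian_norm_sq (fun k => hψ.hasWeakPartial t k)
    (fun k => hψ.hasWeakPartial_two t k k)).weakLaplacian_ae_eq

/-- The equation tested with `v̄`, imaginary part. -/
theorem im_conj_mul_deriv (t : ℝ) : ∀ᵐ x, ∀ v : ℂ, (conj v * deriv ψ t x).im =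
    1 / (2 * m) * (∑ k, (conj v * weakPartial k (weakPartial k (ψ t)) x).re)
      - 1 / 2 * (conj v * WepsPrime N ε W (ψ t x)).re - V x * (conj v * ψ t x).re := by
  filter_upwards [hψ.equation t, laplace_ae_eq (ψ t)] with x h1 h2 v
  have h3 : (conj v * deriv ψ t x).im = -(conj v * (Complex.I * deriv ψ t x)).re := by
    rw [mul_left_comm, Complex.I_mul_re, neg_neg]
  have h4 : conj v * (Complex.I * deriv ψ t x) =
      ((-(1 / (2 * m)) : ℝ) : ℂ) * (∑ k, conj v * weakPartial k (weakPartial k (ψ t)) x)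
      + ((1 / 2 : ℝ) : ℂ) * (conj v * WepsPrime N ε W (ψ t x)) + (V x : ℂ) * (conj v * ψ t x) := by
    rw [h1, h2, ← Finset.mul_sum]
    push_cast
    ring
  rw [h3, h4]
  simp only [Complex.add_re, Complex.re_ofReal_mul, Complex.re_sum]
  ring

/-- The equation tested with `ψ̄`, real part: only the Laplacian contributes. -/
theorem re_conj_mul_deriv (t : ℝ) : ∀ᵐ x, (conj (ψ t x) * deriv ψ t x).re =
    -(1 / (2 * m)) * ∑ k, (conj (ψ t x) * weakPartial k (weakPartial k (ψ t)) x).im := by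
  filter_upwards [hψ.equation t, laplace_ae_eq (ψ t)] with x h1 h2
  have h3 : (conj (ψ t x) * deriv ψ t x).re =
      (conj (ψ t x) * (Complex.I * deriv ψ t x)).im := by
    rw [mul_left_comm, Complex.I_mul_im]
  have h4 : conj (ψ t x) * (Complex.I * deriv ψ t x) =
      ((-(1 / (2 * m)) : ℝ) : ℂ) * (∑ k, conj (ψ t x) * weakPartial k (weakPartial k (ψ t)) x)
      + ((1 / 2 * radialForce N ε W ‖ψ t x‖ / ‖ψ t x‖ : ℝ) : ℂ) * (conj (ψ t x) * ψ t x)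
      + (V x : ℂ) * (conj (ψ t x) * ψ t x) := by
    rw [h1, h2, ← Finset.mul_sum, wepsPrime_eq]
    push_cast
    ring
  rw [h3, h4]
  simp only [Complex.add_im, Complex.im_ofReal_mul, Complex.im_sum, im_conj_mul_self, mul_zero,
    add_zero]

/-- Balance of charge: `2 ∫ ω φ(ρ) Re (ψ̄ ∂_t ψ) = (1/m) ∫ ∇(ω φ(ρ)) · Im (ψ̄ ∇ψ)`. -/
theorem two_mul_re_pairing {ω r : E N → ℝ} (hω : ContDiff ℝ 1 ω) (hr : ContDiff ℝ 1 r) {R : ℝ}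
    (hR : ∀ x, R ≤ ‖x‖ → r x ≤ 1) {B : ℝ} (hB : IsBoundedWeight (cutWeight ω r) B) (t : ℝ) :
    2 * (pairing (cutWeight ω r) (ψ t) (deriv ψ t)).re =
      ∫ x, 1 / m * ∑ k, cutWeightDeriv k ω r x * (conj (ψ t x) * weakPartial k (ψ t) x).im := by
  set Z : Fin N → E N → ℝ := fun k x =>
    cutWeight ω r x * (conj (ψ t x) * weakPartial k (weakPartial k (ψ t)) x).im +
      cutWeightDeriv k ω r x * (conj (ψ t x) * weakPartial k (ψ t) x).im with hZ
  have hP : ∀ k, HasLocalPartial k (fun x => (conj (ψ t x) * weakPartial k (ψ t) x).im)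
      (fun x => (conj (ψ t x) * weakPartial k (weakPartial k (ψ t)) x).im) := fun k => by
    have := (hψ.hasWeakPartial t k).im_conj_mul (hψ.hasWeakPartial_two t k k)
    simpa only [im_conj_mul_self, zero_add] using this
  have hZi : ∀ k, Integrable (Z k) := fun k => (hP k).integrable_cutWeight hω hr hR
  have hZ0 : ∀ k, ∫ x, Z k x = 0 := fun k => (hP k).integral_cutWeight_eq_zero hω hr hR
  have hd : ∀ k, Integrable fun x =>
      cutWeightDeriv k ω r x * (conj (ψ t x) * weakPartial k (ψ t) x).im := fun k =>
    integrable_cutWeightDeriv_mul hω hr hR k (hP k).locallyIntegrable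
  have hi1 : Integrable fun x => cutWeight ω r x * (conj (ψ t x) * deriv ψ t x).re :=
    integrable_cutWeight_mul hω.continuous hr.continuous hR
      (integrable_re_conj_mul _ _).locallyIntegrable
  have hi2 : Integrable fun x =>
      1 / m * ∑ k, cutWeightDeriv k ω r x * (conj (ψ t x) * weakPartial k (ψ t) x).im :=
    (integrable_finsetSum _ fun k _ => hd k).const_mul _
  rw [hB.re_pairing, ← sub_eq_zero, ← integral_const_mul, ← integral_sub (hi1.const_mul 2) hi2]
  have hsum : ∫ x, -(1 / m) * ∑ k, Z k x = 0 := by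
    rw [integral_const_mul, integral_finsetSum _ fun k _ => hZi k]
    simp [hZ0]
  rw [← hsum]
  refine integral_congr_ae ?_
  filter_upwards [hψ.re_conj_mul_deriv t] with x hx
  rw [hx]
  simp only [hZ, Finset.sum_add_distrib, ← Finset.mul_sum]
  ring

/-- Balance of momentum: the force on the cutoff region in terms of the stress tensor. -/
theorem im_pairing_force (hε : 0 < ε) (hW : NonlinearityAssumption N W)
    (hV : PotentialAssumption V) {r : E N → ℝ} (hr : ContDiff ℝ 1 r) {R : ℝ}
    (hR : ∀ x, R ≤ ‖x‖ → r x ≤ 1) (t : ℝ) (j : Fin N) :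
    IntegrableOn (fun x => (stress m ε W (ψ t) x).mulVec (gradient r x).ofLp j)
      {x | 1 < r x ∧ r x < 2} ∧
    ∫ x, (-2 * (cutWeight (fun _ => 1) r x * (conj (weakPartial j (ψ t) x) * deriv ψ t x).im)
        - cutWeightDeriv j (fun _ => 1) r x * (conj (ψ t x) * deriv ψ t x).im) =
      -(∫ x, cutWeight (fun _ => 1) r x * (fderiv ℝ V x (basisVec j) * ‖ψ t x‖ ^ 2))
      - ∫ x in {x | 1 < r x ∧ r x < 2}, (stress m ε W (ψ t) x).mulVec (gradient r x).ofLp j := by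
  have h1 : ContDiff ℝ 1 fun _ : E N => (1 : ℝ) := contDiff_const
  have hVc := hV.contDiff_one
  have hms := measurableSet_haloSet hr.continuous
  set S := {x | 1 < r x ∧ r x < 2} with hS
  -- integrations by parts: `P1` and `P2` for the kinetic part of the stress and the Laplacian of
  -- the density, `P3` for the potential, `P4` for the nonlinear energy
  have P1 : ∀ k, HasLocalPartial k
      (fun x => (conj (weakPartial j (ψ t) x) * weakPartial k (ψ t) x).re) _ := fun k =>
    (hψ.hasWeakPartial_two t j k).re_conj_mul (hψ.hasWeakPartial_two t k k)
  have P2 : ∀ k, HasLocalPartial j (fun x => ‖weakPartial k (ψ t) x‖ ^ 2) _ := fun k =>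
    (hψ.hasWeakPartial_comm t j k).norm_sq
  have P3 := (hψ.hasWeakPartial t j).norm_sq
  have P4 := hψ.hasLocalPartial_weps hε hW hV t j
  have i1 := fun k => (P1 k).integrable_cutWeight h1 hr hR
  have i2 := fun k => (P2 k).integrable_cutWeight h1 hr hR
  have i3 := P3.integrable_cutWeight hVc hr hR
  have i4 := P4.integrable_cutWeight h1 hr hR
  have z1 := fun k => (P1 k).integral_cutWeight_eq_zero h1 hr hR
  have z2 := fun k => (P2 k).integral_cutWeight_eq_zero h1 hr hR
  have z3 := P3.integral_cutWeight_eq_zero hVc hr hR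
  have z4 := P4.integral_cutWeight_eq_zero h1 hr hR
  -- integrability of the stress on the halo
  have hk := fun k => continuous_fderiv_basisVec hr k
  have hstress : IntegrableOn (fun x => (stress m ε W (ψ t) x).mulVec (gradient r x).ofLp j) S := by
    have hA : LocallyIntegrable fun x => 1 / (4 * m) * weakLaplacian (fun y => ‖ψ t y‖ ^ 2) x
        - 1 / 2 * (WepsPrime N ε W (ψ t x) * conj (ψ t x)).re + Weps N ε W (ψ t x) := by
      have a1 : Integrable (weakLaplacian fun y => ‖ψ t y‖ ^ 2) := by
        refine Integrable.congr (integrable_finsetSum Finset.univ fun k _ =>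
          ((integrable_sq (weakPartial k (ψ t))).add (integrable_re_conj_mul (ψ t)
            (weakPartial k (weakPartial k (ψ t))))).const_mul 2) ?_
        filter_upwards [hψ.weakLaplacian_ae_eq t] with x hx
        rw [hx]
        rfl
      have a2 := hψ.integrable_wepsPrime_mul hε hW hV t (ψ t)
      simp_rw [mul_comm (conj _)] at a2
      exact ((a1.const_mul _).sub (a2.const_mul _)).locallyIntegrable.add P4.locallyIntegrable
    have hB : ∀ k, IntegrableOn (fun x => fderiv ℝ r x (basisVec k) *
        stress m ε W (ψ t) x j k) S := by
      intro k
      refine integrableOn_haloSet hR (hk k) ?_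
      have b1 : LocallyIntegrable fun x =>
          -(1 / m) * (weakPartial j (ψ t) x * conj (weakPartial k (ψ t) x)).re := by
        have := (integrable_re_conj_mul (weakPartial k (ψ t)) (weakPartial j (ψ t))).const_mul
          (-(1 / m))
        simp_rw [mul_comm (conj _)] at this
        exact this.locallyIntegrable
      by_cases hjk : j = k
      · refine (b1.add hA).congr (.of_forall fun x => ?_)
        simp only [stress, if_pos hjk, Pi.add_apply]
      · refine b1.congr (.of_forall fun x => ?_)
        simp only [stress, if_neg hjk, add_zero]
    refine (integrable_finsetSum Finset.univ fun k _ => hB k).congr (.of_forall fun x => ?_)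
    simp only [Matrix.mulVec, dotProduct, gradient_apply, mul_comm]
  refine ⟨hstress, ?_⟩
  have j1 : Integrable fun x =>
      cutWeight (fun _ => 1) r x * (conj (weakPartial j (ψ t) x) * deriv ψ t x).im :=
    integrable_cutWeight_mul h1.continuous hr.continuous hR
      (integrable_im_conj_mul _ _).locallyIntegrable
  have j2 : Integrable fun x =>
      cutWeightDeriv j (fun _ => 1) r x * (conj (ψ t x) * deriv ψ t x).im :=
    integrable_cutWeightDeriv_mul h1 hr hR j (integrable_im_conj_mul _ _).locallyIntegrable
  have j3 : Integrable fun x =>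
      cutWeight (fun _ => 1) r x * (fderiv ℝ V x (basisVec j) * ‖ψ t x‖ ^ 2) :=
    integrable_cutWeight_mul h1.continuous hr.continuous hR
      ((integrable_sq (ψ t)).locallyIntegrable.continuous_mul (continuous_fderiv_basisVec hVc j))
  have j4 := (integrable_indicator_iff hms).2 hstress
  rw [← integral_indicator hms, ← sub_eq_zero, sub_sub_eq_add_sub, sub_neg_eq_add]
  have hj12 : Integrable fun x =>
      -2 * (cutWeight (fun _ => 1) r x * (conj (weakPartial j (ψ t) x) * deriv ψ t x).im)
        - cutWeightDeriv j (fun _ => 1) r x * (conj (ψ t x) * deriv ψ t x).im :=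
    (j1.const_mul (-2)).sub j2
  -- the claim is the integral of this linear combination of the total derivatives
  have hz : ∫ x, ((-(1 / m) * ∑ k, (cutWeight (fun _ => 1) r x *
        ((conj (weakPartial k (weakPartial j (ψ t)) x) * weakPartial k (ψ t) x).re +
          (conj (weakPartial j (ψ t) x) * weakPartial k (weakPartial k (ψ t)) x).re) +
        cutWeightDeriv k (fun _ => 1) r x *
          (conj (weakPartial j (ψ t) x) * weakPartial k (ψ t) x).re))
      + (1 / (2 * m) * ∑ k, (cutWeight (fun _ => 1) r x *
        (2 * (conj (weakPartial k (ψ t) x) * weakPartial k (weakPartial j (ψ t)) x).re) +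
        cutWeightDeriv j (fun _ => 1) r x * ‖weakPartial k (ψ t) x‖ ^ 2))
      + (cutWeight V r x * (2 * (conj (ψ t x) * weakPartial j (ψ t) x).re) +
        cutWeightDeriv j V r x * ‖ψ t x‖ ^ 2)
      + (cutWeight (fun _ => 1) r x * (conj (weakPartial j (ψ t) x) * WepsPrime N ε W (ψ t x)).re
        + cutWeightDeriv j (fun _ => 1) r x * Weps N ε W (ψ t x))) = 0 := by
    have s1 := (integrable_finsetSum Finset.univ fun k _ => i1 k).const_mul (-(1 / m))
    have s2 := (integrable_finsetSum Finset.univ fun k _ => i2 k).const_mul (1 / (2 * m))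
    refine (integral_add ((s1.add s2).add i3) i4).trans ?_
    refine (congrArg (· + _) (integral_add₃ s1 s2 i3)).trans ?_
    rw [integral_const_mul, integral_const_mul, integral_finsetSum _ fun k _ => i1 k,
      integral_finsetSum _ fun k _ => i2 k, z3, z4]
    simp only [z1, z2, Finset.sum_const_zero, mul_zero, add_zero]
  refine (integral_add₃ hj12 j4 j3).symm.trans ?_
  rw [← hz]
  refine integral_congr_ae ?_
  filter_upwards [hψ.im_conj_mul_deriv t, hψ.weakLaplacian_ae_eq t] with x hx hL
  simp only [hx, re_conj_mul_self]
  have e1 : ∀ k, (conj (weakPartial k (weakPartial j (ψ t)) x) * weakPartial k (ψ t) x).re =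
      (conj (weakPartial k (ψ t) x) * weakPartial k (weakPartial j (ψ t)) x).re := fun k =>
    re_conj_mul_comm _ _
  have e2 := re_conj_mul_comm (weakPartial j (ψ t) x) (ψ t x)
  by_cases hxS : x ∈ S
  · have hD : ∀ (k : Fin N) (ω : E N → ℝ), cutWeightDeriv k ω r x =
        fderiv ℝ ω x (basisVec k) * cutoff (r x) + ω x * fderiv ℝ r x (basisVec k) := fun k ω => by
      rw [cutWeightDeriv, ← hS, Set.indicator_of_mem hxS]
    have e3 : ∀ k, (weakPartial j (ψ t) x * conj (weakPartial k (ψ t) x)).re =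
        (conj (weakPartial j (ψ t) x) * weakPartial k (ψ t) x).re := fun k => by
      rw [mul_comm, re_conj_mul_comm]
    have e4 : (WepsPrime N ε W (ψ t x) * conj (ψ t x)).re =
        (conj (ψ t x) * WepsPrime N ε W (ψ t x)).re := by rw [mul_comm]
    have hF : (stress m ε W (ψ t) x).mulVec (gradient r x).ofLp j =
        -(1 / m) * (∑ k, fderiv ℝ r x (basisVec k) *
          (conj (weakPartial j (ψ t) x) * weakPartial k (ψ t) x).re)
        + (1 / (4 * m) * (2 * ((∑ k, ‖weakPartial k (ψ t) x‖ ^ 2)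
            + ∑ k, (conj (ψ t x) * weakPartial k (weakPartial k (ψ t)) x).re))
          - 1 / 2 * (conj (ψ t x) * WepsPrime N ε W (ψ t x)).re
          + Weps N ε W (ψ t x)) * fderiv ℝ r x (basisVec j) := by
      simp only [Matrix.mulVec, dotProduct, gradient_apply, stress, hL, e3, e4, add_mul,
        Finset.sum_add_distrib, ite_mul, zero_mul, Finset.sum_ite_eq, Finset.mem_univ, if_true,
        ← Finset.mul_sum]
      rw [Finset.mul_sum]
      congr 1
      exact Finset.sum_congr rfl fun k _ => by ring
    rw [Set.indicator_of_mem hxS, hF]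
    simp only [hD, e1, e2, cutWeight, fderiv_fun_const, Pi.zero_apply,
      zero_apply, zero_mul, zero_add, one_mul, Finset.sum_add_distrib,
      ← Finset.mul_sum]
    ring
  · have hD : ∀ (k : Fin N) (ω : E N → ℝ), cutWeightDeriv k ω r x =
        fderiv ℝ ω x (basisVec k) * cutoff (r x) := fun k ω => by
      rw [cutWeightDeriv, ← hS, Set.indicator_of_notMem hxS, add_zero]
    rw [Set.indicator_of_notMem hxS]
    simp only [hD, e1, e2, cutWeight, fderiv_fun_const, Pi.zero_apply,
      zero_apply, zero_mul, add_zero, one_mul, Finset.sum_add_distrib,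
      ← Finset.mul_sum]
    ring

end

end IsSolution

/-! ### Vector-valued functions by components -/

theorem hasDerivAt_of_apply {f : ℝ → E N} {f' : E N} {t : ℝ}
    (h : ∀ j, HasDerivAt (fun s => f s j) (f' j) t) : HasDerivAt f f' t := by
  have h1 : HasDerivAt (fun s => (f s).ofLp) f'.ofLp t := hasDerivAt_pi.2 h
  let L := (PiLp.continuousLinearEquiv 2 ℝ fun _ : Fin N => ℝ).symm.toContinuousLinearMap
  have h2 : HasFDerivAt (fun v => L v) L (f t).ofLp := L.hasFDerivAt
  exact HasFDerivAt.comp_hasDerivAt (l := fun v => L v) t h2 h1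

theorem norm_le_sum_abs (v : E N) : ‖v‖ ≤ ∑ j, |v j| := by
  have h := (EuclideanSpace.basisFun (Fin N) ℝ).sum_repr v
  calc ‖v‖ = ‖∑ j, (EuclideanSpace.basisFun (Fin N) ℝ).repr v j •
        EuclideanSpace.basisFun (Fin N) ℝ j‖ := by rw [h]
    _ ≤ ∑ j, ‖(EuclideanSpace.basisFun (Fin N) ℝ).repr v j •
        EuclideanSpace.basisFun (Fin N) ℝ j‖ := norm_sum_le _ _
    _ = _ := by simp [norm_smul]

theorem exists_lipschitzOnWith_of_apply {f : ℝ → E N} {S : Set ℝ}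
    (h : ∀ j, ∃ K : ℝ, ∀ s ∈ S, ∀ s' ∈ S, |f s j - f s' j| ≤ K * |s - s'|) :
    ∃ K, LipschitzOnWith K f S := by
  choose K hK using h
  refine ⟨∑ j, (K j).toNNReal, LipschitzOnWith.of_dist_le_mul fun s hs s' hs' => ?_⟩
  rw [dist_eq_norm, Real.dist_eq, NNReal.coe_sum, Finset.sum_mul]
  refine (norm_le_sum_abs _).trans (Finset.sum_le_sum fun j _ => ?_)
  exact (hK j s hs s' hs').trans (mul_le_mul_of_nonneg_right (Real.le_coe_toNNReal _)
    (abs_nonneg _))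

theorem setOf_abs_le_mem_nhds (t : ℝ) : {s : ℝ | |s| ≤ |t| + 1} ∈ 𝓝 t :=
  (continuous_abs.continuousAt.eventually_lt_const (by linarith : |t| < |t| + 1)).mono
    fun _ hs => hs.le

theorem contDiff_coord (j : Fin N) : ContDiff ℝ 1 fun x : E N => x j :=
  (EuclideanSpace.proj j : E N →L[ℝ] ℝ).contDiff

theorem fderiv_coord (j k : Fin N) (x : E N) :
    fderiv ℝ (fun x : E N => x j) x (basisVec k) = if j = k then 1 else 0 := by
  have h1 : HasFDerivAt (fun y : E N => y j) (EuclideanSpace.proj j : E N →L[ℝ] ℝ) x :=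
    (EuclideanSpace.proj j : E N →L[ℝ] ℝ).hasFDerivAt
  rw [h1.fderiv]
  simp [basisVec]

/-! ### Mass, barycenter and momentum -/

/-- The rate `(1/m) Im (ψ̄ ∇ψ) · ∇ρ - |ψ|² ∇ · J` at which charge enters through the halo. -/
noncomputable def haloFlux (m : ℝ) (ψ : ℝ → L2 N) (ρ : ℝ → E N → ℝ) (J : ℝ → E N → E N) (t : ℝ)
    (x : E N) : ℝ :=
  1 / m * ∑ k, fderiv ℝ (ρ t) x (basisVec k) * (conj (ψ t x) * weakPartial k (ψ t) x).im
    - divergence (J t) x * ‖ψ t x‖ ^ 2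

section Integrals

variable {m : ℝ} {ψ : ℝ → L2 N} {ρ : ℝ → E N → ℝ} {J : ℝ → E N → E N}

theorem haloVelocity_apply (hm : m ≠ 0) (t : ℝ) (x : E N) (j : Fin N) :
    haloVelocity m ψ ρ J t x j =
      m * (x j * haloFlux m ψ ρ J t x - barycenter ψ ρ t j * haloFlux m ψ ρ J t x) := by
  have h1 : ‖ψ t x‖ ^ 2 * inner ℝ (gradPhase (ψ t) x) (gradient (ρ t) x) =
      ∑ k, fderiv ℝ (ρ t) x (basisVec k) * (conj (ψ t x) * weakPartial k (ψ t) x).im := by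
    simp only [PiLp.inner_apply, RCLike.inner_apply, conj_trivial, gradient_apply, Finset.mul_sum]
    refine Finset.sum_congr rfl fun k _ => ?_
    rw [← norm_sq_mul_gradPhase]
    ring
  simp only [haloVelocity, haloFlux, h1, PiLp.smul_apply, PiLp.sub_apply, smul_eq_mul]
  field_simp

theorem soliton_sq_smul_gradPhase (t : ℝ) (j : Fin N) (x : E N) :
    (‖soliton ψ ρ t x‖ ^ 2 • gradPhase (ψ t) x) j =
      cutWeight (fun _ => 1) (ρ t) x * (conj (ψ t x) * weakPartial j (ψ t) x).im := by
  rw [← norm_sq_mul_gradPhase]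
  simp only [norm_soliton_sq, cutWeight, PiLp.smul_apply, smul_eq_mul]
  ring

theorem soliton_sq_smul_gradient (V : E N → ℝ) (t : ℝ) (j : Fin N) (x : E N) :
    (‖soliton ψ ρ t x‖ ^ 2 • gradient V x) j =
      cutWeight (fun _ => 1) (ρ t) x * (fderiv ℝ V x (basisVec j) * ‖ψ t x‖ ^ 2) := by
  simp only [norm_soliton_sq, cutWeight, PiLp.smul_apply, smul_eq_mul, gradient_apply]
  ring

theorem haloForce_apply {ε : ℝ} {W : ℝ → ℝ} (t : ℝ) (x : E N) (j : Fin N) :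
    haloForce m ε W ψ ρ J t x j =
      (stress m ε W (ψ t) x).mulVec (gradient (ρ t) x).ofLp j
        + divergence (J t) x * (conj (ψ t x) * weakPartial j (ψ t) x).im := by
  rw [← norm_sq_mul_gradPhase]
  simp only [haloForce, PiLp.add_apply, PiLp.smul_apply, smul_eq_mul]
  ring

variable (hρ : IsDensity ρ J)
include hρ

/-- The weight that arises from the time derivative of `ω φ(ρ)` is bounded. -/
theorem IsDensity.exists_boundedWeight_flux {ω : E N → ℝ} (hω : ContDiff ℝ 1 ω) (t : ℝ) :
    ∃ B, IsBoundedWeight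
      (fun x => ω x * (halo ρ t).indicator (fun x => -divergence (J t) x) x) B := by
  obtain ⟨R, hR⟩ := hρ.exists_radius |t|
  have hdc : Continuous fun x => divergence (J t) x :=
    hρ.continuous_divergence.comp (continuous_const.prodMk continuous_id)
  obtain ⟨B, hB⟩ := (isCompact_closedBall (0 : E N) R).exists_bound_of_continuousOn
    (hω.continuous.mul hdc).continuousOn
  refine ⟨|B|, (hω.continuous.measurable.mul (hdc.neg.measurable.indicator
    (measurableSet_haloSet (hρ.contDiff_space t).continuous))).aestronglyMeasurable, fun x => ?_⟩
  by_cases hx : x ∈ halo ρ t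
  · rw [Set.indicator_of_mem hx, mul_neg, abs_neg]
    refine (hB x ?_).trans (le_abs_self B)
    rw [mem_closedBall_zero_iff]
    by_contra! h
    exact absurd hx.1 (not_lt.2 (hR t x le_rfl h.le))
  · rw [Set.indicator_of_notMem hx, mul_zero, abs_zero]
    exact abs_nonneg _

theorem IsDensity.integrableOn_haloFlux (t : ℝ) {a : E N → ℝ} (ha : Continuous a) :
    IntegrableOn (fun x => a x * haloFlux m ψ ρ J t x) (halo ρ t) := by
  obtain ⟨R, hR⟩ := hρ.exists_radius |t|
  have hR' : ∀ x, R ≤ ‖x‖ → ρ t x ≤ 1 := fun x => hR t x le_rfl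
  have hdc : Continuous fun x => divergence (J t) x :=
    hρ.continuous_divergence.comp (continuous_const.prodMk continuous_id)
  refine integrableOn_haloSet hR' ha (LocallyIntegrable.sub ?_ ?_)
  · refine LocallyIntegrable.smul ?_ (1 / m)
    refine locallyIntegrable_finsetSum _ fun k _ => ?_
    exact (integrable_im_conj_mul _ _).locallyIntegrable.continuous_mul
      (continuous_fderiv_basisVec (hρ.contDiff_space t) k)
  · exact (integrable_sq (ψ t)).locallyIntegrable.continuous_mul hdc

theorem IsDensity.integrable_cutoff_mul (t : ℝ) {a U : E N → ℝ} (ha : Continuous a)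
    (hU : LocallyIntegrable U) : Integrable fun x => cutWeight a (ρ t) x * U x := by
  obtain ⟨R, hR⟩ := hρ.exists_radius |t|
  exact integrable_cutWeight_mul ha (hρ.contDiff_space t).continuous (fun x => hR t x le_rfl) hU

theorem IsDensity.integrable_soliton_sq (t : ℝ) :
    Integrable fun x => ‖soliton ψ ρ t x‖ ^ 2 := by
  refine (hρ.integrable_cutoff_mul t continuous_const (a := fun _ => 1)
    (integrable_sq (ψ t)).locallyIntegrable).congr (.of_forall fun x => ?_)
  simp only [norm_soliton_sq, cutWeight, one_mul]

theorem IsDensity.integrable_soliton_sq_coord (t : ℝ) (j : Fin N) :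
    Integrable fun x => (‖soliton ψ ρ t x‖ ^ 2 • x) j := by
  refine (hρ.integrable_cutoff_mul t (contDiff_coord j).continuous
    (integrable_sq (ψ t)).locallyIntegrable).congr (.of_forall fun x => ?_)
  simp only [norm_soliton_sq, cutWeight, PiLp.smul_apply, smul_eq_mul]
  ring

theorem IsDensity.integrable_soliton_sq_gradPhase (t : ℝ) (j : Fin N) :
    Integrable fun x => (‖soliton ψ ρ t x‖ ^ 2 • gradPhase (ψ t) x) j := by
  refine (hρ.integrable_cutoff_mul t continuous_const (a := fun _ => 1)
    (integrable_im_conj_mul (ψ t) (weakPartial j (ψ t))).locallyIntegrable).congr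
    (.of_forall fun x => ?_)
  exact (soliton_sq_smul_gradPhase t j x).symm

theorem IsDensity.integrable_soliton_sq_gradient {V : E N → ℝ} (hV : ContDiff ℝ 1 V) (t : ℝ)
    (j : Fin N) : Integrable fun x => (‖soliton ψ ρ t x‖ ^ 2 • gradient V x) j := by
  refine (hρ.integrable_cutoff_mul t continuous_const (a := fun _ => 1)
    ((integrable_sq (ψ t)).locallyIntegrable.continuous_mul
      (continuous_fderiv_basisVec hV j))).congr (.of_forall fun x => ?_)
  exact (soliton_sq_smul_gradient V t j x).symm

theorem IsDensity.exists_boundedWeight {ω : E N → ℝ} (hω : ContDiff ℝ 1 ω) (t : ℝ) :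
    ∃ B, IsBoundedWeight (cutWeight ω (ρ t)) B := by
  obtain ⟨B, hB⟩ := hρ.exists_bound hω |t|
  exact ⟨B, (hB t le_rfl).1⟩

theorem IsDensity.charge_eq (t : ℝ) :
    charge ψ ρ t = (pairing (cutWeight (fun _ => 1) (ρ t)) (ψ t) (ψ t)).re := by
  obtain ⟨B, hB⟩ := hρ.exists_boundedWeight (contDiff_const (c := (1 : ℝ))) t
  rw [hB.re_pairing, charge]
  simp only [norm_soliton_sq, re_conj_mul_self, cutWeight, one_mul]

theorem IsDensity.firstMoment_apply (t : ℝ) (j : Fin N) :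
    (∫ x, ‖soliton ψ ρ t x‖ ^ 2 • x) j =
      (pairing (cutWeight (fun x => x j) (ρ t)) (ψ t) (ψ t)).re := by
  obtain ⟨B, hB⟩ := hρ.exists_boundedWeight (contDiff_coord j) t
  rw [eval_integral_piLp (hρ.integrable_soliton_sq_coord t), hB.re_pairing]
  refine integral_congr_ae (.of_forall fun x => ?_)
  simp only [norm_soliton_sq, re_conj_mul_self, cutWeight, PiLp.smul_apply, smul_eq_mul]
  ring

theorem IsDensity.barycenter_apply (t : ℝ) (j : Fin N) :
    barycenter ψ ρ t j = (pairing (cutWeight (fun _ => 1) (ρ t)) (ψ t) (ψ t)).re⁻¹ *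
      (pairing (cutWeight (fun x => x j) (ρ t)) (ψ t) (ψ t)).re := by
  rw [barycenter, PiLp.smul_apply, smul_eq_mul, hρ.firstMoment_apply, hρ.charge_eq]

theorem IsDensity.momentum_apply (t : ℝ) (j : Fin N) :
    momentum ψ ρ t j =
      (pairing (cutWeight (fun _ => 1) (ρ t)) (ψ t) (weakPartial j (ψ t))).im := by
  obtain ⟨B, hB⟩ := hρ.exists_boundedWeight (contDiff_const (c := (1 : ℝ))) t
  rw [momentum, eval_integral_piLp (hρ.integrable_soliton_sq_gradPhase t), hB.im_pairing]
  exact integral_congr_ae (.of_forall fun x => soliton_sq_smul_gradPhase t j x)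

/-- The balance law for the moments `∫ ω |Ψ|²` of the charge. -/
theorem IsDensity.hasDerivAt_moment {ε : ℝ} {W : ℝ → ℝ} {V : E N → ℝ}
    (hψ : IsSolution m ε W V ψ) {ω : E N → ℝ} (hω : ContDiff ℝ 1 ω) {t : ℝ}
    (ht : IsRegularTime ρ J t) :
    HasDerivAt (fun s => (pairing (cutWeight ω (ρ s)) (ψ s) (ψ s)).re)
      (1 / m * (∑ k, ∫ x, cutWeight (fun x => fderiv ℝ ω x (basisVec k)) (ρ t) x *
          (conj (ψ t x) * weakPartial k (ψ t) x).im)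
        + ∫ x in halo ρ t, ω x * haloFlux m ψ ρ J t x) t := by
  obtain ⟨R, hR⟩ := hρ.exists_radius |t|
  obtain ⟨B, hB⟩ := hρ.exists_boundedWeight hω t
  obtain ⟨B', hB'⟩ := hρ.exists_boundedWeight_flux hω t
  have hr := hρ.contDiff_space t
  have hR' : ∀ x, R ≤ ‖x‖ → ρ t x ≤ 1 := fun x => hR t x le_rfl
  have hcont : ContinuousAt ψ t := hψ.contDiff.continuous.continuousAt
  have hD := hρ.hasDerivAt_pairing hω ht hcont hcont
    (hB.hasDerivAt_pairing (hψ.hasDerivAt t) (hψ.hasDerivAt t))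
  have hre := Complex.reCLM.hasFDerivAt.comp_hasDerivAt t hD
  refine (HasDerivAt.congr_deriv (f := fun s => (pairing (cutWeight ω (ρ s)) (ψ s) (ψ s)).re)
    hre ?_)
  have hI : ∀ k, LocallyIntegrable fun x => (conj (ψ t x) * weakPartial k (ψ t) x).im := fun k =>
    (integrable_im_conj_mul _ _).locallyIntegrable
  have hc := fun k => integrable_cutWeight_mul (continuous_fderiv_basisVec hω k) hr.continuous hR'
    (hI k)
  have hb := fun k => integrable_cutWeightDeriv_mul hω hr hR' k (hI k)
  have hms : MeasurableSet (halo ρ t) := measurableSet_haloSet hr.continuous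
  have hF := (integrable_indicator_iff hms).2
    (hρ.integrableOn_haloFlux (m := m) (ψ := ψ) t hω.continuous)
  have hd : Integrable fun x => (ω x * (halo ρ t).indicator (fun x => -divergence (J t) x) x) *
      (conj (ψ t x) * ψ t x).re := by
    have := (hB'.integrable_pairing (ψ t) (ψ t)).re
    simpa using this
  have e1 : (pairing (cutWeight ω (ρ t)) (deriv ψ t) (ψ t)).re =
      (pairing (cutWeight ω (ρ t)) (ψ t) (deriv ψ t)).re := by
    rw [← conj_pairing, Complex.conj_re]
  rw [Complex.reCLM_apply, Complex.add_re, Complex.add_re, e1, ← two_mul,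
    hψ.two_mul_re_pairing hω hr hR' hB t, hB'.re_pairing,
    ← integral_indicator hms,
    ← integral_finsetSum _ fun k _ => hc k, ← integral_const_mul,
    ← integral_add ((integrable_finsetSum _ fun k _ => hb k).const_mul _) hd,
    ← integral_add ((integrable_finsetSum _ fun k _ => hc k).const_mul _) hF]
  refine integral_congr_ae (.of_forall fun x => ?_)
  simp only [re_conj_mul_self]
  by_cases hx : x ∈ halo ρ t
  · have hD : ∀ k, cutWeightDeriv k ω (ρ t) x =
        fderiv ℝ ω x (basisVec k) * cutoff (ρ t x) + ω x * fderiv ℝ (ρ t) x (basisVec k) :=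
      fun k => congrArg _ (Set.indicator_of_mem (s := halo ρ t) hx _)
    rw [Set.indicator_of_mem hx, Set.indicator_of_mem hx]
    simp only [hD, haloFlux, cutWeight, add_mul, Finset.sum_add_distrib, mul_assoc,
      ← Finset.mul_sum]
    ring
  · have hD : ∀ k, cutWeightDeriv k ω (ρ t) x =
        fderiv ℝ ω x (basisVec k) * cutoff (ρ t x) :=
      fun k => (congrArg _ (Set.indicator_of_notMem (s := halo ρ t) hx _)).trans (add_zero _)
    rw [Set.indicator_of_notMem hx, Set.indicator_of_notMem hx]
    simp only [hD, cutWeight, mul_zero, zero_mul]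

theorem IsDensity.integrableOn_haloVelocity (hm : m ≠ 0) (t : ℝ) :
    IntegrableOn (haloVelocity m ψ ρ J t) (halo ρ t) := by
  refine Integrable.of_eval_piLp fun j => ?_
  simp only [haloVelocity_apply hm]
  exact ((hρ.integrableOn_haloFlux t (contDiff_coord j).continuous).sub
    (hρ.integrableOn_haloFlux t continuous_const)).const_mul m

/-- The quotient rule for `q = ∫ x |Ψ|² / ∫ |Ψ|²`, with the balance laws of the two moments. -/
theorem IsDensity.barycenterEquation {ε : ℝ} {W : ℝ → ℝ} {V : E N → ℝ} (hm : 0 < m)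
    (hψ : IsSolution m ε W V ψ) {t : ℝ} (ht : IsRegularTime ρ J t) (hpos : 0 < mass m ψ ρ t) :
    BarycenterEquation m ψ ρ J t := by
  have hC : 0 < charge ψ ρ t := (pos_iff_pos_of_mul_pos hpos).1 hm
  have h1 := hρ.hasDerivAt_moment hψ (contDiff_const (c := (1 : ℝ))) ht
  refine hasDerivAt_of_apply fun j => ?_
  have h2 := hρ.hasDerivAt_moment hψ (contDiff_coord j) ht
  have hC' := hC
  rw [hρ.charge_eq] at hC'
  have h3 := (h1.inv hC'.ne').mul h2
  have h4 : (fun s => barycenter ψ ρ s j) =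
      (fun s => (pairing (cutWeight (fun _ => 1) (ρ s)) (ψ s) (ψ s)).re)⁻¹ *
      fun s => (pairing (cutWeight (fun x => x j) (ρ s)) (ψ s) (ψ s)).re := by
    ext s
    exact hρ.barycenter_apply s j
  rw [h4]
  refine h3.congr_deriv ?_
  have hq := hρ.barycenter_apply (ψ := ψ) t j
  have hint : ∀ j, IntegrableOn (fun x => haloVelocity m ψ ρ J t x j) (halo ρ t) := fun j =>
    (hρ.integrableOn_haloVelocity hm.ne' t).eval_piLp j
  have hp : momentum ψ ρ t j = ∑ k, ∫ x, cutWeight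
      (fun x => fderiv ℝ (fun x : E N => x j) x (basisVec k)) (ρ t) x *
        (conj (ψ t x) * weakPartial k (ψ t) x).im := by
    obtain ⟨B, hB⟩ := hρ.exists_boundedWeight (contDiff_const (c := (1 : ℝ))) t
    rw [hρ.momentum_apply, hB.im_pairing, Finset.sum_eq_single j]
    · simp only [fderiv_coord, if_true]
    · intro k _ hk
      simp [fderiv_coord, if_neg hk.symm, cutWeight]
    · simp
  simp only [PiLp.add_apply, PiLp.smul_apply, smul_eq_mul]
  rw [eval_integral_piLp hint]
  have hv : ∫ x in halo ρ t, haloVelocity m ψ ρ J t x j =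
      m * ((∫ x in halo ρ t, x j * haloFlux m ψ ρ J t x) -
        barycenter ψ ρ t j * ∫ x in halo ρ t, haloFlux m ψ ρ J t x) := by
    simp only [haloVelocity_apply hm.ne']
    rw [integral_const_mul, integral_sub
      (hρ.integrableOn_haloFlux (m := m) (ψ := ψ) t (contDiff_coord j).continuous)
      (hρ.integrableOn_haloFlux (m := m) (ψ := ψ) t
        (continuous_const (y := barycenter ψ ρ t j))), integral_const_mul]
  rw [hv, ← hp, hq, mass, hρ.charge_eq]
  have h0 : ∀ k : Fin N, ∫ x, cutWeight (fun x => fderiv ℝ (fun _ : E N => (1 : ℝ)) x (basisVec k))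
      (ρ t) x * (conj (ψ t x) * weakPartial k (ψ t) x).im = 0 := fun k => by
    simp [cutWeight]
  simp only [h0, Finset.sum_const_zero, mul_zero, zero_add, one_mul, Pi.inv_apply]
  set C := (pairing (cutWeight (fun _ => 1) (ρ t)) (ψ t) (ψ t)).re
  field_simp
  ring

section Force

variable {ε : ℝ} {W : ℝ → ℝ} {V : E N → ℝ}

theorem IsDensity.integrableOn_div_mul (t : ℝ) (j : Fin N) :
    IntegrableOn (fun x => divergence (J t) x * (conj (ψ t x) * weakPartial j (ψ t) x).im)
      (halo ρ t) := by
  obtain ⟨R, hR⟩ := hρ.exists_radius |t|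
  exact integrableOn_haloSet (fun x => hR t x le_rfl)
    (hρ.continuous_divergence.comp (continuous_const.prodMk continuous_id))
    (integrable_im_conj_mul _ _).locallyIntegrable

theorem IsDensity.integrableOn_haloForce (hψ : IsSolution m ε W V ψ) (hε : 0 < ε)
    (hW : NonlinearityAssumption N W) (hV : PotentialAssumption V) (t : ℝ) :
    IntegrableOn (haloForce m ε W ψ ρ J t) (halo ρ t) := by
  obtain ⟨R, hR⟩ := hρ.exists_radius |t|
  refine Integrable.of_eval_piLp fun j => ?_
  simp only [haloForce_apply]
  exact (hψ.im_pairing_force hε hW hV (hρ.contDiff_space t) (fun x => hR t x le_rfl) t j).1.add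
    (hρ.integrableOn_div_mul t j)

/-- The time derivative of the cutoff yields the flux of `∇ · J`, that of the wave function the
force, which the balance of momentum expresses by the potential and the stress. -/
theorem IsDensity.momentumEquation (hψ : IsSolution m ε W V ψ) (hε : 0 < ε)
    (hW : NonlinearityAssumption N W) (hV : PotentialAssumption V) {t : ℝ}
    (ht : IsRegularTime ρ J t) : MomentumEquation m ε W V ψ ρ J t := by
  refine hasDerivAt_of_apply fun j => ?_
  obtain ⟨R, hR⟩ := hρ.exists_radius |t|
  have hω : ContDiff ℝ 1 fun _ : E N => (1 : ℝ) := contDiff_const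
  obtain ⟨B, hB⟩ := hρ.exists_bound hω |t|
  have hB1 := (hB t le_rfl).1
  have hB2 := (hB t le_rfl).2.1 j
  obtain ⟨B', hB'⟩ := hρ.exists_boundedWeight_flux hω t
  have hr := hρ.contDiff_space t
  have hms : MeasurableSet (halo ρ t) := measurableSet_haloSet hr.continuous
  have hD := hρ.hasDerivAt_pairing hω ht hψ.contDiff.continuous.continuousAt
    (hψ.continuous_one j).continuousAt
    (hρ.hasDerivAt_pairing_partial hω (hψ.continuous_one j) (fun s => hψ.hasWeakPartial s j)
      (hψ.hasDerivAt t))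
  have him := Complex.imCLM.hasFDerivAt.comp_hasDerivAt t hD
  have h4 : (fun s => momentum ψ ρ s j) =
      Complex.imCLM ∘ fun s =>
        pairing (cutWeight (fun _ => 1) (ρ s)) (ψ s) (weakPartial j (ψ s)) := by
    ext s
    exact hρ.momentum_apply s j
  rw [h4]
  refine him.congr_deriv ?_
  obtain ⟨hs, hforce⟩ := hψ.im_pairing_force hε hW hV hr (fun x => hR t x le_rfl) t j
  have hint : ∀ j, IntegrableOn (fun x => haloForce m ε W ψ ρ J t x j) (halo ρ t) := fun j =>
    (hρ.integrableOn_haloForce hψ hε hW hV t).eval_piLp j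
  have e1 : (pairing (cutWeight (fun _ => 1) (ρ t)) (deriv ψ t) (weakPartial j (ψ t))).im =
      -(pairing (cutWeight (fun _ => 1) (ρ t)) (weakPartial j (ψ t)) (deriv ψ t)).im := by
    rw [← conj_pairing, Complex.conj_im]
  have e2 : ∫ x, (1 * (halo ρ t).indicator (fun x => -divergence (J t) x) x) *
      (conj (ψ t x) * weakPartial j (ψ t) x).im =
      -∫ x in halo ρ t, divergence (J t) x * (conj (ψ t x) * weakPartial j (ψ t) x).im := by
    rw [← integral_neg, ← integral_indicator hms]
    refine integral_congr_ae (.of_forall fun x => ?_)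
    simp only [one_mul]
    by_cases hx : x ∈ halo ρ t
    · rw [Set.indicator_of_mem hx, Set.indicator_of_mem hx, neg_mul]
    · rw [Set.indicator_of_notMem hx, Set.indicator_of_notMem hx, zero_mul]
  have i1 : Integrable fun x => cutWeight (fun _ => 1) (ρ t) x *
      (conj (weakPartial j (ψ t) x) * deriv ψ t x).im :=
    hρ.integrable_cutoff_mul t continuous_const (integrable_im_conj_mul _ _).locallyIntegrable
  have i2 : Integrable fun x => cutWeightDeriv j (fun _ => 1) (ρ t) x *
      (conj (ψ t x) * deriv ψ t x).im :=
    integrable_cutWeightDeriv_mul hω hr (fun x => hR t x le_rfl) j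
      (integrable_im_conj_mul _ _).locallyIntegrable
  rw [integral_sub (i1.const_mul (-2)) i2, integral_const_mul] at hforce
  simp only [Complex.imCLM_apply, Complex.add_im, Complex.sub_im, Complex.neg_im,
    PiLp.sub_apply, PiLp.neg_apply]
  rw [e1, hB1.im_pairing, hB2.im_pairing, hB'.im_pairing, e2,
    eval_integral_piLp (hρ.integrable_soliton_sq_gradient hV.contDiff_one t),
    eval_integral_piLp hint]
  simp only [haloForce_apply, soliton_sq_smul_gradient]
  have hs' : IntegrableOn _ (halo ρ t) := hs
  rw [integral_add hs' (hρ.integrableOn_div_mul t j)]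
  unfold halo at *
  linarith [hforce]

theorem IsDensity.locallyLipschitz_momentum (hψ : IsSolution m ε W V ψ) :
    LocallyLipschitz (momentum ψ ρ) := by
  intro t
  obtain ⟨K, hK⟩ := exists_lipschitzOnWith_of_apply (f := momentum ψ ρ)
    (S := {s : ℝ | |s| ≤ |t| + 1}) fun j => by
      obtain ⟨K, hK⟩ := hρ.exists_lipschitz_pairing_partial (contDiff_const (c := (1 : ℝ)))
        hψ.contDiff (hψ.continuous_one j) (fun s => hψ.hasWeakPartial s j) (|t| + 1)
      refine ⟨K, fun s hs s' hs' => ?_⟩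
      rw [hρ.momentum_apply, hρ.momentum_apply, ← Complex.sub_im]
      exact (Complex.abs_im_le_norm _).trans (hK s s' hs hs')
  exact ⟨K, _, setOf_abs_le_mem_nhds t, hK⟩

theorem IsDensity.exists_lipschitzOnWith_barycenter (hm : 0 < m) (hψ : IsSolution m ε W V ψ)
    {t : ℝ} (hpos : 0 < mass m ψ ρ t) :
    ∃ K, ∃ s ∈ 𝓝 t, LipschitzOnWith K (barycenter ψ ρ) s := by
  have hC : 0 < charge ψ ρ t := (pos_iff_pos_of_mul_pos hpos).1 hm
  set C : ℝ → ℝ := fun s => (pairing (cutWeight (fun _ => 1) (ρ s)) (ψ s) (ψ s)).re with hCdef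
  have hC0 : 0 < C t := by rwa [hρ.charge_eq] at hC
  set τ := |t| + 1 with hτ
  have htτ : |t| ≤ τ := by rw [hτ]; linarith
  obtain ⟨K, hK⟩ := hρ.exists_lipschitz_pairing_self (contDiff_const (c := (1 : ℝ)))
    hψ.contDiff τ
  have hCK : ∀ s s', |s| ≤ τ → |s'| ≤ τ → |C s - C s'| ≤ K * |s - s'| := fun s s' hs hs' => by
    rw [hCdef]
    simp only
    rw [← Complex.sub_re]
    exact (Complex.abs_re_le_norm _).trans (hK s s' hs hs')
  have hcont : ContinuousAt C t := by
    have hL : LipschitzOnWith K.toNNReal C {s | |s| ≤ τ} :=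
      LipschitzOnWith.of_dist_le_mul fun s hs s' hs' => by
        rw [Real.dist_eq, Real.dist_eq]
        exact (hCK s s' hs hs').trans (mul_le_mul_of_nonneg_right (Real.le_coe_toNNReal _)
          (abs_nonneg _))
    exact hL.continuousOn.continuousAt (setOf_abs_le_mem_nhds t)
  have hS : {s | |s| ≤ τ} ∩ {s | C t / 2 < C s} ∈ 𝓝 t :=
    inter_mem (setOf_abs_le_mem_nhds t) (hcont.eventually_const_lt (half_lt_self hC0))
  obtain ⟨L, hL⟩ := exists_lipschitzOnWith_of_apply (f := barycenter ψ ρ)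
    (S := {s | |s| ≤ τ} ∩ {s | C t / 2 < C s}) fun j => by
      obtain ⟨K', hK'⟩ := hρ.exists_lipschitz_pairing_self (contDiff_coord j) hψ.contDiff τ
      set X : ℝ → ℝ := fun s => (pairing (cutWeight (fun x => x j) (ρ s)) (ψ s) (ψ s)).re with hX
      have hXK : ∀ s s', |s| ≤ τ → |s'| ≤ τ → |X s - X s'| ≤ K' * |s - s'| :=
        fun s s' hs hs' => by
          rw [hX]
          simp only
          rw [← Complex.sub_re]
          exact (Complex.abs_re_le_norm _).trans (hK' s s' hs hs')
      set c := C t / 2 with hc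
      have hc0 : 0 < c := half_pos hC0
      refine ⟨K' / c + |K| * (|X t| + |K'| * (2 * τ)) / (c * c), fun s hs s' hs' => ?_⟩
      obtain ⟨hs1, hs2⟩ := hs
      obtain ⟨hs1', hs2'⟩ := hs'
      have hCs : c < C s := hs2
      have hCs' : c < C s' := hs2'
      have hXb : |X s'| ≤ |X t| + |K'| * (2 * τ) := by
        have h1 := hXK s' t hs1' htτ
        have h2 : |s' - t| ≤ 2 * τ := (abs_sub _ _).trans (by
          have : |s'| ≤ τ := hs1'
          linarith)
        have h3 : K' * |s' - t| ≤ |K'| * (2 * τ) :=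
          mul_le_mul (le_abs_self _) h2 (abs_nonneg _) (abs_nonneg _)
        have h4 := abs_sub_abs_le_abs_sub (X s') (X t)
        linarith
      have hd := hCK s' s hs1' hs1
      rw [hρ.barycenter_apply, hρ.barycenter_apply]
      change |(C s)⁻¹ * X s - (C s')⁻¹ * X s'| ≤ _
      have e : (C s)⁻¹ * X s - (C s')⁻¹ * X s' =
          (X s - X s') / C s + (C s' - C s) * X s' / (C s * C s') := by
        have : C s ≠ 0 := (hc0.trans hCs).ne'
        have : C s' ≠ 0 := (hc0.trans hCs').ne'
        field_simp
        ring
      rw [e, add_mul]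
      refine (abs_add_le _ _).trans (add_le_add ?_ ?_)
      · rw [abs_div, abs_of_pos (hc0.trans hCs), div_mul_eq_mul_div]
        exact div_le_div₀ ((abs_nonneg _).trans (hXK s s' hs1 hs1')) (hXK s s' hs1 hs1') hc0 hCs.le
      · rw [abs_div, abs_mul, abs_of_pos (mul_pos (hc0.trans hCs) (hc0.trans hCs')),
          div_mul_eq_mul_div]
        have hd' : |C s' - C s| ≤ |K| * |s - s'| := by
          rw [abs_sub_comm s s']
          exact hd.trans (mul_le_mul_of_nonneg_right (le_abs_self _) (abs_nonneg _))
        refine div_le_div₀ (by positivity) ?_ (by positivity)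
          (mul_le_mul hCs.le hCs'.le hc0.le (hc0.trans hCs).le)
        calc |C s' - C s| * |X s'| ≤ (|K| * |s - s'|) * (|X t| + |K'| * (2 * τ)) :=
              mul_le_mul hd' hXb (abs_nonneg _) (by positivity)
          _ = _ := by ring
  exact ⟨L, _, hS, hL⟩

end Force

end Integrals

end NLSSoliton

theorem theorem2 {N : ℕ} (hN : 1 ≤ N) {m ε : ℝ} (hm : 0 < m) (hε : 0 < ε)
    {W : ℝ → ℝ} (hW : NonlinearityAssumption N W)
    {V : E N → ℝ} (hV : PotentialAssumption V)
    {ψ : ℝ → L2 N} (hψ : IsSolution m ε W V ψ)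
    {ρ : ℝ → E N → ℝ} {J : ℝ → E N → E N} (hρ : IsDensity ρ J) :
    -- all the integrals converge
    (∀ t,
      Integrable (fun x => ‖soliton ψ ρ t x‖ ^ 2) ∧
      Integrable (fun x => ‖soliton ψ ρ t x‖ ^ 2 • x) ∧
      Integrable (fun x => ‖soliton ψ ρ t x‖ ^ 2 • gradPhase (ψ t) x) ∧
      Integrable (fun x => ‖soliton ψ ρ t x‖ ^ 2 • gradient V x) ∧
      IntegrableOn (haloVelocity m ψ ρ J t) (halo ρ t) ∧
      IntegrableOn (haloForce m ε W ψ ρ J t) (halo ρ t)) ∧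
    -- the equation of the barycenter, where the soliton does not vanish
    (∀ t, 0 < mass m ψ ρ t → ∃ K, ∃ s ∈ 𝓝 t, LipschitzOnWith K (barycenter ψ ρ) s) ∧
    (∀ t, IsRegularTime ρ J t → 0 < mass m ψ ρ t → BarycenterEquation m ψ ρ J t) ∧
    -- the equation of the momentum
    LocallyLipschitz (momentum ψ ρ) ∧
    (∀ t, IsRegularTime ρ J t → MomentumEquation m ε W V ψ ρ J t) ∧
    -- both equations hold for almost all times
    (∀ᵐ t : ℝ, IsRegularTime ρ J t) :=
  ⟨fun t => ⟨hρ.integrable_soliton_sq t, .of_eval_piLp (hρ.integrable_soliton_sq_coord t),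
      .of_eval_piLp (hρ.integrable_soliton_sq_gradPhase t),
      .of_eval_piLp (hρ.integrable_soliton_sq_gradient hV.contDiff_one t),
      hρ.integrableOn_haloVelocity hm.ne' t, hρ.integrableOn_haloForce hψ hε hW hV t⟩,
    fun _ hpos => hρ.exists_lipschitzOnWith_barycenter hm hψ hpos,
    fun _ ht hpos => hρ.barycenterEquation hm hψ ht hpos,
    hρ.locallyLipschitz_momentum hψ,
    fun _ ht => hρ.momentumEquation hψ hε hW hV ht,
    hρ.ae_isRegularTime⟩
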